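/- Let $\beta>0$, let $\log$ denote the logarithm to a fixed base $a>1$, and consider the stationary memoryless channel with input alphabet $[0,\infty)$ and single-letter transition law $\mathsf Y=\mathsf x+\mathsf N$, where $\mathsf N$ is exponential with mean $1$; write $W_{\mathsf x}=P_{\mathsf Y|\mathsf X=\mathsf x}$ and $W^n_{x^n}=W_{x_1}\times\dots\times W_{x_n}$. The cost is $\mathsf b(\mathsf x)=\mathsf x$, with block cost $\mathsf b_n(x^n)=\frac1n\sum_{i=1}^n x_i$. Let $C(\beta)=\sup\{I(\mathsf X;\mathsf Y):\mathbb E[\mathsf b(\mathsf X)]\le\beta\}$. An $(n,M,\epsilon,\beta)$ code consists of a (possibly random) encoder and decoder for $M$ equiprobable messages with $\mathsf b_n(X^n)\le\beta$ almost surely and average error probability at most $\epsilon$. Let $M^\star(n,\epsilon,\beta)$ be the largest $M$ for which such a code exists, and define the dispersion-cost function $$V(\beta)=\lim_{\epsilon\to0}\limsup_{n\to\infty}\frac1n\,\frac{\bigl(nC(\beta)-\log M^\star(n,\epsilon,\beta)\bigr)^2}{2\log_e\frac1\epsilon}.$$ Then the following hold. 1. $C(\beta)=\log(1+\beta)$,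 and $C$ is differentiable at $\beta$. For all $n\ge1$ and $0<\epsilon<1$ the maximum $M^\star(n,\epsilon,\beta)$ is finite and attained, the limit defining $V(\beta)$ exists, and $V(\beta)=\frac{\beta^2}{(1+\beta)^2}\log^2e$. 2. There is exactly one output distribution $P_{\mathsf Y^\star}$ induced by an input distribution that achieves the supremum in $C(\beta)$; it is the exponential distribution with mean $1+\beta$. For every $\mathsf x\ge0$, $W_{\mathsf x}\ll P_{\mathsf Y^\star}$, and for $P_{\mathsf Y^\star}$-almost every $\mathsf y\ge\mathsf x$ the density $\frac{dW_{\mathsf x}}{dP_{\mathsf Y^\star}}(\mathsf y)$ is positive and finite and the $\mathsf b$-tilted information density is $$\jmath_{\mathsf X;\mathsf Y^\star}(\mathsf x;\mathsf y,\beta):=\log\frac{dW_{\mathsf x}}{dP_{\mathsf Y^\star}}(\mathsf y)-C'(\beta)\bigl(\mathsf b(\mathsf x)-\beta\bigr)=\log(1+\beta)+\frac{\beta}{1+\beta}(\mathsf x-\mathsf y+1)\log e,$$ while $\frac{dW_{\mathsf x}}{dP_{\mathsf Y^\star}}(\mathsf y)=0$ for $P_{\mathsf Y^\star}$-almost every $\mathsf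 y<\mathsf x$. For every input distribution $P_{\mathsf X^\star}$ achieving $C(\beta)$, under the joint law of $\mathsf X^\star$ and the corresponding output, $\jmath_{\mathsf X;\mathsf Y^\star}$ has mean $C(\beta)$ and variance $V(\beta)$; moreover, for every $\mathsf x\ge0$, its conditional variance given $\mathsf X=\mathsf x$ is $V(\beta)$. 3. Let $\mathcal F_n=\{x^n\in[0,\infty)^n:\mathsf b_n(x^n)=\beta\}$ and let $P_{Y^{n\star}}$ be the $n$-fold product of $P_{\mathsf Y^\star}$. There is a sequence of real numbers $f_n=O(1)$ (in particular $f_n=o(\sqrt n)$) such that: (a) for every $\gamma\in[\beta,\infty)$ the set $\mathsf b^{-1}(\gamma)$ is nonempty; (b) for every $n\ge1$ and $x^n\in\mathcal F_n$ one has $W^n_{x^n}\ll P_{Y^{n\star}}$, and the distribution of $\log\frac{dW^n_{x^n}}{dP_{Y^{n\star}}}(Y^n)$ under $Y^n\sim W^n_{x^n}$ does not depend on $x^n\in\mathcal F_n$; (c) for every $n\ge1$ and every $\mathsf x$ in the projection of $\mathcal F_n$ onto $[0,\infty)$, $\mathbb E\bigl[|\jmath_{\mathsf X;\mathsf Y^\star}(\mathsf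 x;\mathsf Y,\beta)-C(\beta)|^3\,\big|\,\mathsf X=\mathsf x\bigr]<\infty$; (d) for every $n\ge1$ there is a distribution $P_{X^n}$ supported on $\mathcal F_n$ whose induced output distribution $P_{Y^n}$ satisfies $P_{Y^n}\ll P_{Y^{n\star}}$ and $\log\frac{dP_{Y^n}}{dP_{Y^{n\star}}}(Y^n)\le f_n$ for $P_{Y^n}$-almost every $Y^n$. -/

import Mathlib

open MeasureTheory ProbabilityTheory Filter Topology Set
open scoped ENNReal NNReal

noncomputable section

namespace CostChannel

/-! Information quantities are measured in units set by the base `a > 1` of the logarithm. -/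

section SingleLetter

variable {A B : Type*} [MeasurableSpace A] [MeasurableSpace B]

/-- The mutual information `I(X;Y) = D(P_{XY} ‖ P_X × P_Y)`, where `X ∼ P` is the input and `Y` is
the output of the channel `W`, with logarithms to base `a`. -/
def mutualInfo (a : ℝ) (W : Kernel A B) (P : Measure A) : ℝ≥0∞ :=
  InformationTheory.klDiv (P ⊗ₘ W) (P.prod (W ∘ₘ P)) / ENNReal.ofReal (Real.log a)

/-- `P` is an input distribution of average cost at most `β`. -/
def IsFeasibleInput (b : A → ℝ≥0∞) (β : ℝ) (P : Measure A) : Prop :=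
  IsProbabilityMeasure P ∧ ∫⁻ x, b x ∂P ≤ ENNReal.ofReal β

/-- The capacity-cost function `C(β) = sup {I(X;Y) : E[b(X)] ≤ β}`. -/
def capacityCost (a : ℝ) (W : Kernel A B) (b : A → ℝ≥0∞) (β : ℝ) : ℝ≥0∞ :=
  ⨆ (P : Measure A) (_ : IsFeasibleInput b β P), mutualInfo a W P

/-- The capacity-cost function as a real-valued function. -/
def capacityReal (a : ℝ) (W : Kernel A B) (b : A → ℝ≥0∞) (β : ℝ) : ℝ :=
  (capacityCost a W b β).toReal

/-- `P` achieves the supremum that defines the capacity-cost function at `β`. -/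
def IsOptimalInput (a : ℝ) (W : Kernel A B) (b : A → ℝ≥0∞) (β : ℝ) (P : Measure A) : Prop :=
  IsFeasibleInput b β P ∧ mutualInfo a W P = capacityCost a W b β

/-- `Q` is the output distribution induced by an input distribution that achieves the supremum
in the capacity-cost function at `β`. -/
def IsOptimalOutput (a : ℝ) (W : Kernel A B) (b : A → ℝ≥0∞) (β : ℝ) (Q : Measure B) : Prop :=
  ∃ P : Measure A, IsOptimalInput a W b β P ∧ Q = W ∘ₘ P

/-- The log-likelihood ratio `log (dμ/dν)(y)` to base `a`. It is only used where `μ ≪ ν` and for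
`μ`-almost every `y`, so that the ratio is positive and finite. -/
def logRatio {Ω : Type*} [MeasurableSpace Ω] (a : ℝ) (μ ν : Measure Ω) (y : Ω) : ℝ :=
  Real.logb a (μ.rnDeriv ν y).toReal

/-- The density `(dP_{Y|X=x} / dQ)(y)`, in a version that is jointly measurable in `(x, y)`. -/
def outputDensity [MeasurableSpace.CountablyGenerated B] (W : Kernel A B) (Q : Measure B)
    (x : A) (y : B) : ℝ≥0∞ :=
  Kernel.rnDeriv W (Kernel.const A Q) x y

/-- The `b`-tilted information density
`j(x; y, β) = log (dP_{Y|X=x} / dQ)(y) - C'(β) (b(x) - β)`, where `Q` is the optimal output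
distribution at cost `β`. -/
def tiltedDensity [MeasurableSpace.CountablyGenerated B] (a : ℝ) (W : Kernel A B)
    (b : A → ℝ≥0∞) (β : ℝ) (Q : Measure B) (x : A) (y : B) : ℝ :=
  Real.logb a (outputDensity W Q x y).toReal
    - deriv (capacityReal a W b) β * ((b x).toReal - β)

end SingleLetter

section Block

variable {A B : Type*} [MeasurableSpace A] [MeasurableSpace B]

/-- The separable cost `b_n(x^n) = (1/n) ∑ b(x_i)`. -/
def blockCost (b : A → ℝ≥0∞) (n : ℕ) (x : Fin n → A) : ℝ≥0∞ :=
  (∑ i, b (x i)) / (n : ℝ≥0∞)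

/-- `n` independent uses of the channel `W`: a stationary memoryless channel. -/
def blockChannel (W : Kernel A B) [IsMarkovKernel W] (n : ℕ) :
    Kernel (Fin n → A) (Fin n → B) where
  toFun x := Measure.pi fun i => W (x i)
  measurable' := by
    refine Measurable.measure_of_isPiSystem_of_isProbabilityMeasure generateFrom_pi.symm
      isPiSystem_pi ?_
    rintro _ ⟨s, hs, rfl⟩
    simp only [Measure.pi_pi]
    refine Finset.measurable_prod _ fun i _ => ?_
    exact (Kernel.measurable_coe W (hs i (mem_univ i))).comp (measurable_pi_apply i)

/-- The set `F_n` of input words whose cost is exactly `β`. -/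
def costSurface (b : A → ℝ≥0∞) (β : ℝ) (n : ℕ) : Set (Fin n → A) :=
  {x | blockCost b n x = ENNReal.ofReal β}

/-- There is an `(n, M, ε, β)` code: a random encoder and a random decoder for `M` equiprobable
messages whose codewords have cost at most `β` almost surely, and whose average error probability
is at most `ε`. -/
def CodeExists (W : Kernel A B) [IsMarkovKernel W] (b : A → ℝ≥0∞) (n M : ℕ) (ε β : ℝ) : Prop :=
  ∃ (enc : Kernel (Fin M) (Fin n → A)) (dec : Kernel (Fin n → B) (Fin M)),
    IsMarkovKernel enc ∧ IsMarkovKernel dec ∧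
    (∀ m, ∀ᵐ x ∂(enc m), blockCost b n x ≤ ENNReal.ofReal β) ∧
    (∑ m, (dec ∘ₖ blockChannel W n ∘ₖ enc) m {m}ᶜ) / (M : ℝ≥0∞) ≤ ENNReal.ofReal ε

/-- The maximum code size `M⋆(n, ε, β)`. -/
def maxCodeSize (W : Kernel A B) [IsMarkovKernel W] (b : A → ℝ≥0∞) (n : ℕ) (ε β : ℝ) : ℕ :=
  sSup {M : ℕ | CodeExists W b n M ε β}

/-- `V` is the dispersion-cost function at `β`:
`V = lim_{ε → 0} limsup_n (1/n) (n C(β) - log M⋆(n, ε, β))² / (2 ln (1/ε))`.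
The upper limit is taken in the extended reals. -/
def IsDispersion (a : ℝ) (W : Kernel A B) [IsMarkovKernel W] (b : A → ℝ≥0∞) (β V : ℝ) : Prop :=
  Tendsto
    (fun ε : ℝ => limsup
      (fun n : ℕ =>
        ((1 / (n : ℝ) *
          ((n * capacityReal a W b β - Real.logb a (maxCodeSize W b n ε β)) ^ 2 /
            (2 * Real.log (1 / ε))) : ℝ) : EReal))
      atTop)
    (𝓝[>] 0) (𝓝 (V : EReal))

/-- The regularity conditions on a stationary memoryless channel `W` with separable cost generated
by `b`, with optimal output distribution `Q` at cost `β` and with the bounding sequence `f`. -/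
structure AbstractAlphabetConditions [MeasurableSpace.CountablyGenerated B] (a : ℝ)
    (W : Kernel A B) [IsMarkovKernel W] (b : A → ℝ≥0∞) (β : ℝ) (Q : Measure B)
    (f : ℕ → ℝ) : Prop where
  /-- every cost value in `[β, ∞)` is attained -/
  cost_surj : ∀ γ : ℝ, β ≤ γ → (b ⁻¹' {ENNReal.ofReal γ}).Nonempty
  /-- on `F_n` the output law has a density with respect to the product of copies of `Q` ... -/
  abs_cont : ∀ n : ℕ, 1 ≤ n → ∀ x ∈ costSurface b β n,
    blockChannel W n x ≪ Measure.pi (fun _ : Fin n => Q)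
  /-- ... and the law of the information density is the same for all words in `F_n` -/
  symmetry : ∀ n : ℕ, 1 ≤ n → ∀ x ∈ costSurface b β n, ∀ x' ∈ costSurface b β n,
    (blockChannel W n x).map
        (logRatio a (blockChannel W n x) (Measure.pi fun _ : Fin n => Q)) =
      (blockChannel W n x').map
        (logRatio a (blockChannel W n x') (Measure.pi fun _ : Fin n => Q))
  /-- finite third absolute moments on the projections of the sets `F_n` -/
  third_moment : ∀ n : ℕ, ∀ x ∈ costSurface b β (n + 1),
    ∫⁻ y, ENNReal.ofReal (|tiltedDensity a W b β Q (x 0) y - capacityReal a W b β| ^ 3)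
      ∂(W (x 0)) < ∞
  /-- some input distribution supported on `F_n` induces an output distribution whose
  log-likelihood ratio with respect to the product of copies of `Q` is bounded by `f n` -/
  ratio_bound : ∀ n : ℕ, 1 ≤ n → ∃ P : Measure (Fin n → A), IsProbabilityMeasure P ∧
    (∀ᵐ x ∂P, x ∈ costSurface b β n) ∧
    (blockChannel W n ∘ₘ P) ≪ Measure.pi (fun _ : Fin n => Q) ∧
    ∀ᵐ y ∂(blockChannel W n ∘ₘ P),
      logRatio a (blockChannel W n ∘ₘ P) (Measure.pi fun _ : Fin n => Q) y ≤ f n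
  /-- the bounding sequence is negligible with respect to `√n` -/
  bound_small : f =o[atTop] fun n : ℕ => Real.sqrt n

end Block

/-- The additive exponential noise channel: on input `x ≥ 0` the output is `x + N`, where `N` is
exponential with mean one. -/
def expChannel : Kernel ℝ≥0 ℝ :=
  (Kernel.id ×ₖ Kernel.const ℝ≥0 (expMeasure 1)).map fun p : ℝ≥0 × ℝ => (p.1 : ℝ) + p.2

instance : IsMarkovKernel expChannel := by
  have : IsProbabilityMeasure (expMeasure 1) := isProbabilityMeasure_expMeasure one_pos
  exact Kernel.IsMarkovKernel.map _ (by fun_prop)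

/-- The cost `b(x) = x`. -/
def expCost (x : ℝ≥0) : ℝ≥0∞ := x

/-- The law of the output given the input `x` is the law of `x + N`. -/
theorem expChannel_apply (x : ℝ≥0) :
    expChannel x = (expMeasure 1).map fun z => (x : ℝ) + z := by
  have : IsProbabilityMeasure (expMeasure 1) := isProbabilityMeasure_expMeasure one_pos
  rw [expChannel, Kernel.map_apply _ (by fun_prop), Kernel.prod_apply, Kernel.id_apply,
    Kernel.const_apply, Measure.dirac_prod, Measure.map_map (by fun_prop) (by fun_prop)]
  rfl

end CostChannel

end

noncomputable section

namespace CostChannel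

/-! ### Exponential laws: density, integrals and moments. -/

section ExponentialLaw

/-! Let Q be the exponential law of mean 1 + β and l = β/(1+β). On y ≥ x the channel density
relative to Q is (1+β) exp(x − l y). For a block it depends on the word only through its sum and the
support condition x ≤ y. With y = x + z its natural logarithm is n ln(1+β) + (Σx)/(1+β) − l Σz,
where z is the noise. The total noise therefore governs the coding problem, and its fluctuations are
Gaussian on the scale √n.

Capacity. The divergence of the channel from Q, averaged over an input, is ln(1+β) + (E X − β)/(1+β)
nats (`klDiv_compProd_exp`). By the compensation identity it equals the mutual information plus the
divergence of the output law from Q. This bounds C(β) and forces the output law of any optimal input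
to be Q; `expInput` attains the bound because its output law is Q (`comp_expInput`). The tilt
removes the dependence on x, so the tilted density is an affine function of the noise alone.

Dispersion. Let F be the distribution function of the total noise and γ the likelihood ratio at
noise level c. The meta-converse gives M(1 − ε − F(c)) ≤ γ (`CodeExists.mul_le`). Conversely, greedy
selection of codewords produces about γ messages (`codeExists_of_dominated`), provided some input on
the cost surface has output law at most K times the product of copies of Q. With c = n + t√n the
central limit theorem gives a loss of l t √n up to a constant, for t on either side of the normal
quantile of 1 − ε. That quantile is √(2 ln(1/ε)) up to bounded error, so the limit in ε is l² nats
squared.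

The domination with K independent of n (`exists_input_dominated`) is the hard point. Words are drawn
from the product of copies of `expInput`, conditioned on a sum in a bounded window, and completed by
one letter to the exact cost. The conditioning event has probability at least a constant over √m, by
a local limit theorem. The output density requires an upper bound of the same order for words below
y with sum in the window. Exponential tilting and Gaussian smoothing turn this into an integral of
truncated transforms, whose decay is measured by `truncationDeficit`. The factors √m cancel. -/

theorem expMeasure_eq_withDensity (r : ℝ) :
    expMeasure r = volume.withDensity
      ((Ici (0 : ℝ)).indicator fun x => ENNReal.ofReal (r * Real.exp (-(r * x)))) := by
  change volume.withDensity (exponentialPDF r) = _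
  congr 1
  ext x
  rw [exponentialPDF_eq]
  by_cases hx : 0 ≤ x
  · simp [hx]
  · simp [hx]

theorem lintegral_expMeasure (r : ℝ) {f : ℝ → ℝ≥0∞} (hf : Measurable f) :
    ∫⁻ x, f x ∂(expMeasure r) =
      ∫⁻ x in Ici 0, ENNReal.ofReal (r * Real.exp (-(r * x))) * f x := by
  rw [expMeasure_eq_withDensity, lintegral_withDensity_eq_lintegral_mul _ _ hf,
    ← lintegral_indicator measurableSet_Ici]
  · refine lintegral_congr fun x => ?_
    by_cases hx : 0 ≤ x <;> simp [hx]
  · exact Measurable.indicator (by fun_prop) measurableSet_Ici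

theorem integral_expMeasure {E : Type*} [NormedAddCommGroup E] [NormedSpace ℝ E]
    {r : ℝ} (hr : 0 < r) (f : ℝ → E) :
    ∫ x, f x ∂(expMeasure r) = ∫ x in Ioi 0, (r * Real.exp (-(r * x))) • f x := by
  rw [expMeasure_eq_withDensity, integral_withDensity_eq_integral_toReal_smul,
    ← integral_Ici_eq_integral_Ioi, ← integral_indicator measurableSet_Ici]
  · refine integral_congr_ae (ae_of_all _ fun x => ?_)
    by_cases hx : 0 ≤ x
    · simp [hx, ENNReal.toReal_ofReal (show 0 ≤ r * Real.exp (-(r * x)) by positivity)]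
    · simp [hx]
  · exact Measurable.indicator (by fun_prop) measurableSet_Ici
  · refine ae_of_all _ fun x => ?_
    by_cases hx : 0 ≤ x <;> simp [hx]

theorem integrable_expMeasure_iff {E : Type*} [NormedAddCommGroup E] [NormedSpace ℝ E]
    {r : ℝ} (hr : 0 < r) (f : ℝ → E) :
    Integrable f (expMeasure r) ↔
      IntegrableOn (fun x => (r * Real.exp (-(r * x))) • f x) (Ioi 0) := by
  rw [expMeasure_eq_withDensity, integrable_withDensity_iff_integrable_smul',
    ← integrableOn_Ici_iff_integrableOn_Ioi, ← integrable_indicator_iff measurableSet_Ici]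
  · refine integrable_congr (ae_of_all _ fun x => ?_)
    by_cases hx : 0 ≤ x
    · simp [hx, ENNReal.toReal_ofReal (show 0 ≤ r * Real.exp (-(r * x)) by positivity)]
    · simp [hx]
  · exact Measurable.indicator (by fun_prop) measurableSet_Ici
  · refine ae_of_all _ fun x => ?_
    by_cases hx : 0 ≤ x <;> simp [hx]

theorem ae_nonneg_expMeasure (r : ℝ) : ∀ᵐ x ∂(expMeasure r), 0 ≤ x := by
  rw [expMeasure_eq_withDensity, ae_withDensity_iff
    (Measurable.indicator (by fun_prop) measurableSet_Ici)]
  refine ae_of_all _ fun x hx => ?_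
  by_contra h
  simp [h] at hx

theorem integrable_pow_expMeasure {r : ℝ} (hr : 0 < r) (k : ℕ) :
    Integrable (fun x => x ^ k) (expMeasure r) := by
  rw [integrable_expMeasure_iff hr]
  have h := (integrableOn_rpow_mul_exp_neg_mul_rpow (p := 1) (s := k) (b := r)
    (by have : (0 : ℝ) ≤ k := by positivity
        linarith) one_pos hr).const_mul r
  refine h.congr (ae_of_all _ fun x => ?_)
  simp only [Real.rpow_one, Real.rpow_natCast, smul_eq_mul, neg_mul]
  ring

theorem integral_pow_expMeasure {r : ℝ} (hr : 0 < r) (k : ℕ) :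
    ∫ x, x ^ k ∂(expMeasure r) = (k.factorial : ℝ) / r ^ k := by
  rw [integral_expMeasure hr]
  have h := Real.integral_rpow_mul_exp_neg_mul_Ioi (a := k + 1) (r := r) (by positivity) hr
  have e : ∫ x in Ioi (0 : ℝ), (r * Real.exp (-(r * x))) • x ^ k =
      r * ∫ x in Ioi (0 : ℝ), x ^ ((k : ℝ) + 1 - 1) * Real.exp (-(r * x)) := by
    rw [← integral_const_mul]
    refine integral_congr_ae (ae_of_all _ fun x => ?_)
    simp only [add_sub_cancel_right, Real.rpow_natCast, smul_eq_mul]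
    ring
  rw [e, h, Real.Gamma_nat_eq_factorial]
  have : (1 / r) ^ ((k : ℝ) + 1) = (1 / r) ^ (k + 1) := by
    rw [← Real.rpow_natCast]; push_cast; rfl
  rw [this, one_div, inv_pow, pow_succ]
  field_simp

end ExponentialLaw

/-! ### The single-letter density relative to the optimal output law. -/

section SingleLetterDensity

/-- The density of the law of the output given the input `x` with respect to the exponential
distribution with mean `1 + β`. -/
def expDensity (β : ℝ) (x : ℝ≥0) (y : ℝ) : ℝ≥0∞ :=
  if (x : ℝ) ≤ y then ENNReal.ofReal ((1 + β) * Real.exp (x - β / (1 + β) * y)) else 0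

theorem measurable_expDensity (β : ℝ) : Measurable (Function.uncurry (expDensity β)) := by
  unfold expDensity
  refine Measurable.ite ?_ (by fun_prop) measurable_const
  exact measurableSet_le (by fun_prop) (by fun_prop)

theorem measurable_expDensity_right (β : ℝ) (x : ℝ≥0) : Measurable (expDensity β x) :=
  (measurable_expDensity β).comp measurable_prodMk_left

theorem isProbabilityMeasure_exp {β : ℝ} (hβ : 0 < β) :
    IsProbabilityMeasure (expMeasure (1 / (1 + β))) :=
  isProbabilityMeasure_expMeasure (by positivity)

/-- The quotient of exp(−(y − x)) by exp(−y/(1+β))/(1+β) is `expDensity`; translation invariance of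
Lebesgue measure moves the noise by x. -/
theorem expChannel_eq_withDensity {β : ℝ} (hβ : 0 < β) (x : ℝ≥0) :
    expChannel x = (expMeasure (1 / (1 + β))).withDensity (expDensity β x) := by
  rw [expChannel_apply]
  ext s hs
  rw [Measure.map_apply (by fun_prop) hs, withDensity_apply _ hs,
    ← lintegral_indicator_one (hs.preimage (by fun_prop)), ← lintegral_indicator hs,
    lintegral_expMeasure _ (measurable_one.indicator (hs.preimage (by fun_prop))),
    lintegral_expMeasure _ ((measurable_expDensity_right β x).indicator hs),
    ← lintegral_indicator measurableSet_Ici, ← lintegral_indicator measurableSet_Ici,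
    ← lintegral_add_left_eq_self (μ := volume) (fun y => (Ici (0 : ℝ)).indicator (fun y =>
      ENNReal.ofReal (1 / (1 + β) * Real.exp (-(1 / (1 + β) * y))) *
        s.indicator (expDensity β x) y) y) (x : ℝ)]
  refine lintegral_congr fun z => ?_
  have hx : (0 : ℝ) ≤ x := x.2
  by_cases hz : 0 ≤ z
  · have h1 : 0 ≤ (x : ℝ) + z := by positivity
    by_cases hs' : (x : ℝ) + z ∈ s
    · simp only [mem_Ici, hz, h1, indicator_of_mem, hs', mem_preimage, Pi.one_apply, expDensity,
        le_add_iff_nonneg_right, if_true]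
      rw [mul_one, ← ENNReal.ofReal_mul (by positivity)]
      congr 1
      have h2 : Real.exp (-(1 * z)) = Real.exp (-(1 / (1 + β) * (x + z))) *
          Real.exp (x - β / (1 + β) * (x + z)) := by
        rw [← Real.exp_add]
        congr 1
        field_simp
        ring
      rw [h2]
      field_simp
    · simp [hz, h1, hs']
  · have : ¬ ((x : ℝ) ≤ x + z) := by linarith
    by_cases h1 : 0 ≤ (x : ℝ) + z
    · rw [indicator_of_notMem (by simpa using hz), indicator_of_mem (by simpa using h1)]
      by_cases hs' : (x : ℝ) + z ∈ s <;> simp [hz, hs', expDensity]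
    · simp [hz, h1]

theorem expChannel_absolutelyContinuous {β : ℝ} (hβ : 0 < β) (x : ℝ≥0) :
    expChannel x ≪ expMeasure (1 / (1 + β)) := by
  rw [expChannel_eq_withDensity hβ]
  exact withDensity_absolutelyContinuous _ _

theorem ae_le_expChannel (x : ℝ≥0) : ∀ᵐ y ∂(expChannel x), (x : ℝ) ≤ y := by
  rw [expChannel_apply, ae_map_iff (by fun_prop) measurableSet_Ici]
  filter_upwards [ae_nonneg_expMeasure 1] with z hz
  simpa using hz

theorem outputDensity_ae_eq {β : ℝ} (hβ : 0 < β) (x : ℝ≥0) :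
    outputDensity expChannel (expMeasure (1 / (1 + β))) x
      =ᵐ[expMeasure (1 / (1 + β))] expDensity β x := by
  have := isProbabilityMeasure_exp hβ
  have h1 := Kernel.rnDeriv_eq_rnDeriv_measure (κ := expChannel)
    (η := Kernel.const ℝ≥0 (expMeasure (1 / (1 + β)))) (a := x)
  rw [Kernel.const_apply] at h1
  have h2 := Measure.rnDeriv_withDensity (expMeasure (1 / (1 + β)))
    (measurable_expDensity_right β x)
  rw [← expChannel_eq_withDensity hβ] at h2
  exact h1.trans h2

theorem measurable_outputDensity (Q : Measure ℝ) :
    Measurable fun p : ℝ≥0 × ℝ => outputDensity expChannel Q p.1 p.2 :=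
  Kernel.measurable_rnDeriv _ _

end SingleLetterDensity

/-! ### The capacity-achieving input and its truncated transforms. -/

section CapacityAchievingInput

/-- The input distribution achieving the capacity-cost function at `β`: a mixture of an atom at
zero and an exponential distribution with mean `1 + β`. -/
def expInput (β : ℝ) : Measure ℝ≥0 :=
  (ENNReal.ofReal (1 / (1 + β)) • Measure.dirac 0 +
    ENNReal.ofReal (β / (1 + β)) • expMeasure (1 / (1 + β))).map Real.toNNReal

theorem lintegral_expInput (β : ℝ) {f : ℝ≥0 → ℝ≥0∞} (hf : Measurable f) :
    ∫⁻ x, f x ∂(expInput β) = ENNReal.ofReal (1 / (1 + β)) * f 0 +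
      ENNReal.ofReal (β / (1 + β)) * ∫⁻ x, f x.toNNReal ∂(expMeasure (1 / (1 + β))) := by
  rw [expInput, lintegral_map hf (by fun_prop), lintegral_add_measure, lintegral_smul_measure,
    lintegral_smul_measure, lintegral_dirac' _ (by fun_prop)]
  simp

theorem isProbabilityMeasure_expInput {β : ℝ} (hβ : 0 < β) :
    IsProbabilityMeasure (expInput β) := by
  have := isProbabilityMeasure_exp hβ
  constructor
  rw [← lintegral_one, lintegral_expInput _ measurable_const]
  simp only [lintegral_one, measure_univ, mul_one]
  rw [← ENNReal.ofReal_add (by positivity) (by positivity), ← ENNReal.ofReal_one]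
  congr 1
  field_simp

theorem integrable_expInput {E : Type*} [NormedAddCommGroup E] [NormedSpace ℝ E]
    {β : ℝ} {f : ℝ → E} (hm : StronglyMeasurable f)
    (hf : Integrable f (expMeasure (1 / (1 + β)))) :
    Integrable (fun x : ℝ≥0 => f x) (expInput β) := by
  have hm' : StronglyMeasurable (fun x : ℝ≥0 => f x) := hm.comp_measurable (by fun_prop)
  rw [expInput, integrable_map_measure hm'.aestronglyMeasurable (by fun_prop)]
  refine Integrable.add_measure (Integrable.smul_measure ?_ (by simp))
    (Integrable.smul_measure ?_ (by simp))
  · exact integrable_dirac (by simp)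
  · refine hf.congr ?_
    filter_upwards [ae_nonneg_expMeasure _] with x hx
    simp [hx]

theorem integral_expInput {E : Type*} [NormedAddCommGroup E] [NormedSpace ℝ E] [CompleteSpace E]
    {β : ℝ} (hβ : 0 < β) {f : ℝ → E} (hm : StronglyMeasurable f)
    (hf : Integrable f (expMeasure (1 / (1 + β)))) :
    ∫ x : ℝ≥0, f x ∂(expInput β) = (1 / (1 + β)) • f 0 +
      (β / (1 + β)) • ∫ x, f x ∂(expMeasure (1 / (1 + β))) := by
  have hm' : StronglyMeasurable (fun x : ℝ≥0 => f x) := hm.comp_measurable (by fun_prop)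
  have hae : (fun x : ℝ => f (x.toNNReal : ℝ)) =ᵐ[expMeasure (1 / (1 + β))] f := by
    filter_upwards [ae_nonneg_expMeasure _] with x hx
    simp [hx]
  rw [expInput, integral_map (by fun_prop) hm'.aestronglyMeasurable,
    integral_add_measure, integral_smul_measure, integral_smul_measure, integral_dirac,
    integral_congr_ae hae, ENNReal.toReal_ofReal (by positivity),
    ENNReal.toReal_ofReal (by positivity)]
  · simp
  · exact Integrable.smul_measure (integrable_dirac (by simp)) (by simp)
  · exact Integrable.smul_measure (hf.congr hae.symm) (by simp)

/-- The truncated exponential integrals of the capacity-achieving input distribution. -/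
theorem integral_expInput_truncated {β : ℝ} (hβ : 0 < β) {y : ℝ} (hy : 0 ≤ y) (t : ℝ) :
    ∫ x : ℝ≥0, (if (x : ℝ) ≤ y then Complex.exp ((1 + t * Complex.I) * (x : ℝ)) else 0)
        ∂(expInput β) =
      1 / (1 + β) * ((t * Complex.I + (β / (1 + β) : ℝ) *
        Complex.exp (((β / (1 + β) : ℝ) + t * Complex.I) * y)) /
          ((β / (1 + β) : ℝ) + t * Complex.I)) := by
  have := isProbabilityMeasure_exp hβ
  have hr : 0 < 1 / (1 + β) := by positivity
  have hm : StronglyMeasurable fun x : ℝ =>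
      (if x ≤ y then Complex.exp ((1 + t * Complex.I) * x) else 0) :=
    (Measurable.ite measurableSet_Iic (by fun_prop) measurable_const).stronglyMeasurable
  have hc : ((β / (1 + β) : ℝ) + t * Complex.I : ℂ) ≠ 0 := by
    intro h
    have h0 : 0 < β / (1 + β) := by positivity
    have := congrArg Complex.re h
    simp only [Complex.add_re, Complex.ofReal_re, Complex.mul_re, Complex.I_re, mul_zero,
      Complex.ofReal_im, Complex.I_im, mul_one, sub_self, add_zero, Complex.zero_re] at this
    exact h0.ne' this
  rw [integral_expInput hβ (f := fun x : ℝ =>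
      (if x ≤ y then Complex.exp ((1 + t * Complex.I) * x) else 0)) hm]
  · rw [integral_expMeasure hr]
    -- The tilt exp(x) against the density rate 1/(1+β) leaves the exponent β/(1+β) + it, and the
    -- truncation makes the domain [0, y].
    have e : ∫ x in Ioi (0 : ℝ), (1 / (1 + β) * Real.exp (-(1 / (1 + β) * x))) •
          (if x ≤ y then Complex.exp ((1 + t * Complex.I) * x) else 0) =
        ∫ x in (0 : ℝ)..y, (1 / (1 + β) : ℝ) *
          Complex.exp (((β / (1 + β) : ℝ) + t * Complex.I) * x) := by
      rw [intervalIntegral.integral_of_le hy, ← Ioi_inter_Iic,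
        ← integral_indicator measurableSet_Ioi,
        ← integral_indicator (measurableSet_Ioi.inter measurableSet_Iic)]
      refine integral_congr_ae (ae_of_all _ fun x => ?_)
      by_cases h0 : 0 < x <;> by_cases h1 : x ≤ y <;> simp [indicator, h0, h1]
      rw [mul_assoc, ← Complex.exp_add]
      congr 2
      have : (1 + β : ℂ) ≠ 0 := by
        have : (1 + β : ℝ) ≠ 0 := by positivity
        exact_mod_cast this
      field_simp
      ring
    rw [e, intervalIntegral.integral_const_mul, integral_exp_mul_complex hc, if_pos hy]
    have h1 : (1 + β : ℂ) ≠ 0 := by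
      have : (1 + β : ℝ) ≠ 0 := by positivity
      exact_mod_cast this
    simp only [Complex.real_smul]
    push_cast at hc ⊢
    simp only [mul_zero, Complex.exp_zero]
    generalize Complex.exp ((β / (1 + β) + t * Complex.I) * y) = E at *
    clear e hm
    generalize (t * Complex.I : ℂ) = τ at *
    have h2 : (β + (1 + β) * τ : ℂ) ≠ 0 := by
      have := mul_ne_zero h1 hc
      rwa [mul_add, mul_div_cancel₀ _ h1] at this
    have h3 : (β / (1 + β) + τ : ℂ) = (β + (1 + β) * τ) / (1 + β) := by
      field_simp
    rw [h3]
    field_simp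
    ring
  · refine Integrable.mono' (integrable_const (Real.exp y)) hm.aestronglyMeasurable ?_
    refine ae_of_all _ fun x => ?_
    by_cases h : x ≤ y
    · simp [h, Complex.norm_exp]
    · simp [h]; positivity

end CapacityAchievingInput

/-! ### Gaussian smoothing of sums by Fourier transform. -/

section GaussianSmoothing

/-- The Gaussian as a mixture of characters: a Gaussian weight on a sum of independent letters
thereby factorises under the integral over t. -/
theorem exp_neg_sq_eq_integral_gaussianReal (s : ℝ≥0) (x : ℝ) :
    Complex.exp (-(s * x ^ 2 / 2)) =
      ∫ t, Complex.exp (t * x * Complex.I) ∂(gaussianReal 0 s) := by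
  have h := charFun_gaussianReal (μ := 0) (v := s) x
  rw [charFun_apply_real] at h
  simp only [Complex.ofReal_zero, mul_zero, zero_mul, zero_sub] at h
  rw [← h]
  exact integral_congr_ae (ae_of_all _ fun t => by ring_nf)

/-- Gaussian smoothing of a sum of independent variables, expressed through their (weighted)
characteristic functions. -/
theorem integral_pi_mul_exp_neg_sq {X : Type*} [MeasurableSpace X] (μ : Measure X)
    [SigmaFinite μ] {m : ℕ} {f : Fin m → X → ℂ} (hf : ∀ i, Integrable (f i) μ)
    {g : X → ℝ} (hg : Measurable g) (s : ℝ≥0) (d : ℝ) :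
    ∫ z, (∏ i, f i (z i)) * Complex.exp (-(s * ((∑ i, g (z i) - d : ℝ) : ℂ) ^ 2 / 2))
        ∂(Measure.pi fun _ : Fin m => μ) =
      ∫ t, Complex.exp (-(t * d * Complex.I)) *
        ∏ i, ∫ x, f i x * Complex.exp (t * g x * Complex.I) ∂μ ∂(gaussianReal 0 s) := by
  have hF : Integrable (fun z : Fin m → X => ∏ i, f i (z i)) (Measure.pi fun _ : Fin m => μ) :=
    Integrable.fintype_prod hf
  have hgm : Measurable fun z : Fin m → X => ∑ i, g (z i) - d := by fun_prop
  have hI : Integrable (fun p : (Fin m → X) × ℝ => (∏ i, f i (p.1 i)) *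
      Complex.exp (p.2 * ((∑ i, g (p.1 i) - d : ℝ) : ℂ) * Complex.I))
      ((Measure.pi fun _ : Fin m => μ).prod (gaussianReal 0 s)) := by
    have h1 : Integrable (fun p : (Fin m → X) × ℝ => (∏ i, f i (p.1 i)) * (1 : ℂ))
        ((Measure.pi fun _ : Fin m => μ).prod (gaussianReal 0 s)) :=
      Integrable.mul_prod hF (integrable_const (1 : ℂ))
    refine Integrable.mono (g := fun p : (Fin m → X) × ℝ => (∏ i, f i (p.1 i)) * (1 : ℂ)) h1 ?_ ?_
    · refine AEStronglyMeasurable.mul ?_ ?_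
      · simpa using h1.aestronglyMeasurable
      · refine Measurable.aestronglyMeasurable ?_
        have : Measurable fun p : (Fin m → X) × ℝ => ∑ i, g (p.1 i) - d :=
          hgm.comp measurable_fst
        fun_prop
    · refine ae_of_all _ fun p => ?_
      rw [norm_mul, norm_mul, ← Complex.ofReal_mul, Complex.norm_exp_ofReal_mul_I, norm_one]
  calc _ = ∫ z, ∫ t, (∏ i, f i (z i)) *
        Complex.exp (t * ((∑ i, g (z i) - d : ℝ) : ℂ) * Complex.I) ∂(gaussianReal 0 s)
        ∂(Measure.pi fun _ : Fin m => μ) := by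
        refine integral_congr_ae (ae_of_all _ fun z => ?_)
        simp only
        rw [integral_const_mul, ← exp_neg_sq_eq_integral_gaussianReal]
    _ = ∫ t, ∫ z, (∏ i, f i (z i)) *
        Complex.exp (t * ((∑ i, g (z i) - d : ℝ) : ℂ) * Complex.I)
        ∂(Measure.pi fun _ : Fin m => μ) ∂(gaussianReal 0 s) :=
        integral_integral_swap hI
    _ = _ := by
        refine integral_congr_ae (ae_of_all _ fun t => ?_)
        simp only
        rw [← integral_fintype_prod_eq_prod (fun (i : Fin m) x =>
          f i x * Complex.exp (t * g x * Complex.I)), ← integral_const_mul]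
        refine integral_congr_ae (ae_of_all _ fun z => ?_)
        simp only
        rw [Finset.prod_mul_distrib, ← Complex.exp_sum, mul_left_comm, ← Complex.exp_add]
        congr 2
        push_cast
        rw [← Finset.sum_mul, ← Finset.mul_sum]
        ring

end GaussianSmoothing

/-! ### A smoothed local limit theorem. -/

section LocalLimit

theorem integrable_one_div_one_add_sq (c : ℝ) : Integrable fun u : ℝ => c / (1 + u ^ 2) := by
  simpa [div_eq_mul_inv] using integrable_inv_one_add_sq.const_mul c

/-- A domination for the rescaled characteristic functions in the local limit theorem. -/
theorem exp_neg_scaled_le {a s : ℝ} (ha : 0 < a) (hs : 0 < s) {m : ℕ} (hm : 1 ≤ m) (u : ℝ) :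
    Real.exp (-(a * ((√m)⁻¹ * u) ^ 2 / (1 + ((√m)⁻¹ * u) ^ 2))) ^ m *
        Real.exp (-(((√m)⁻¹ * u) ^ 2 / (2 * s))) ≤
      Real.exp (-(a / 2) * u ^ 2) + 2 * (4 / a ^ 2 + s / a) / (1 + u ^ 2) := by
  have hm' : (1 : ℝ) ≤ m := by exact_mod_cast hm
  have hm0 : (0 : ℝ) < m := by linarith
  have e : ((√m)⁻¹ * u) ^ 2 = u ^ 2 / m := by
    rw [mul_pow, inv_pow, Real.sq_sqrt hm0.le]; field_simp
  rw [e, ← Real.exp_nat_mul, ← Real.exp_add]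
  have e2 : a * (u ^ 2 / m) / (1 + u ^ 2 / m) = a * u ^ 2 / (m + u ^ 2) := by field_simp
  rw [e2]
  -- In the central range the characteristic function alone gives Gaussian decay. Beyond it, its
  -- m-th power contributes only exp(−a m / 2), and the smoothing factor must supply the decay in u.
  by_cases h : u ^ 2 ≤ m
  · have h1 : a / 2 * u ^ 2 ≤ m * (a * u ^ 2 / (m + u ^ 2)) := by
      rw [mul_div_assoc', le_div_iff₀ (by positivity)]
      nlinarith [mul_nonneg ha.le (sq_nonneg u)]
    have h2 : 0 ≤ u ^ 2 / m / (2 * s) := by positivity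
    have h3 : 0 ≤ 2 * (4 / a ^ 2 + s / a) / (1 + u ^ 2) := by positivity
    have : Real.exp (m * -(a * u ^ 2 / (m + u ^ 2)) + -(u ^ 2 / m / (2 * s))) ≤
        Real.exp (-(a / 2) * u ^ 2) := Real.exp_le_exp.2 (by linarith)
    linarith
  · push Not at h
    have h1 : a / 2 * m ≤ m * (a * u ^ 2 / (m + u ^ 2)) := by
      rw [mul_div_assoc', le_div_iff₀ (by positivity)]
      nlinarith [mul_nonneg ha.le hm0.le, mul_pos ha hm0]
    set x := a / 2 * m + u ^ 2 / m / (2 * s) with hx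
    have hx0 : 0 < x := by positivity
    have h4 : Real.exp (m * -(a * u ^ 2 / (m + u ^ 2)) + -(u ^ 2 / m / (2 * s))) ≤
        Real.exp (-x) := Real.exp_le_exp.2 (by linarith)
    have h5 : x ^ 2 / 2 ≤ Real.exp x := by
      have := Real.quadratic_le_exp_of_nonneg hx0.le
      linarith
    have h6 : 1 ≤ 4 / a ^ 2 * x ^ 2 := by
      rw [div_mul_eq_mul_div, le_div_iff₀ (by positivity)]
      have : a / 2 ≤ x := by
        have : 0 ≤ u ^ 2 / m / (2 * s) := by positivity
        nlinarith
      nlinarith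
    -- The arithmetic-geometric mean inequality: the product of the two summands of x is free of m.
    have h7 : u ^ 2 ≤ s / a * x ^ 2 := by
      have : x ^ 2 ≥ 4 * (a / 2 * m) * (u ^ 2 / m / (2 * s)) := by
        nlinarith [sq_nonneg (a / 2 * m - u ^ 2 / m / (2 * s))]
      have e3 : 4 * (a / 2 * m) * (u ^ 2 / m / (2 * s)) = a / s * u ^ 2 := by field_simp; ring
      rw [e3] at this
      calc u ^ 2 = s / a * (a / s * u ^ 2) := by field_simp
        _ ≤ _ := by gcongr
    have h8 : Real.exp (-x) ≤ 2 * (4 / a ^ 2 + s / a) / (1 + u ^ 2) := by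
      rw [Real.exp_neg, inv_eq_one_div, div_le_div_iff₀ (Real.exp_pos x) (by positivity)]
      have : 1 + u ^ 2 ≤ (4 / a ^ 2 + s / a) * x ^ 2 := by nlinarith
      have h9 : 0 ≤ 4 / a ^ 2 + s / a := by positivity
      nlinarith
    have := Real.exp_pos (-(a / 2) * u ^ 2)
    linarith

/-- A local limit theorem for Gaussian-smoothed sums of independent standardized variables. -/
theorem tendsto_sqrt_mul_integral_exp_neg_sq {X : Type*} [MeasurableSpace X] (μ : Measure X)
    [IsProbabilityMeasure μ] {g : X → ℝ} (hg : Measurable g) (h0 : ∫ x, g x ∂μ = 0)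
    (h1 : ∫ x, g x ^ 2 ∂μ = 1) {a : ℝ} (ha : 0 < a)
    (hchar : ∀ t : ℝ, ‖charFun (μ.map g) t‖ ≤ Real.exp (-(a * t ^ 2 / (1 + t ^ 2))))
    {s : ℝ≥0} (hs : 0 < s) (d : ℝ) :
    Tendsto (fun m : ℕ => √m * ∫ z, Real.exp (-(s * (∑ i, g (z i) - d) ^ 2 / 2))
      ∂(Measure.pi fun _ : Fin m => μ)) atTop (𝓝 (1 / √s)) := by
  set φ := charFun (μ.map g) with hφ
  have hs' : (0 : ℝ) < s := hs
  -- Substituting t = u/√m in the Fourier representation absorbs the factor √m, so that dominated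
  -- convergence applies to the integral in u.
  have key : ∀ m : ℕ, 1 ≤ m → ((√m * ∫ z, Real.exp (-(s * (∑ i, g (z i) - d) ^ 2 / 2))
      ∂(Measure.pi fun _ : Fin m => μ) : ℝ) : ℂ) = ((√(2 * Real.pi * s))⁻¹ : ℝ) *
        ∫ u : ℝ, (Real.exp (-(((√m)⁻¹ * u) ^ 2 / (2 * s))) : ℂ) *
          (Complex.exp (-(((√m)⁻¹ * u : ℝ) * d * Complex.I)) * φ ((√m)⁻¹ * u) ^ m) := by
    intro m hm
    have hm0 : (0 : ℝ) < m := by exact_mod_cast hm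
    have h := integral_pi_mul_exp_neg_sq μ (m := m) (f := fun _ _ => 1)
      (fun _ => integrable_const _) hg s d
    simp only [Finset.prod_const_one, one_mul, Finset.prod_const, Finset.card_univ,
      Fintype.card_fin] at h
    have hφ' : ∀ t : ℝ, ∫ x, Complex.exp (t * g x * Complex.I) ∂μ = φ t := by
      intro t
      rw [hφ, charFun_apply_real, integral_map hg.aemeasurable]
      exact Measurable.aestronglyMeasurable (by fun_prop)
    simp only [hφ'] at h
    rw [integral_gaussianReal_eq_integral_smul hs.ne'] at h
    rw [Complex.ofReal_mul, ← integral_complex_ofReal]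
    have e : ∫ z, ((Real.exp (-(s * (∑ i, g (z i) - d) ^ 2 / 2)) : ℝ) : ℂ)
        ∂(Measure.pi fun _ : Fin m => μ) = ∫ z, Complex.exp
          (-(s * ((∑ i, g (z i) - d : ℝ) : ℂ) ^ 2 / 2)) ∂(Measure.pi fun _ : Fin m => μ) := by
      refine integral_congr_ae (ae_of_all _ fun z => ?_)
      push_cast
      rfl
    rw [e, h, Measure.integral_comp_inv_mul_left (fun t : ℝ => (Real.exp (-(t ^ 2 / (2 * s))) : ℂ) *
          (Complex.exp (-((t : ℝ) * d * Complex.I)) * φ t ^ m)),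
      abs_of_nonneg (Real.sqrt_nonneg _), Complex.real_smul, mul_left_comm]
    congr 1
    rw [← integral_const_mul]
    refine integral_congr_ae (ae_of_all _ fun t => ?_)
    simp only [gaussianPDFReal_def, sub_zero, Complex.real_smul]
    push_cast
    rw [mul_assoc, neg_div]
  have hsq : Tendsto (fun m : ℕ => (√(m : ℝ))⁻¹) atTop (𝓝 0) :=
    tendsto_inv_atTop_zero.comp (Real.tendsto_sqrt_atTop.comp tendsto_natCast_atTop_atTop)
  have hlim : Tendsto (fun m : ℕ =>
        ∫ u : ℝ, (Real.exp (-(((√m)⁻¹ * u) ^ 2 / (2 * s))) : ℂ) *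
          (Complex.exp (-(((√m)⁻¹ * u : ℝ) * d * Complex.I)) * φ ((√m)⁻¹ * u) ^ m))
      atTop (𝓝 (∫ u : ℝ, Complex.exp (-u ^ 2 / 2))) := by
    refine tendsto_integral_filter_of_dominated_convergence
      (fun u => Real.exp (-(a / 2) * u ^ 2) + 2 * (4 / a ^ 2 + s / a) / (1 + u ^ 2)) ?_ ?_ ?_ ?_
    · refine Eventually.of_forall fun m => Measurable.aestronglyMeasurable ?_
      have : Measurable φ := measurable_charFun
      fun_prop
    · filter_upwards [eventually_ge_atTop 1] with m hm
      refine ae_of_all _ fun u => ?_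
      refine le_trans ?_ (exp_neg_scaled_le ha hs' hm u)
      rw [norm_mul, norm_mul, norm_pow, Complex.norm_real, Real.norm_eq_abs, Real.abs_exp,
        ← neg_mul, ← Complex.ofReal_mul, ← Complex.ofReal_neg, Complex.norm_exp_ofReal_mul_I,
        one_mul, mul_comm]
      gcongr
      exact hchar _
    · exact (integrable_exp_neg_mul_sq (by positivity)).add (integrable_one_div_one_add_sq _)
    · refine ae_of_all _ fun u => ?_
      have hu : Tendsto (fun m : ℕ => (√(m : ℝ))⁻¹ * u) atTop (𝓝 0) := by
        simpa using hsq.mul_const u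
      have t1 : Tendsto (fun m : ℕ => ((Real.exp (-(((√m)⁻¹ * u) ^ 2 / (2 * s))) : ℝ) : ℂ))
          atTop (𝓝 1) := by
        have c : Continuous fun x : ℝ => ((Real.exp (-(x ^ 2 / (2 * s))) : ℝ) : ℂ) := by fun_prop
        simpa [Function.comp_def] using (c.tendsto 0).comp hu
      have t2 : Tendsto (fun m : ℕ => Complex.exp (-(((√m)⁻¹ * u : ℝ) * d * Complex.I)))
          atTop (𝓝 1) := by
        have c : Continuous fun x : ℝ => Complex.exp (-((x : ℂ) * d * Complex.I)) := by fun_prop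
        simpa [Function.comp_def] using (c.tendsto 0).comp hu
      have t3 := tendsto_charFun_inv_sqrt_mul_pow (P := μ) hg.aemeasurable h0
        (by simpa using h1) u
      simpa using t1.mul (t2.mul t3)
  have hI : ∫ u : ℝ, Complex.exp (-u ^ 2 / 2) = (√(2 * Real.pi) : ℝ) := by
    have := integral_gaussian (1 / 2)
    rw [show Real.pi / (1 / 2) = 2 * Real.pi by ring] at this
    rw [← this, ← integral_complex_ofReal]
    refine integral_congr_ae (ae_of_all _ fun u => ?_)
    push_cast
    ring_nf
  rw [hI] at hlim
  have hfin := hlim.const_mul (((√(2 * Real.pi * s))⁻¹ : ℝ) : ℂ)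
  rw [← Complex.ofReal_mul] at hfin
  have e3 : (√(2 * Real.pi * s))⁻¹ * √(2 * Real.pi) = 1 / √s := by
    rw [Real.sqrt_mul (by positivity)]
    field_simp
  rw [e3] at hfin
  have := (Complex.continuous_re.tendsto _).comp hfin
  refine (this.congr' ?_)
  filter_upwards [eventually_ge_atTop 1] with m hm
  rw [Function.comp_apply, ← key m hm, Complex.ofReal_re]

end LocalLimit

/-! ### Decay of the truncated transforms and anti-concentration. -/

section Concentration

/-- The deficit `1 - exp (-2v) - 2v exp (-v)` that governs the decay of the characteristic
function of an exponential variable truncated at `v`. -/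
def truncationDeficit (v : ℝ) : ℝ := 1 - Real.exp (-(2 * v)) - 2 * v * Real.exp (-v)

theorem continuous_truncationDeficit : Continuous truncationDeficit := by
  unfold truncationDeficit; fun_prop

theorem hasDerivAt_truncationDeficit (v : ℝ) :
    HasDerivAt truncationDeficit (2 * Real.exp (-v) * (Real.exp (-v) - 1 + v)) v := by
  have h1 : HasDerivAt (fun v : ℝ => Real.exp (-(2 * v))) (Real.exp (-(2 * v)) * (-(2 * 1))) v :=
    (((hasDerivAt_id v).const_mul 2).neg).exp
  have h2 : HasDerivAt (fun v : ℝ => Real.exp (-v)) (Real.exp (-v) * -1) v :=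
    ((hasDerivAt_id v).neg).exp
  have h3 := ((hasDerivAt_const v (1 : ℝ)).sub h1).sub
    (((hasDerivAt_id v).const_mul 2).mul h2)
  refine h3.congr_deriv ?_
  have : Real.exp (-(2 * v)) = Real.exp (-v) * Real.exp (-v) := by
    rw [← Real.exp_add]; ring_nf
  simp only [id]
  rw [this]
  ring

/-- The derivative is positive for v > 0 since exp(−v) > 1 − v. Monotonicity later transfers a total
deficit from a word to any output lying above it. -/
theorem strictMonoOn_truncationDeficit : StrictMonoOn truncationDeficit (Ici 0) := by
  refine strictMonoOn_of_deriv_pos (convex_Ici 0) continuous_truncationDeficit.continuousOn ?_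
  intro v hv
  rw [interior_Ici, mem_Ioi] at hv
  rw [(hasDerivAt_truncationDeficit v).deriv]
  have : -v + 1 < Real.exp (-v) := Real.add_one_lt_exp (by linarith)
  have h2 := Real.exp_pos (-v)
  have : 0 < Real.exp (-v) - 1 + v := by linarith
  positivity

theorem truncationDeficit_zero : truncationDeficit 0 = 0 := by simp [truncationDeficit]

theorem truncationDeficit_pos {v : ℝ} (hv : 0 < v) : 0 < truncationDeficit v := by
  have := strictMonoOn_truncationDeficit (mem_Ici.2 le_rfl) (mem_Ici.2 hv.le) hv
  rwa [truncationDeficit_zero] at this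

theorem truncationDeficit_nonneg {v : ℝ} (hv : 0 ≤ v) : 0 ≤ truncationDeficit v := by
  rcases hv.eq_or_lt with rfl | h
  · rw [truncationDeficit_zero]
  · exact (truncationDeficit_pos h).le

theorem truncationDeficit_le_one {v : ℝ} (hv : 0 ≤ v) : truncationDeficit v ≤ 1 := by
  unfold truncationDeficit
  have := Real.exp_pos (-(2 * v))
  have : 0 ≤ 2 * v * Real.exp (-v) := by positivity
  linarith

/-- At t = 0 the bound is the exact value, which is what makes the output law of `expInput`
exponential. For other t the closed form is expanded into sines and cosines, and t sin(ty) ≤ y t²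
shows that the squared modulus loses the factor 1 − deficit · t²/(l² + t²), at most the exponential
of minus the subtracted term. -/
theorem norm_integral_expInput_truncated_le {β : ℝ} (hβ : 0 < β) {y : ℝ} (hy : 0 ≤ y) (t : ℝ) :
    ‖∫ x : ℝ≥0, (if (x : ℝ) ≤ y then Complex.exp ((1 + t * Complex.I) * (x : ℝ)) else 0)
        ∂(expInput β)‖ ≤
      1 / (1 + β) * (Real.exp (β / (1 + β) * y) *
        Real.exp (-(truncationDeficit (β / (1 + β) * y) * (t ^ 2 / ((β / (1 + β)) ^ 2 + t ^ 2)) / 2)))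
        := by
  rw [integral_expInput_truncated hβ hy]
  have hl : 0 < β / (1 + β) := by positivity
  have h1 : ‖(1 / (1 + β) : ℂ)‖ = 1 / (1 + β) := by
    rw [show (1 / (1 + β) : ℂ) = ((1 / (1 + β) : ℝ) : ℂ) by push_cast; rfl, Complex.norm_real,
      Real.norm_eq_abs, abs_of_pos (by positivity)]
  rw [norm_mul, h1]
  generalize β / (1 + β) = l at *
  refine mul_le_mul_of_nonneg_left ?_ (by positivity)
  rw [← Real.exp_add]
  refine (pow_le_pow_iff_left₀ (norm_nonneg _) (Real.exp_pos _).le two_ne_zero).1 ?_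
  rw [← Real.exp_nat_mul, norm_div, div_pow, ← Complex.normSq_eq_norm_sq,
    ← Complex.normSq_eq_norm_sq, Complex.normSq_apply, Complex.normSq_apply]
  have hexp : Complex.exp ((l + t * Complex.I) * y) =
      (Real.exp (l * y) : ℂ) * (Real.cos (t * y) + Real.sin (t * y) * Complex.I) := by
    rw [show ((l + t * Complex.I) * y : ℂ) = ((l * y : ℝ) : ℂ) + ((t * y : ℝ) : ℂ) * Complex.I by
      push_cast; ring, Complex.exp_add, Complex.exp_mul_I]
    push_cast
    rfl
  have hre : (t * Complex.I + l * Complex.exp ((l + t * Complex.I) * y)).re =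
      l * Real.exp (l * y) * Real.cos (t * y) := by
    rw [hexp]
    simp [-Complex.ofReal_exp, -Complex.ofReal_cos, -Complex.ofReal_sin]
    ring
  have him : (t * Complex.I + l * Complex.exp ((l + t * Complex.I) * y)).im =
      t + l * Real.exp (l * y) * Real.sin (t * y) := by
    rw [hexp]
    simp [-Complex.ofReal_exp, -Complex.ofReal_cos, -Complex.ofReal_sin]
    ring
  rw [hre, him]
  have hD : 0 < l ^ 2 + t ^ 2 := by positivity
  have hd : (l + t * Complex.I : ℂ).re * (l + t * Complex.I : ℂ).re +
      (l + t * Complex.I : ℂ).im * (l + t * Complex.I : ℂ).im = l ^ 2 + t ^ 2 := by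
    simp; ring
  rw [hd]
  have hsin : t * Real.sin (t * y) ≤ y * t ^ 2 := by
    calc t * Real.sin (t * y) ≤ |t * Real.sin (t * y)| := le_abs_self _
      _ = |t| * |Real.sin (t * y)| := abs_mul _ _
      _ ≤ |t| * |t * y| := mul_le_mul_of_nonneg_left Real.abs_sin_le_abs (abs_nonneg _)
      _ = y * t ^ 2 := by rw [abs_mul, abs_of_nonneg hy, ← sq_abs t]; ring
  have hcs := Real.sin_sq_add_cos_sq (t * y)
  have hE : Real.exp (-(2 * (l * y))) * Real.exp (l * y) ^ 2 = 1 := by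
    rw [← Real.exp_nat_mul, ← Real.exp_add]; simp
  have hE2 : Real.exp (-(l * y)) * Real.exp (l * y) = 1 := by rw [← Real.exp_add]; simp
  set E := Real.exp (l * y) with hEdef
  have hEpos : 0 < E := Real.exp_pos _
  calc (l * E * Real.cos (t * y) * (l * E * Real.cos (t * y)) +
        (t + l * E * Real.sin (t * y)) * (t + l * E * Real.sin (t * y))) / (l ^ 2 + t ^ 2)
      ≤ E ^ 2 * (1 - truncationDeficit (l * y) * (t ^ 2 / (l ^ 2 + t ^ 2))) := by
        rw [div_le_iff₀ hD]
        have e1 : E ^ 2 * (1 - truncationDeficit (l * y) * (t ^ 2 / (l ^ 2 + t ^ 2))) *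
            (l ^ 2 + t ^ 2) = E ^ 2 * l ^ 2 + t ^ 2 * (E ^ 2 * (1 - truncationDeficit (l * y))) := by
          field_simp; ring
        -- The deficit is defined so that this identity holds: 1 + 2 l y E bounds the coefficient of
        -- t² in the numerator.
        have e2 : E ^ 2 * (1 - truncationDeficit (l * y)) = 1 + 2 * (l * y) * E := by
          unfold truncationDeficit
          linear_combination hE + 2 * (l * y) * E * hE2
        rw [e1, e2]
        have e3 : l * E * Real.cos (t * y) * (l * E * Real.cos (t * y)) +
            (t + l * E * Real.sin (t * y)) * (t + l * E * Real.sin (t * y)) =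
            l ^ 2 * E ^ 2 + t ^ 2 + 2 * l * E * (t * Real.sin (t * y)) := by
          linear_combination l ^ 2 * E ^ 2 * hcs
        rw [e3]
        have := mul_le_mul_of_nonneg_left hsin (show 0 ≤ 2 * l * E by positivity)
        linarith
    _ ≤ E ^ 2 * Real.exp (-(truncationDeficit (l * y) * (t ^ 2 / (l ^ 2 + t ^ 2)))) := by
        gcongr
        exact Real.one_sub_le_exp_neg _
    _ = _ := by
        rw [hEdef, ← Real.exp_nat_mul, ← Real.exp_add]
        congr 1
        push_cast
        ring

/-- For |t| ≤ l the exponent is at least quadratic, so the Gaussian integral is of order 1/√m. For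
larger t the integrand is at most exp(−κ m / 4), which is smaller still. -/
theorem exists_integral_exp_neg_le {l κ : ℝ} (hl : 0 < l) (hκ : 0 < κ) :
    ∃ C : ℝ, 0 < C ∧ ∀ m : ℕ, 1 ≤ m →
      ∫ t, Real.exp (-(κ * m * (t ^ 2 / (l ^ 2 + t ^ 2)) / 2)) ∂(gaussianReal 0 1) ≤ C / √m := by
  refine ⟨√(Real.pi / (κ / (4 * l ^ 2))) + 2 / √κ, by positivity, fun m hm => ?_⟩
  have hm0 : (0 : ℝ) < m := by exact_mod_cast hm
  set b := κ * m / (4 * l ^ 2) with hb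
  have hb0 : 0 < b := by positivity
  have hpt : ∀ t : ℝ, Real.exp (-(κ * m * (t ^ 2 / (l ^ 2 + t ^ 2)) / 2)) ≤
      Real.exp (-b * t ^ 2) + Real.exp (-(κ * m / 4)) := by
    intro t
    by_cases h : t ^ 2 ≤ l ^ 2
    · have h1 : t ^ 2 / (2 * l ^ 2) ≤ t ^ 2 / (l ^ 2 + t ^ 2) := by
        gcongr; linarith
      have h2 : b * t ^ 2 = κ * m * (t ^ 2 / (2 * l ^ 2)) / 2 := by rw [hb]; field_simp; ring
      have h3 : Real.exp (-(κ * m * (t ^ 2 / (l ^ 2 + t ^ 2)) / 2)) ≤ Real.exp (-b * t ^ 2) := by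
        rw [neg_mul, h2]
        gcongr
      have := Real.exp_pos (-(κ * m / 4))
      linarith
    · push Not at h
      have h1 : 1 / 2 ≤ t ^ 2 / (l ^ 2 + t ^ 2) := by
        rw [div_le_div_iff₀ (by norm_num) (by positivity)]; linarith
      have h3 : Real.exp (-(κ * m * (t ^ 2 / (l ^ 2 + t ^ 2)) / 2)) ≤ Real.exp (-(κ * m / 4)) := by
        have := mul_le_mul_of_nonneg_left h1 (show 0 ≤ κ * m by positivity)
        exact Real.exp_le_exp.2 (by linarith)
      have := Real.exp_pos (-b * t ^ 2)
      linarith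
  have hi1 : Integrable (fun t : ℝ => Real.exp (-b * t ^ 2)) (gaussianReal 0 1) := by
    refine Integrable.mono' (integrable_const 1) (by fun_prop) (ae_of_all _ fun t => ?_)
    rw [Real.norm_eq_abs, Real.abs_exp, Real.exp_le_one_iff]
    nlinarith [mul_nonneg hb0.le (sq_nonneg t)]
  have hgauss : ∫ t, Real.exp (-b * t ^ 2) ∂(gaussianReal 0 1) ≤ √(Real.pi / b) := by
    rw [integral_gaussianReal_eq_integral_smul (by simp), ← integral_gaussian]
    refine integral_mono_of_nonneg (ae_of_all _ fun t => ?_) (integrable_exp_neg_mul_sq hb0)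
      (ae_of_all _ fun t => ?_)
    · exact mul_nonneg (gaussianPDFReal_nonneg _ _ _) (Real.exp_pos _).le
    · have : gaussianPDFReal 0 1 t ≤ 1 := by
        rw [gaussianPDFReal]
        refine mul_le_one₀ ?_ (Real.exp_pos _).le ?_
        · refine inv_le_one_of_one_le₀ (Real.one_le_sqrt.2 ?_)
          have := Real.pi_gt_three
          simp only [NNReal.coe_one]
          linarith
        · rw [Real.exp_le_one_iff]
          have : 0 ≤ (t - 0) ^ 2 / (2 * ((1 : ℝ≥0) : ℝ)) := by positivity
          rw [neg_div]; linarith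
      exact mul_le_of_le_one_left (Real.exp_pos _).le this
  have htail : Real.exp (-(κ * m / 4)) ≤ 2 / √κ / √m := by
    rw [Real.exp_neg, inv_eq_one_div, div_div, ← Real.sqrt_mul hκ.le,
      div_le_div_iff₀ (Real.exp_pos _) (Real.sqrt_pos.2 (by positivity))]
    have h1 : κ * m / 4 + 1 ≤ Real.exp (κ * m / 4) := Real.add_one_le_exp _
    have h2 : √(κ * m) ≤ κ * m / 4 + 1 := by
      have := Real.sq_sqrt (show 0 ≤ κ * m by positivity)
      nlinarith [sq_nonneg (√(κ * m) / 2 - 1)]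
    have := Real.exp_pos (κ * m / 4)
    linarith
  have hsq : √(Real.pi / b) = √(Real.pi / (κ / (4 * l ^ 2))) / √m := by
    rw [← Real.sqrt_div (by positivity)]
    congr 1
    rw [hb]
    field_simp
  calc _ ≤ ∫ t, (Real.exp (-b * t ^ 2) + Real.exp (-(κ * m / 4))) ∂(gaussianReal 0 1) :=
        integral_mono_of_nonneg (ae_of_all _ fun t => (Real.exp_pos _).le)
          (hi1.add (integrable_const _)) (ae_of_all _ hpt)
    _ = ∫ t, Real.exp (-b * t ^ 2) ∂(gaussianReal 0 1) + Real.exp (-(κ * m / 4)) := by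
        rw [integral_add hi1 (integrable_const _)]; simp
    _ ≤ √(Real.pi / (κ / (4 * l ^ 2))) / √m + 2 / √κ / √m := by
        rw [← hsq]; gcongr
    _ = _ := by rw [add_div]

/-- An anti-concentration bound: the probability that a word drawn from the capacity-achieving
input distribution lies below `y` and has a sum in a bounded window. -/
theorem measureReal_pi_expInput_window_le {β : ℝ} (hβ : 0 < β) {κ : ℝ} (hκ : 0 < κ) {m : ℕ}
    {y : Fin m → ℝ} (hy : ∀ i, 0 ≤ y i)
    (hsum : κ * m ≤ ∑ i, truncationDeficit (β / (1 + β) * y i)) (w : ℝ) :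
    (Measure.pi fun _ : Fin m => expInput β).real
        {z | (∀ i, (z i : ℝ) ≤ y i) ∧ |∑ i, (z i : ℝ) - w| ≤ 2} ≤
      Real.exp (4 - w) * ((1 / (1 + β)) ^ m * Real.exp (β / (1 + β) * ∑ i, y i) *
        ∫ t, Real.exp (-(κ * m * (t ^ 2 / ((β / (1 + β)) ^ 2 + t ^ 2)) / 2))
          ∂(gaussianReal 0 1)) := by
  have := isProbabilityMeasure_expInput hβ
  have hl : 0 < β / (1 + β) := by positivity
  set μ := Measure.pi fun _ : Fin m => expInput β with hμ
  set A : Set (Fin m → ℝ≥0) := {z | (∀ i, (z i : ℝ) ≤ y i) ∧ |∑ i, (z i : ℝ) - w| ≤ 2} with hA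
  have hAm : MeasurableSet A := by
    rw [hA, ofPred_and]
    refine MeasurableSet.inter ?_ (measurableSet_le (by fun_prop) measurable_const)
    rw [ofPred_forall]
    exact MeasurableSet.iInter fun i => measurableSet_le (by fun_prop) measurable_const
  -- A smooth majorant of the event up to a constant: the sharp window becomes a Gaussian weight,
  -- and the tilt exp(Σ z) is nearly constant on the window.
  let F : (Fin m → ℝ≥0) → ℝ := fun z =>
    (∏ i, if (z i : ℝ) ≤ y i then Real.exp (z i) else 0) *
      Real.exp (-((∑ i, (z i : ℝ) - w) ^ 2 / 2))
  have hfm : ∀ i, Measurable fun x : ℝ≥0 => if (x : ℝ) ≤ y i then Real.exp x else 0 := fun i =>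
    Measurable.ite (measurableSet_le (by fun_prop) measurable_const) (by fun_prop) measurable_const
  have hfi : ∀ i, Integrable (fun x : ℝ≥0 => if (x : ℝ) ≤ y i then Real.exp x else 0)
      (expInput β) := by
    intro i
    refine Integrable.mono' (integrable_const (Real.exp (y i))) (hfm i).aestronglyMeasurable
      (ae_of_all _ fun x => ?_)
    split_ifs with h
    · rwa [Real.norm_eq_abs, Real.abs_exp, Real.exp_le_exp]
    · simpa using (Real.exp_pos _).le
  have hF0 : ∀ z, 0 ≤ F z := fun z => mul_nonneg
    (Finset.prod_nonneg fun i _ => by split_ifs <;> positivity) (Real.exp_pos _).le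
  have hFi : Integrable F μ := by
    refine Integrable.mono (Integrable.fintype_prod hfi) ?_ (ae_of_all _ fun z => ?_)
    · refine Measurable.aestronglyMeasurable (Measurable.mul ?_ (by fun_prop))
      exact Finset.measurable_prod _ fun i _ => (hfm i).comp (measurable_pi_apply i)
    · rw [norm_mul]
      refine mul_le_of_le_one_right (norm_nonneg _) ?_
      rw [Real.norm_eq_abs, Real.abs_exp, Real.exp_le_one_iff]
      have : 0 ≤ (∑ i, (z i : ℝ) - w) ^ 2 / 2 := by positivity
      linarith
  -- On the window the tilt is at least exp(w − 2) and the Gaussian weight at least exp(−2), hence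
  -- the factor exp(4 − w).
  have hlow : ∀ z, A.indicator (fun _ => (1 : ℝ)) z ≤ Real.exp (4 - w) * F z := by
    intro z
    by_cases hz : z ∈ A
    · rw [indicator_of_mem hz]
      have hz' := hz
      obtain ⟨hz1, hz2⟩ := hz'
      have e : F z = Real.exp (∑ i, (z i : ℝ) - (∑ i, (z i : ℝ) - w) ^ 2 / 2) := by
        simp only [F, hz1, if_true]
        rw [← Real.exp_sum, ← Real.exp_add]
        rfl
      rw [e, ← Real.exp_add]
      refine Real.one_le_exp ?_
      have h1 := abs_le.1 hz2
      have h2 : (∑ i, (z i : ℝ) - w) ^ 2 ≤ 2 ^ 2 := sq_le_sq' h1.1 h1.2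
      linarith
    · rw [indicator_of_notMem hz]
      exact mul_nonneg (Real.exp_pos _).le (hF0 z)
  have hstep : μ.real A ≤ Real.exp (4 - w) * ∫ z, F z ∂μ := by
    rw [← integral_const_mul, ← integral_indicator_one hAm]
    exact integral_mono ((integrable_const (1 : ℝ)).indicator hAm) (hFi.const_mul _) hlow
  refine hstep.trans (mul_le_mul_of_nonneg_left ?_ (Real.exp_pos _).le)
  have hsm := integral_pi_mul_exp_neg_sq (expInput β) (m := m)
    (f := fun i x => ((if (x : ℝ) ≤ y i then Real.exp x else 0 : ℝ) : ℂ))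
    (fun i => (hfi i).ofReal) (g := fun x : ℝ≥0 => (x : ℝ)) (by fun_prop) 1 w
  have hFc : ((∫ z, F z ∂μ : ℝ) : ℂ) = ∫ t, Complex.exp (-(t * w * Complex.I)) *
        ∏ i, ∫ x : ℝ≥0, (if (x : ℝ) ≤ y i then Complex.exp ((1 + t * Complex.I) * (x : ℝ)) else 0)
          ∂(expInput β) ∂(gaussianReal 0 1) := by
    rw [← integral_complex_ofReal]
    refine Eq.trans (integral_congr_ae (ae_of_all _ fun z => ?_)) (hsm.trans
      (integral_congr_ae (ae_of_all _ fun t => ?_)))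
    · simp only [F]
      push_cast
      simp
    · simp only
      congr 1
      refine Finset.prod_congr rfl fun i _ => integral_congr_ae (ae_of_all _ fun x => ?_)
      simp only
      split_ifs with h
      · rw [Complex.ofReal_exp, ← Complex.exp_add]
        ring_nf
      · simp
  -- The integral is real and nonnegative, so it may be replaced by its modulus; this discards the
  -- oscillating phase exp(−itw).
  have hnorm : ∫ z, F z ∂μ = ‖((∫ z, F z ∂μ : ℝ) : ℂ)‖ := by
    rw [Complex.norm_real, Real.norm_eq_abs, abs_of_nonneg (integral_nonneg hF0)]
  rw [hnorm, hFc, ← integral_const_mul]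
  refine norm_integral_le_of_norm_le ?_ (ae_of_all _ fun t => ?_)
  · refine Integrable.const_mul (Integrable.mono' (integrable_const 1) ?_ ?_) _
    · exact Measurable.aestronglyMeasurable (by fun_prop)
    · refine ae_of_all _ fun t => ?_
      rw [Real.norm_eq_abs, Real.abs_exp, Real.exp_le_one_iff]
      have : 0 ≤ κ * m * (t ^ 2 / ((β / (1 + β)) ^ 2 + t ^ 2)) / 2 := by positivity
      linarith
  · rw [norm_mul, ← neg_mul, ← Complex.ofReal_mul, ← Complex.ofReal_neg,
      Complex.norm_exp_ofReal_mul_I, one_mul, norm_prod]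
    refine (Finset.prod_le_prod (fun i _ => norm_nonneg _) fun i _ =>
      norm_integral_expInput_truncated_le hβ (hy i) t).trans ?_
    rw [Finset.prod_mul_distrib, Finset.prod_mul_distrib, Finset.prod_const, Finset.card_univ,
      Fintype.card_fin, ← Real.exp_sum, ← Real.exp_sum, mul_assoc, Finset.mul_sum]
    gcongr
    rw [Finset.sum_neg_distrib, ← Finset.sum_div, ← Finset.sum_mul]
    gcongr

end Concentration

/-! ### A lower bound for the probability of the window. -/

section WindowLowerBound

theorem integral_expInput_id {β : ℝ} (hβ : 0 < β) : ∫ x : ℝ≥0, (x : ℝ) ∂(expInput β) = β := by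
  have hr : 0 < 1 / (1 + β) := by positivity
  have h := integral_pow_expMeasure hr 1
  have hi := integrable_pow_expMeasure hr 1
  simp only [pow_one] at h hi
  rw [integral_expInput hβ (f := fun x : ℝ => x) (by fun_prop) hi, h]
  simp
  field_simp

theorem integrable_expInput_id {β : ℝ} (hβ : 0 < β) :
    Integrable (fun x : ℝ≥0 => (x : ℝ)) (expInput β) := by
  have hi := integrable_pow_expMeasure (show 0 < 1 / (1 + β) by positivity) 1
  simp only [pow_one] at hi
  exact integrable_expInput (f := fun x : ℝ => x) (by fun_prop) hi

theorem integral_expInput_sq {β : ℝ} (hβ : 0 < β) :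
    ∫ x : ℝ≥0, (x : ℝ) ^ 2 ∂(expInput β) = 2 * β * (1 + β) := by
  have hr : 0 < 1 / (1 + β) := by positivity
  have h := integral_pow_expMeasure hr 2
  have hi := integrable_pow_expMeasure hr 2
  rw [integral_expInput hβ (f := fun x : ℝ => x ^ 2)
    (Measurable.stronglyMeasurable (by fun_prop)) hi, h]
  simp
  field_simp

theorem integrable_expInput_sq {β : ℝ} (hβ : 0 < β) :
    Integrable (fun x : ℝ≥0 => (x : ℝ) ^ 2) (expInput β) :=
  integrable_expInput (f := fun x : ℝ => x ^ 2) (Measurable.stronglyMeasurable (by fun_prop))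
    (integrable_pow_expMeasure (show 0 < 1 / (1 + β) by positivity) 2)

theorem integral_exp_mul_I_expInput {β : ℝ} (hβ : 0 < β) (t : ℝ) :
    ∫ x : ℝ≥0, Complex.exp (t * (x : ℝ) * Complex.I) ∂(expInput β) =
      (1 - t * Complex.I) / (1 - (1 + β) * (t * Complex.I)) := by
  have := isProbabilityMeasure_exp hβ
  have hr : 0 < 1 / (1 + β) := by positivity
  have hm : StronglyMeasurable fun x : ℝ => Complex.exp (t * x * Complex.I) :=
    Measurable.stronglyMeasurable (by fun_prop)
  have h1 : (1 + β : ℂ) ≠ 0 := by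
    have : (1 + β : ℝ) ≠ 0 := by positivity
    exact_mod_cast this
  rw [integral_expInput hβ (f := fun x : ℝ => Complex.exp (t * x * Complex.I)) hm]
  · rw [integral_expMeasure hr]
    set c : ℂ := -(1 / (1 + β) : ℝ) + t * Complex.I with hc
    have hcre : c.re < 0 := by
      rw [hc]
      simp only [Complex.add_re, Complex.neg_re, Complex.ofReal_re, Complex.mul_re, Complex.I_re,
        mul_zero, Complex.ofReal_im, Complex.I_im, mul_one, sub_self, add_zero]
      linarith
    have e : ∫ x in Ioi (0 : ℝ), (1 / (1 + β) * Real.exp (-(1 / (1 + β) * x))) •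
          Complex.exp (t * x * Complex.I) =
        ∫ x in Ioi (0 : ℝ), (1 / (1 + β) : ℝ) * Complex.exp (c * x) := by
      refine integral_congr_ae (ae_of_all _ fun x => ?_)
      simp only [Complex.real_smul, hc]
      push_cast
      rw [mul_assoc, ← Complex.exp_add]
      congr 2
      ring
    rw [e, integral_const_mul, integral_exp_mul_complex_Ioi hcre]
    have hc0 : c ≠ 0 := fun h => by simp [h] at hcre
    have h2 : (1 - (1 + β) * (t * Complex.I) : ℂ) ≠ 0 := by
      have : (1 - (1 + β) * (t * Complex.I) : ℂ) = -(1 + β) * c := by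
        rw [hc]; push_cast; field_simp; ring
      rw [this]
      exact mul_ne_zero (neg_ne_zero.2 h1) hc0
    have h3 : c = -(1 - (1 + β) * (t * Complex.I)) / (1 + β) := by
      rw [hc]; push_cast; field_simp; ring
    rw [h3]
    simp only [Complex.real_smul]
    push_cast
    simp only [mul_zero, zero_mul, Complex.exp_zero]
    clear e hm
    generalize (t * Complex.I : ℂ) = τ at *
    field_simp
    ring
  · refine Integrable.mono' (integrable_const 1) hm.aestronglyMeasurable (ae_of_all _ fun x => ?_)
    rw [← Complex.ofReal_mul, Complex.norm_exp_ofReal_mul_I]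

/-- The squared modulus is (1 + t²)/(1 + (1+β)² t²) = 1 − x, bounded by exp(−x). The atom at zero
keeps it from vanishing at infinity, which is why a smoothed limit theorem is used. -/
theorem norm_integral_exp_mul_I_expInput_le {β : ℝ} (hβ : 0 < β) (t : ℝ) :
    ‖∫ x : ℝ≥0, Complex.exp (t * (x : ℝ) * Complex.I) ∂(expInput β)‖ ≤
      Real.exp (-(((1 + β) ^ 2 - 1) * t ^ 2 / (1 + (1 + β) ^ 2 * t ^ 2) / 2)) := by
  rw [integral_exp_mul_I_expInput hβ]
  refine (pow_le_pow_iff_left₀ (norm_nonneg _) (Real.exp_pos _).le two_ne_zero).1 ?_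
  rw [← Real.exp_nat_mul, norm_div, div_pow, ← Complex.normSq_eq_norm_sq,
    ← Complex.normSq_eq_norm_sq, Complex.normSq_apply, Complex.normSq_apply]
  have hn : (1 - t * Complex.I : ℂ).re * (1 - t * Complex.I : ℂ).re +
      (1 - t * Complex.I : ℂ).im * (1 - t * Complex.I : ℂ).im = 1 + t ^ 2 := by simp; ring
  have hd : (1 - (1 + β) * (t * Complex.I) : ℂ).re * (1 - (1 + β) * (t * Complex.I) : ℂ).re +
      (1 - (1 + β) * (t * Complex.I) : ℂ).im * (1 - (1 + β) * (t * Complex.I) : ℂ).im =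
      1 + (1 + β) ^ 2 * t ^ 2 := by simp; ring
  rw [hn, hd]
  have hD : 0 < 1 + (1 + β) ^ 2 * t ^ 2 := by positivity
  calc (1 + t ^ 2) / (1 + (1 + β) ^ 2 * t ^ 2) =
      1 - ((1 + β) ^ 2 - 1) * t ^ 2 / (1 + (1 + β) ^ 2 * t ^ 2) := by field_simp; ring
    _ ≤ Real.exp (-(((1 + β) ^ 2 - 1) * t ^ 2 / (1 + (1 + β) ^ 2 * t ^ 2))) :=
      Real.one_sub_le_exp_neg _
    _ = _ := by congr 1; push_cast; ring

/-- The local limit theorem for the standardised letters; (1+β)² − 1 is the variance of `expInput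
β`. -/
theorem tendsto_sqrt_mul_integral_expInput {β : ℝ} (hβ : 0 < β) {s : ℝ} (hs : 0 < s) (d : ℝ) :
    Tendsto (fun m : ℕ => √m * ∫ z, Real.exp (-(s * (∑ i, (z i : ℝ) - m * β - d) ^ 2 / 2))
      ∂(Measure.pi fun _ : Fin m => expInput β)) atTop
      (𝓝 (1 / √(s * ((1 + β) ^ 2 - 1)))) := by
  have := isProbabilityMeasure_expInput hβ
  have hv : 0 < (1 + β) ^ 2 - 1 := by nlinarith
  set σ := √((1 + β) ^ 2 - 1) with hσ
  have hσ0 : 0 < σ := Real.sqrt_pos.2 hv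
  have hσ2 : σ ^ 2 = (1 + β) ^ 2 - 1 := Real.sq_sqrt hv.le
  have hi1 := integrable_expInput_id hβ
  have hi2 := integrable_expInput_sq hβ
  have hmean : ∫ x : ℝ≥0, ((x : ℝ) - β) / σ ∂(expInput β) = 0 := by
    rw [integral_div, integral_sub hi1 (integrable_const _), integral_expInput_id hβ]
    simp
  have hvar : ∫ x : ℝ≥0, (((x : ℝ) - β) / σ) ^ 2 ∂(expInput β) = 1 := by
    have e : ∀ x : ℝ≥0, (((x : ℝ) - β) / σ) ^ 2 =
        ((x : ℝ) ^ 2 - (2 * β * (x : ℝ) - β ^ 2)) / σ ^ 2 := fun x => by rw [div_pow]; ring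
    simp_rw [e]
    have hi3 : Integrable (fun x : ℝ≥0 => 2 * β * (x : ℝ) - β ^ 2) (expInput β) :=
      (hi1.const_mul _).sub (integrable_const _)
    rw [integral_div, integral_sub hi2 hi3,
      integral_sub (hi1.const_mul _) (integrable_const _), integral_const_mul,
      integral_expInput_id hβ, integral_expInput_sq hβ, hσ2]
    simp only [integral_const, probReal_univ, one_smul]
    rw [div_eq_one_iff_eq hv.ne']
    ring
  have hchar : ∀ t : ℝ, ‖charFun ((expInput β).map fun x : ℝ≥0 => ((x : ℝ) - β) / σ) t‖ ≤
      Real.exp (-(((1 + β) ^ 2 - 1) / (2 * (1 + β) ^ 2) * t ^ 2 / (1 + t ^ 2))) := by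
    intro t
    rw [charFun_apply_real, integral_map (by fun_prop)
      (Measurable.aestronglyMeasurable (by fun_prop))]
    have e : ∫ x : ℝ≥0, Complex.exp (t * ((((x : ℝ) - β) / σ : ℝ) : ℂ) * Complex.I)
        ∂(expInput β) = Complex.exp ((-(t * β / σ) : ℝ) * Complex.I) *
          ∫ x : ℝ≥0, Complex.exp ((t / σ : ℝ) * (x : ℝ) * Complex.I) ∂(expInput β) := by
      rw [← integral_const_mul]
      refine integral_congr_ae (ae_of_all _ fun x => ?_)
      simp only
      rw [← Complex.exp_add]
      congr 1
      push_cast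
      ring
    rw [e, norm_mul, Complex.norm_exp_ofReal_mul_I, one_mul]
    refine (norm_integral_exp_mul_I_expInput_le hβ _).trans (Real.exp_le_exp.2 (neg_le_neg ?_))
    rw [div_pow, hσ2]
    generalize (1 + β) ^ 2 = b at *
    have hb : 0 < b := by linarith
    have e1 : (b - 1) * (t ^ 2 / (b - 1)) / (1 + b * (t ^ 2 / (b - 1))) / 2 =
        (b - 1) * t ^ 2 / (2 * ((b - 1) + b * t ^ 2)) := by field_simp
    have e2 : (b - 1) / (2 * b) * t ^ 2 / (1 + t ^ 2) =
        (b - 1) * t ^ 2 / (2 * (b * (1 + t ^ 2))) := by field_simp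
    rw [e1, e2]
    have : 0 < b - 1 + b * t ^ 2 := by positivity
    gcongr
    linarith
  have hs2 : 0 < s * σ ^ 2 := by positivity
  have h := tendsto_sqrt_mul_integral_exp_neg_sq (expInput β)
    (g := fun x : ℝ≥0 => ((x : ℝ) - β) / σ) (by fun_prop) hmean hvar
    (a := ((1 + β) ^ 2 - 1) / (2 * (1 + β) ^ 2)) (by positivity) hchar
    (s := (s * σ ^ 2).toNNReal) (by simpa using hs2) (d / σ)
  rw [Real.coe_toNNReal _ hs2.le] at h
  rw [← hσ2]
  refine h.congr fun m => ?_
  congr 1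
  refine integral_congr_ae (ae_of_all _ fun z => ?_)
  simp only
  congr 3
  rw [← Finset.sum_div, Finset.sum_sub_distrib, ← sub_div]
  simp only [Finset.sum_const, Finset.card_univ, Fintype.card_fin, nsmul_eq_mul]
  field_simp

theorem measurableSet_window {m : ℕ} (w : ℝ) :
    MeasurableSet {z : Fin m → ℝ≥0 | |∑ i, (z i : ℝ) - w| ≤ 2} :=
  measurableSet_le (by fun_prop) measurable_const

/-- The function exp(−x²/2) − exp(−1) exp(−x²/4) is at most 1 everywhere and nonpositive for |x| ≥
2, so it minorises the indicator of the window. Both terms are covered by the smoothed limit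
theorem, with s = 1 and s = 1/2, and the limit is positive because √2 < e. -/
theorem exists_le_measureReal_window {β : ℝ} (hβ : 0 < β) (d : ℝ) :
    ∃ c : ℝ, 0 < c ∧ ∀ᶠ m : ℕ in atTop, c / √m ≤
      (Measure.pi fun _ : Fin m => expInput β).real
        {z | |∑ i, (z i : ℝ) - (m * β + d)| ≤ 2} := by
  have := isProbabilityMeasure_expInput hβ
  have hv : 0 < (1 + β) ^ 2 - 1 := by nlinarith
  have h1 := tendsto_sqrt_mul_integral_expInput hβ (s := 1) one_pos d
  have h2 := (tendsto_sqrt_mul_integral_expInput hβ (s := 1 / 2) (by norm_num) d).const_mul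
    (Real.exp (-1))
  have h3 := h1.sub h2
  set v := (1 + β) ^ 2 - 1 with hvdef
  set L := 1 / √(1 * v) - Real.exp (-1) * (1 / √(1 / 2 * v)) with hL
  have hL0 : 0 < L := by
    have e1 : √(1 / 2 * v) = √v / √2 := by
      rw [← Real.sqrt_div hv.le]; congr 1; ring
    have hs : 0 < √v := Real.sqrt_pos.2 hv
    have e2 : L = (1 - Real.exp (-1) * √2) / √v := by
      rw [hL, e1, one_mul]; field_simp
    rw [e2]
    refine div_pos ?_ hs
    have h2 : √2 < 2 := by
      rw [Real.sqrt_lt' (by norm_num)]; norm_num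
    have h4 : 2 < Real.exp 1 := by
      have := Real.add_one_lt_exp (one_ne_zero (α := ℝ))
      linarith
    rw [Real.exp_neg, sub_pos, inv_mul_lt_iff₀ (Real.exp_pos _)]
    linarith
  refine ⟨L / 2, by positivity, ?_⟩
  filter_upwards [h3.eventually (lt_mem_nhds (show L / 2 < L by linarith)),
    eventually_ge_atTop 1] with m hm hm1
  have hm0 : (0 : ℝ) < √m := Real.sqrt_pos.2 (by exact_mod_cast hm1)
  rw [div_le_iff₀' hm0]
  refine hm.le.trans ?_
  rw [mul_left_comm, ← mul_sub]
  refine mul_le_mul_of_nonneg_left ?_ hm0.le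
  have hint : ∀ s : ℝ, 0 < s → Integrable (fun z : Fin m → ℝ≥0 =>
      Real.exp (-(s * (∑ i, (z i : ℝ) - m * β - d) ^ 2 / 2)))
        (Measure.pi fun _ : Fin m => expInput β) := by
    intro s hs
    refine Integrable.mono' (integrable_const 1) (Measurable.aestronglyMeasurable (by fun_prop))
      (ae_of_all _ fun z => ?_)
    rw [Real.norm_eq_abs, Real.abs_exp, Real.exp_le_one_iff]
    have : 0 ≤ s * (∑ i, (z i : ℝ) - m * β - d) ^ 2 / 2 := by positivity
    linarith
  rw [← integral_const_mul, ← integral_sub (hint 1 one_pos)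
    ((hint (1 / 2) (by norm_num)).const_mul _), ← integral_indicator_one (measurableSet_window _)]
  refine integral_mono ((hint 1 one_pos).sub ((hint (1 / 2) (by norm_num)).const_mul _))
    ((integrable_const (1 : ℝ)).indicator (measurableSet_window _)) fun z => ?_
  simp only
  rw [← Real.exp_add, sub_sub]
  set x := ∑ i, (z i : ℝ) - (m * β + d) with hx
  by_cases hz : |x| ≤ 2
  · rw [indicator_of_mem (show z ∈ {z : Fin m → ℝ≥0 | |∑ i, (z i : ℝ) - (m * β + d)| ≤ 2} from hz)]
    have e1 : Real.exp (-(1 * x ^ 2 / 2)) ≤ 1 := by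
      rw [Real.exp_le_one_iff]
      have : 0 ≤ 1 * x ^ 2 / 2 := by positivity
      linarith
    have e2 := Real.exp_pos (-1 + -(1 / 2 * x ^ 2 / 2))
    simp only [Pi.one_apply]
    linarith
  · rw [indicator_of_notMem (show z ∉ {z : Fin m → ℝ≥0 | |∑ i, (z i : ℝ) - (m * β + d)| ≤ 2}
      from hz)]
    push Not at hz
    have hx2 : 2 ^ 2 ≤ x ^ 2 := by
      rw [← sq_abs x]
      exact pow_le_pow_left₀ (by norm_num) hz.le 2
    rw [sub_nonpos, Real.exp_le_exp]
    linarith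

/-- The deficit accumulated by a typical word is linear in its length. -/
theorem exists_le_measureReal_window_inter {β : ℝ} (hβ : 0 < β) (d : ℝ) :
    ∃ c κ : ℝ, 0 < c ∧ 0 < κ ∧ ∀ᶠ m : ℕ in atTop, c / √m ≤
      (Measure.pi fun _ : Fin m => expInput β).real
        ({z | |∑ i, (z i : ℝ) - (m * β + d)| ≤ 2} ∩
          {z | κ * m ≤ ∑ i, truncationDeficit (β / (1 + β) * z i)}) := by
  have := isProbabilityMeasure_expInput hβ
  have hl : 0 < β / (1 + β) := by positivity
  obtain ⟨c, hc, hw⟩ := exists_le_measureReal_window hβ d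
  set g : ℝ≥0 → ℝ := fun x => truncationDeficit (β / (1 + β) * x) with hg
  have hgm : Measurable g := by
    have := continuous_truncationDeficit.measurable
    fun_prop
  have hg0 : ∀ x, 0 ≤ g x := fun x => truncationDeficit_nonneg (by positivity)
  have hg1 : ∀ x, g x ≤ 1 := fun x => truncationDeficit_le_one (by positivity)
  have hgi : MemLp g 2 (expInput β) := by
    refine MemLp.of_bound hgm.aestronglyMeasurable 1 (ae_of_all _ fun x => ?_)
    rw [Real.norm_eq_abs, abs_of_nonneg (hg0 x)]
    exact hg1 x
  set e := ∫ x, g x ∂(expInput β) with he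
  have he0 : 0 < e := by
    -- A vanishing mean deficit would force the letter to be zero almost surely, contradicting the
    -- mean β > 0.
    refine lt_of_le_of_ne (integral_nonneg hg0) fun h => ?_
    have h0 := (integral_eq_zero_iff_of_nonneg hg0 (hgi.integrable (by norm_num))).1 h.symm
    have h1 : ∫ x : ℝ≥0, (x : ℝ) ∂(expInput β) = 0 := by
      rw [← integral_zero ℝ≥0 ℝ (μ := expInput β)]
      refine integral_congr_ae ?_
      filter_upwards [h0] with x hx
      by_contra hne
      have hx0 : (0 : ℝ) < x := lt_of_le_of_ne x.2 (Ne.symm hne)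
      exact (truncationDeficit_pos (mul_pos hl hx0)).ne' hx
    rw [integral_expInput_id hβ] at h1
    exact hβ.ne' h1
  refine ⟨c / 2, e / 2, by positivity, by positivity, ?_⟩
  -- By Chebyshev a small total deficit has probability at most 4/(m e²). Beyond this m that is at
  -- most half of the window probability c/√m.
  have hlarge : ∀ᶠ m : ℕ in atTop, 8 / (c * e ^ 2) ≤ √(m : ℝ) :=
    (Real.tendsto_sqrt_atTop.comp tendsto_natCast_atTop_atTop).eventually (eventually_ge_atTop _)
  filter_upwards [hw, hlarge, eventually_ge_atTop 1] with m hm hml hm1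
  have hm0 : (0 : ℝ) < m := by exact_mod_cast hm1
  have hsm : (0 : ℝ) < √m := Real.sqrt_pos.2 hm0
  set μ := Measure.pi fun _ : Fin m => expInput β with hμ
  set S : (Fin m → ℝ≥0) → ℝ := fun z => ∑ i, g (z i) with hS
  have hSm : MemLp S 2 μ := by
    have : ∀ i ∈ Finset.univ, MemLp (fun z : Fin m → ℝ≥0 => g (z i)) 2 μ := fun i _ =>
      hgi.comp_measurePreserving (measurePreserving_eval _ i)
    exact memLp_finsetSum _ this
  have hSmean : ∫ z, S z ∂μ = m * e := by
    rw [hS, integral_finsetSum]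
    · have : ∀ i : Fin m, ∫ z, g (z i) ∂μ = e := fun i => by
        have h := integral_map (μ := μ) (φ := Function.eval i)
          (measurable_pi_apply i).aemeasurable (f := g) hgm.aestronglyMeasurable
        rw [(measurePreserving_eval (fun _ : Fin m => expInput β) i).map_eq] at h
        exact h.symm
      simp [this]
    · intro i _
      exact (hgi.comp_measurePreserving (measurePreserving_eval _ i)).integrable (by norm_num)
  have hSvar : variance S μ ≤ m := by
    have h1 := variance_sum_pi (ι := Fin m) (μ := fun _ => expInput β) (X := fun _ => g)
      (fun _ => hgi)
    have h2 : variance g (expInput β) ≤ 1 := by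
      have := variance_le_sq_of_bounded (μ := expInput β) (a := 0) (b := 1) (X := g)
        (ae_of_all _ fun x => ⟨hg0 x, hg1 x⟩) hgm.aemeasurable
      norm_num at this
      linarith
    have e1 : S = ∑ i, fun z : Fin m → ℝ≥0 => g (z i) := by
      ext z; simp [hS]
    rw [e1, h1]
    simp only [Finset.sum_const, Finset.card_univ, Fintype.card_fin, nsmul_eq_mul]
    nlinarith
  have hcheb := meas_ge_le_variance_div_sq hSm (c := m * e / 2) (by positivity)
  rw [hSmean] at hcheb
  have hbad : μ.real {z | e / 2 * m ≤ S z}ᶜ ≤ 4 / (m * e ^ 2) := by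
    have h1 : {z | e / 2 * m ≤ S z}ᶜ ⊆ {z | m * e / 2 ≤ |S z - m * e|} := by
      intro z hz
      simp only [mem_compl_iff, mem_ofPred_eq, not_le] at hz ⊢
      rw [abs_sub_comm]
      refine le_trans ?_ (le_abs_self _)
      linarith
    have h2 : μ {z | e / 2 * m ≤ S z}ᶜ ≤ ENNReal.ofReal (4 / (m * e ^ 2)) := by
      refine (measure_mono h1).trans (hcheb.trans (ENNReal.ofReal_le_ofReal ?_))
      calc variance S μ / (m * e / 2) ^ 2 ≤ m / (m * e / 2) ^ 2 := by gcongr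
        _ = 4 / (m * e ^ 2) := by field_simp; ring
    exact ENNReal.toReal_le_of_le_ofReal (by positivity) h2
  have hsplit : μ.real {z | |∑ i, (z i : ℝ) - (m * β + d)| ≤ 2} ≤
      μ.real ({z | |∑ i, (z i : ℝ) - (m * β + d)| ≤ 2} ∩ {z | e / 2 * m ≤ S z}) +
        μ.real {z | e / 2 * m ≤ S z}ᶜ := by
    refine (measureReal_mono ?_).trans (measureReal_union_le _ _)
    intro z hz
    by_cases h : z ∈ {z | e / 2 * m ≤ S z}
    · exact Or.inl ⟨hz, h⟩
    · exact Or.inr h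
  have hsmall : 4 / (m * e ^ 2) ≤ c / 2 / √m := by
    have hms : (m : ℝ) = √m * √m := (Real.mul_self_sqrt hm0.le).symm
    rw [div_div, div_le_div_iff₀ (by positivity) (by positivity)]
    rw [div_le_iff₀ (by positivity)] at hml
    calc 4 * (2 * √m) = 8 * √m := by ring
      _ ≤ √m * (c * e ^ 2) * √m := by gcongr
      _ = c * (√m * √m * e ^ 2) := by ring
      _ = c * (m * e ^ 2) := by rw [← hms]
  have h4 : c / √m = c / 2 / √m + c / 2 / √m := by ring
  change _ ≤ μ.real ({z | |∑ i, (z i : ℝ) - (m * β + d)| ≤ 2} ∩ {z | e / 2 * m ≤ S z})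
  linarith

end WindowLowerBound

/-! ### Densities of the block channel and of its outputs. -/

section BlockDensity

theorem lintegral_pi_prod {ι : Type*} [Fintype ι] {Ω : Type*} [MeasurableSpace Ω]
    (ν : Measure Ω) [IsProbabilityMeasure ν] {f : ι → Ω → ℝ≥0∞} (hf : ∀ i, Measurable (f i)) :
    ∫⁻ y, ∏ i, f i (y i) ∂(Measure.pi fun _ : ι => ν) = ∏ i, ∫⁻ x, f i x ∂ν := by
  refine (lintegral_prod_eq_prod_lintegral_of_indepFun Finset.univ
    (fun i (y : ι → Ω) => f i (y i))
    (iIndepFun_pi fun i => (hf i).aemeasurable)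
    fun i => (hf i).comp (measurable_pi_apply i)).trans ?_
  exact Finset.prod_congr rfl fun i _ =>
    (measurePreserving_eval (fun _ : ι => ν) i).lintegral_comp (hf i)

theorem pi_withDensity {ι : Type*} [Fintype ι] {Ω : Type*} [MeasurableSpace Ω]
    (ν : Measure Ω) [IsProbabilityMeasure ν] {f : ι → Ω → ℝ≥0∞} (hf : ∀ i, Measurable (f i))
    [∀ i, SigmaFinite (ν.withDensity (f i))] :
    Measure.pi (fun i => ν.withDensity (f i)) =
      (Measure.pi fun _ : ι => ν).withDensity fun y => ∏ i, f i (y i) := by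
  refine Measure.pi_eq fun s hs => ?_
  rw [withDensity_apply _ (MeasurableSet.univ_pi hs),
    ← lintegral_indicator (MeasurableSet.univ_pi hs)]
  have e : (univ.pi s).indicator (fun y : ι → Ω => ∏ i, f i (y i)) =
      fun y => ∏ i, (s i).indicator (f i) (y i) := by
    ext y
    by_cases hy : y ∈ univ.pi s
    · rw [indicator_of_mem hy]
      exact Finset.prod_congr rfl fun i _ => (indicator_of_mem (hy i (mem_univ i)) _).symm
    · rw [indicator_of_notMem hy]
      simp only [Set.mem_pi, mem_univ, true_imp_iff, not_forall] at hy
      obtain ⟨i, hi⟩ := hy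
      exact (Finset.prod_eq_zero (Finset.mem_univ i) (indicator_of_notMem hi _)).symm
  rw [e, lintegral_pi_prod ν fun i => (hf i).indicator (hs i)]
  exact Finset.prod_congr rfl fun i _ => by
    rw [withDensity_apply _ (hs i), lintegral_indicator (hs i)]

/-- The density of the block channel with respect to the product of exponential distributions with
mean `1 + β`. -/
def blockDensity (β : ℝ) {n : ℕ} (x : Fin n → ℝ≥0) (y : Fin n → ℝ) : ℝ≥0∞ :=
  ∏ i, expDensity β (x i) (y i)

theorem measurable_blockDensity (β : ℝ) (n : ℕ) :
    Measurable (Function.uncurry (blockDensity β (n := n))) := by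
  have e : Function.uncurry (blockDensity β (n := n)) = fun p : (Fin n → ℝ≥0) × (Fin n → ℝ) =>
      ∏ i, expDensity β (p.1 i) (p.2 i) := rfl
  rw [e]
  refine Finset.measurable_prod _ fun i _ => ?_
  exact (measurable_expDensity β).comp (f := fun p : (Fin n → ℝ≥0) × (Fin n → ℝ) =>
    (p.1 i, p.2 i)) (by fun_prop)

theorem measurable_blockDensity_right (β : ℝ) {n : ℕ} (x : Fin n → ℝ≥0) :
    Measurable (blockDensity β x) :=
  (measurable_blockDensity β n).comp measurable_prodMk_left

theorem blockChannel_eq_withDensity {β : ℝ} (hβ : 0 < β) {n : ℕ} (x : Fin n → ℝ≥0) :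
    blockChannel expChannel n x =
      (Measure.pi fun _ : Fin n => expMeasure (1 / (1 + β))).withDensity (blockDensity β x) := by
  have := isProbabilityMeasure_exp hβ
  have h : ∀ i, IsProbabilityMeasure
      ((expMeasure (1 / (1 + β))).withDensity (expDensity β (x i))) := fun i => by
    rw [← expChannel_eq_withDensity hβ]; infer_instance
  have := pi_withDensity (expMeasure (1 / (1 + β)))
    (fun i => measurable_expDensity_right β (x i))
  change Measure.pi (fun i => expChannel (x i)) = _
  simp_rw [expChannel_eq_withDensity hβ]
  exact this

/-- Above the word, the density sees the word only through its sum; this underlies both coding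
bounds and the symmetry on the cost surface. -/
theorem blockDensity_of_le {β : ℝ} (hβ : 0 < β) {n : ℕ} {x : Fin n → ℝ≥0} {y : Fin n → ℝ}
    (h : ∀ i, (x i : ℝ) ≤ y i) :
    blockDensity β x y = ENNReal.ofReal
      ((1 + β) ^ n * Real.exp (∑ i, (x i : ℝ) - β / (1 + β) * ∑ i, y i)) := by
  simp only [blockDensity, expDensity, h, if_true]
  rw [← ENNReal.ofReal_prod_of_nonneg fun i _ => by positivity]
  rw [Finset.prod_mul_distrib, ← Real.exp_sum, Finset.sum_sub_distrib, Finset.mul_sum]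
  simp

theorem blockDensity_of_not_le {β : ℝ} {n : ℕ} {x : Fin n → ℝ≥0} {y : Fin n → ℝ}
    (h : ¬ ∀ i, (x i : ℝ) ≤ y i) : blockDensity β x y = 0 := by
  push Not at h
  obtain ⟨i, hi⟩ := h
  exact Finset.prod_eq_zero (Finset.mem_univ i) (by simp [expDensity, hi])

theorem blockCost_eq {n : ℕ} (hn : 1 ≤ n) (x : Fin n → ℝ≥0) :
    blockCost expCost n x = ENNReal.ofReal ((∑ i, (x i : ℝ)) / n) := by
  have hn0 : (0 : ℝ) < n := by exact_mod_cast hn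
  rw [blockCost, ENNReal.ofReal_div_of_pos hn0, ENNReal.ofReal_natCast,
    ENNReal.ofReal_sum_of_nonneg fun i _ => NNReal.coe_nonneg _]
  simp [expCost]

theorem mem_costSurface_iff {β : ℝ} (hβ : 0 < β) {n : ℕ} (hn : 1 ≤ n) (x : Fin n → ℝ≥0) :
    x ∈ costSurface expCost β n ↔ ∑ i, (x i : ℝ) = n * β := by
  have hn0 : (0 : ℝ) < n := by exact_mod_cast hn
  change blockCost expCost n x = _ ↔ _
  rw [blockCost_eq hn, ENNReal.ofReal_eq_ofReal_iff (by positivity) hβ.le, div_eq_iff hn0.ne',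
    mul_comm]

theorem blockCost_le_iff {β : ℝ} (hβ : 0 < β) {n : ℕ} (hn : 1 ≤ n) (x : Fin n → ℝ≥0) :
    blockCost expCost n x ≤ ENNReal.ofReal β ↔ ∑ i, (x i : ℝ) ≤ n * β := by
  have hn0 : (0 : ℝ) < n := by exact_mod_cast hn
  rw [blockCost_eq hn, ENNReal.ofReal_le_ofReal_iff hβ.le, div_le_iff₀ hn0, mul_comm]

theorem ae_nonneg_pi_exp {β : ℝ} (hβ : 0 < β) (n : ℕ) :
    ∀ᵐ y ∂(Measure.pi fun _ : Fin n => expMeasure (1 / (1 + β))), ∀ i, 0 ≤ y i := by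
  have := isProbabilityMeasure_exp hβ
  rw [ae_all_iff]
  exact fun i => (measurePreserving_eval (fun _ : Fin n => expMeasure (1 / (1 + β))) i
    ).quasiMeasurePreserving.ae (ae_nonneg_expMeasure _)

/-- By Tonelli, the output density is the average of the block densities. Only nonnegative y matter,
since the reference law is carried by them. -/
theorem comp_blockChannel_le {β : ℝ} (hβ : 0 < β) {n : ℕ} (P : Measure (Fin n → ℝ≥0))
    [IsProbabilityMeasure P] {K : ℝ≥0∞}
    (h : ∀ y : Fin n → ℝ, (∀ i, 0 ≤ y i) → ∫⁻ x, blockDensity β x y ∂P ≤ K) :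
    blockChannel expChannel n ∘ₘ P ≤ K • Measure.pi fun _ : Fin n => expMeasure (1 / (1 + β)) := by
  have := isProbabilityMeasure_exp hβ
  refine Measure.le_iff.2 fun U hU => ?_
  rw [Measure.bind_apply hU (Kernel.aemeasurable _), Measure.smul_apply, smul_eq_mul]
  calc ∫⁻ x, blockChannel expChannel n x U ∂P
      = ∫⁻ x, ∫⁻ y in U, blockDensity β x y
          ∂(Measure.pi fun _ : Fin n => expMeasure (1 / (1 + β))) ∂P := by
        refine lintegral_congr fun x => ?_
        rw [blockChannel_eq_withDensity hβ, withDensity_apply _ hU]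
    _ = ∫⁻ y in U, ∫⁻ x, blockDensity β x y ∂P
          ∂(Measure.pi fun _ : Fin n => expMeasure (1 / (1 + β))) :=
        lintegral_lintegral_swap (measurable_blockDensity β n).aemeasurable
    _ ≤ ∫⁻ y in U, K ∂(Measure.pi fun _ : Fin n => expMeasure (1 / (1 + β))) := by
        refine lintegral_mono_ae (ae_restrict_of_ae ?_)
        filter_upwards [ae_nonneg_pi_exp hβ n] with y hy using h y hy
    _ = _ := by simp

theorem measurableSet_word_le {n : ℕ} (y : Fin n → ℝ) :
    MeasurableSet {x : Fin n → ℝ≥0 | ∀ i, (x i : ℝ) ≤ y i} := by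
  rw [ofPred_forall]
  exact MeasurableSet.iInter fun i => measurableSet_le (by fun_prop) measurable_const

/-- With the sum fixed, the density is constant in x on the words below y, so the output density is
that constant times their probability. -/
theorem lintegral_blockDensity {β : ℝ} (hβ : 0 < β) {n : ℕ} (P : Measure (Fin n → ℝ≥0))
    (hP : ∀ᵐ x ∂P, ∑ i, (x i : ℝ) = n * β) (y : Fin n → ℝ) :
    ∫⁻ x, blockDensity β x y ∂P = ENNReal.ofReal
      ((1 + β) ^ n * Real.exp (n * β - β / (1 + β) * ∑ i, y i)) *
        P {x | ∀ i, (x i : ℝ) ≤ y i} := by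
  rw [← lintegral_indicator_const (measurableSet_word_le y)]
  refine lintegral_congr_ae ?_
  filter_upwards [hP] with x hx
  by_cases h : ∀ i, (x i : ℝ) ≤ y i
  · rw [indicator_of_mem (show x ∈ {x : Fin n → ℝ≥0 | ∀ i, (x i : ℝ) ≤ y i} from h),
      blockDensity_of_le hβ h, hx]
  · rw [indicator_of_notMem (show x ∉ {x : Fin n → ℝ≥0 | ∀ i, (x i : ℝ) ≤ y i} from h),
      blockDensity_of_not_le h]

end BlockDensity

/-! ### An input on the cost surface with dominated output. -/

section DominatedInput

/-- Completes a word by a first letter so that the sum becomes `t`, if possible. -/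
def completeWord (t : ℝ) {m : ℕ} (z : Fin m → ℝ≥0) : Fin (m + 1) → ℝ≥0 :=
  Fin.cons (t - ∑ i, (z i : ℝ)).toNNReal z

theorem measurable_completeWord (t : ℝ) (m : ℕ) :
    Measurable (completeWord t : (Fin m → ℝ≥0) → Fin (m + 1) → ℝ≥0) := by
  refine measurable_pi_iff.2 fun i => ?_
  refine Fin.cases ?_ (fun j => ?_) i
  · simp only [completeWord, Fin.cons_zero]
    fun_prop
  · simp only [completeWord, Fin.cons_succ]
    fun_prop

theorem sum_completeWord {t : ℝ} {m : ℕ} {z : Fin m → ℝ≥0} (h : ∑ i, (z i : ℝ) ≤ t) :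
    ∑ i, (completeWord t z i : ℝ) = t := by
  rw [Fin.sum_univ_succ]
  simp only [completeWord, Fin.cons_zero, Fin.cons_succ]
  rw [Real.coe_toNNReal _ (by linarith)]
  ring

/-- For long blocks there is an input distribution on the cost surface whose output distribution is
dominated, up to a constant factor, by the product of the optimal output distributions. -/
theorem exists_input_dominated {β : ℝ} (hβ : 0 < β) :
    ∃ K : ℝ, 0 < K ∧ ∀ᶠ n : ℕ in atTop, ∃ P : Measure (Fin n → ℝ≥0), IsProbabilityMeasure P ∧
      (∀ᵐ x ∂P, x ∈ costSurface expCost β n) ∧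
      blockChannel expChannel n ∘ₘ P ≤
        ENNReal.ofReal K • Measure.pi fun _ : Fin n => expMeasure (1 / (1 + β)) := by
  have := isProbabilityMeasure_expInput hβ
  have hl : 0 < β / (1 + β) := by positivity
  -- The shift β − 2 puts the upper end of the window of radius 2 exactly at (m+1)β, so that the
  -- completing letter is nonnegative.
  obtain ⟨c, κ, hc, hκ, hlow⟩ := exists_le_measureReal_window_inter hβ (β - 2)
  obtain ⟨C, hC, hup⟩ := exists_integral_exp_neg_le hl hκ
  refine ⟨C / c * (1 + β) * Real.exp 6, by positivity, ?_⟩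
  suffices h : ∀ᶠ m : ℕ in atTop, ∃ P : Measure (Fin (m + 1) → ℝ≥0), IsProbabilityMeasure P ∧
      (∀ᵐ x ∂P, x ∈ costSurface expCost β (m + 1)) ∧
      blockChannel expChannel (m + 1) ∘ₘ P ≤ ENNReal.ofReal (C / c * (1 + β) * Real.exp 6) •
        Measure.pi fun _ : Fin (m + 1) => expMeasure (1 / (1 + β)) by
    obtain ⟨m₀, hm₀⟩ := eventually_atTop.1 h
    refine eventually_atTop.2 ⟨m₀ + 1, fun n hn => ?_⟩
    obtain ⟨m, rfl⟩ : ∃ m, n = m + 1 := ⟨n - 1, by omega⟩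
    exact hm₀ m (by omega)
  filter_upwards [hlow, eventually_ge_atTop 1] with m hm hm1
  have hm0 : (0 : ℝ) < m := by exact_mod_cast hm1
  have hsm : (0 : ℝ) < √m := Real.sqrt_pos.2 hm0
  set μ := Measure.pi fun _ : Fin m => expInput β with hμ
  set A : Set (Fin m → ℝ≥0) := {z | |∑ i, (z i : ℝ) - (m * β + (β - 2))| ≤ 2} ∩
    {z | κ * m ≤ ∑ i, truncationDeficit (β / (1 + β) * z i)} with hA
  have hAm : MeasurableSet A := by
    refine (measurableSet_window _).inter (measurableSet_le measurable_const ?_)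
    have := continuous_truncationDeficit.measurable
    fun_prop
  have hA0 : 0 < μ.real A := lt_of_lt_of_le (by positivity) hm
  have hA0' : μ A ≠ 0 := fun h => by simp [measureReal_def, h] at hA0
  have hcond : IsProbabilityMeasure μ[|A] := cond_isProbabilityMeasure hA0'
  have hφ := measurable_completeWord ((m + 1 : ℕ) * β) m
  have hsum : ∀ᵐ x ∂(μ[|A].map (completeWord ((m + 1 : ℕ) * β))),
      ∑ i, (x i : ℝ) = (m + 1 : ℕ) * β := by
    rw [ae_map_iff hφ.aemeasurable (measurableSet_eq_fun (by fun_prop) measurable_const)]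
    filter_upwards [ae_cond_mem hAm] with z hz
    refine sum_completeWord ?_
    have hz1 : |∑ i, (z i : ℝ) - (m * β + (β - 2))| ≤ 2 := hz.1
    have := (abs_le.1 hz1).2
    push_cast
    linarith
  have hprob : IsProbabilityMeasure (μ[|A].map (completeWord ((m + 1 : ℕ) * β))) :=
    Measure.isProbabilityMeasure_map hφ.aemeasurable
  refine ⟨μ[|A].map (completeWord ((m + 1 : ℕ) * β)), hprob, ?_, ?_⟩
  · filter_upwards [hsum] with x hx using (mem_costSurface_iff hβ (by omega) x).2 hx
  refine comp_blockChannel_le hβ _ fun y hy => ?_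
  rw [lintegral_blockDensity hβ _ hsum y,
    Measure.map_apply hφ (measurableSet_word_le y), cond_apply hAm]
  set y' : Fin m → ℝ := fun i => y i.succ with hy'
  have hsub : A ∩ completeWord ((m + 1 : ℕ) * β) ⁻¹' {x | ∀ i, (x i : ℝ) ≤ y i} ⊆
      {z | (∀ i, (z i : ℝ) ≤ y' i) ∧ |∑ i, (z i : ℝ) - (m * β + (β - 2))| ≤ 2} ∩ A := by
    rintro z ⟨hz1, hz2⟩
    exact ⟨⟨fun i => by simpa [completeWord] using hz2 i.succ, hz1.1⟩, hz1⟩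
  -- If no admissible word lies below y there is nothing to bound. Otherwise one such word certifies
  -- that y itself has a total deficit of at least κ m, as the anti-concentration bound requires.
  rcases (A ∩ completeWord ((m + 1 : ℕ) * β) ⁻¹' {x | ∀ i, (x i : ℝ) ≤ y i}).eq_empty_or_nonempty
    with he | ⟨z₀, hz₀⟩
  · rw [he]; simp
  have hz₀' := hsub hz₀
  have hdef : κ * m ≤ ∑ i, truncationDeficit (β / (1 + β) * y' i) := by
    refine hz₀'.2.2.trans (Finset.sum_le_sum fun i _ => ?_)
    have hyi : 0 ≤ y' i := hy i.succ
    exact strictMonoOn_truncationDeficit.monotoneOn (mem_Ici.2 (by positivity))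
      (mem_Ici.2 (by positivity)) (mul_le_mul_of_nonneg_left (hz₀'.1.1 i) hl.le)
  have hbound := measureReal_pi_expInput_window_le hβ hκ (fun i => hy i.succ) hdef
    (m * β + (β - 2))
  have hI := hup m hm1
  have hmeas : μ (A ∩ completeWord ((m + 1 : ℕ) * β) ⁻¹' {x | ∀ i, (x i : ℝ) ≤ y i}) ≤
      ENNReal.ofReal (Real.exp (4 - (m * β + (β - 2))) * ((1 / (1 + β)) ^ m *
        Real.exp (β / (1 + β) * ∑ i, y' i) * (C / √m))) := by
    refine (measure_mono (hsub.trans inter_subset_left)).trans ?_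
    rw [← ofReal_measureReal]
    refine ENNReal.ofReal_le_ofReal (hbound.trans ?_)
    gcongr
  have hinv : (μ A)⁻¹ ≤ ENNReal.ofReal (√m / c) := by
    rw [← ofReal_measureReal (s := A), ← ENNReal.ofReal_inv_of_pos hA0]
    refine ENNReal.ofReal_le_ofReal ?_
    rw [← inv_div]
    exact inv_anti₀ (by positivity) hm
  refine (mul_le_mul_right (mul_le_mul' hinv hmeas) _).trans ?_
  rw [← ENNReal.ofReal_mul (by positivity), ← ENNReal.ofReal_mul (by positivity)]
  refine ENNReal.ofReal_le_ofReal ?_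
  rw [Fin.sum_univ_succ]
  -- The factors √m cancel, as do the powers of 1 + β except one; the exponents add up to 4 + 2
  -- minus the contribution of the first output letter.
  have e : (1 + β) ^ (m + 1) * Real.exp ((m + 1 : ℕ) * β - β / (1 + β) * (y 0 + ∑ i, y' i)) *
      (√m / c * (Real.exp (4 - (m * β + (β - 2))) * ((1 / (1 + β)) ^ m *
        Real.exp (β / (1 + β) * ∑ i, y' i) * (C / √m)))) =
      C / c * (1 + β) * Real.exp (6 - β / (1 + β) * y 0) := by
    have e1 : Real.exp (6 - β / (1 + β) * y 0) =
        Real.exp ((m + 1 : ℕ) * β - β / (1 + β) * (y 0 + ∑ i, y' i)) *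
        Real.exp (4 - (m * β + (β - 2))) * Real.exp (β / (1 + β) * ∑ i, y' i) := by
      rw [← Real.exp_add, ← Real.exp_add]
      congr 1
      push_cast
      ring
    rw [e1, div_pow, one_pow, pow_succ]
    field_simp
  rw [e]
  have h0 : 0 ≤ β / (1 + β) * y 0 := mul_nonneg hl.le (hy 0)
  gcongr
  linarith

end DominatedInput

/-! ### The total noise and the likelihood-ratio threshold. -/

section Noise

/-- The law of the noise in `n` uses of the channel. -/
def noiseLaw (n : ℕ) : Measure (Fin n → ℝ) := Measure.pi fun _ => expMeasure 1

instance : IsProbabilityMeasure (expMeasure 1) := isProbabilityMeasure_expMeasure one_pos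

instance (n : ℕ) : IsProbabilityMeasure (noiseLaw n) := by
  unfold noiseLaw; infer_instance

instance (n : ℕ) : IsMarkovKernel (blockChannel expChannel n) :=
  ⟨fun x => by
    change IsProbabilityMeasure (Measure.pi fun i => expChannel (x i))
    infer_instance⟩

theorem blockChannel_eq_map {n : ℕ} (x : Fin n → ℝ≥0) :
    blockChannel expChannel n x = (noiseLaw n).map fun z i => (x i : ℝ) + z i := by
  change Measure.pi (fun i => expChannel (x i)) = _
  simp_rw [expChannel_apply]
  have : ∀ i, IsProbabilityMeasure ((expMeasure 1).map fun z => (x i : ℝ) + z) := fun i =>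
    Measure.isProbabilityMeasure_map (by fun_prop)
  exact (Measure.pi_map_pi (μ := fun _ : Fin n => expMeasure 1) (f := fun i z => (x i : ℝ) + z)
    (fun i => by fun_prop)).symm

theorem ae_nonneg_noiseLaw (n : ℕ) : ∀ᵐ z ∂(noiseLaw n), ∀ i, 0 ≤ z i := by
  rw [ae_all_iff]
  exact fun i => (measurePreserving_eval (fun _ : Fin n => expMeasure 1) i
    ).quasiMeasurePreserving.ae (ae_nonneg_expMeasure _)

theorem measurableSet_shift_le {n : ℕ} (x : Fin n → ℝ≥0) :
    MeasurableSet {y : Fin n → ℝ | ∀ i, (x i : ℝ) ≤ y i} := by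
  rw [ofPred_forall]
  exact MeasurableSet.iInter fun i => measurableSet_le measurable_const (by fun_prop)

theorem ae_le_blockChannel {n : ℕ} (x : Fin n → ℝ≥0) :
    ∀ᵐ y ∂(blockChannel expChannel n x), ∀ i, (x i : ℝ) ≤ y i := by
  have hm : Measurable fun (z : Fin n → ℝ) i => (x i : ℝ) + z i := by fun_prop
  rw [blockChannel_eq_map, ae_map_iff hm.aemeasurable (measurableSet_shift_le x)]
  filter_upwards [ae_nonneg_noiseLaw n] with z hz i
  simpa using hz i

theorem measurableSet_sum_sub_le {n : ℕ} (x : Fin n → ℝ≥0) (c : ℝ) :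
    MeasurableSet {y : Fin n → ℝ | ∑ i, (y i - x i) ≤ c} :=
  measurableSet_le (by fun_prop) measurable_const

theorem blockChannel_sum_sub_le {n : ℕ} (x : Fin n → ℝ≥0) (c : ℝ) :
    blockChannel expChannel n x {y | ∑ i, (y i - x i) ≤ c} =
      noiseLaw n {z | ∑ i, z i ≤ c} := by
  rw [blockChannel_eq_map, Measure.map_apply (by fun_prop) (measurableSet_sum_sub_le x c)]
  congr 1
  ext z
  simp only [mem_preimage, mem_ofPred_eq, add_sub_cancel_left]

/-- The distribution function of the total noise. -/
def noiseCdf (n : ℕ) (c : ℝ) : ℝ := (noiseLaw n).real {z | ∑ i, z i ≤ c}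

/-- The likelihood-ratio threshold that corresponds to the value `c` of the total noise. -/
def ratioThreshold (β : ℝ) (n : ℕ) (c : ℝ) : ℝ :=
  (1 + β) ^ n * Real.exp (β / (1 + β) * (n - c))

theorem ratioThreshold_pos {β : ℝ} (hβ : 0 < β) (n : ℕ) (c : ℝ) : 0 < ratioThreshold β n c := by
  unfold ratioThreshold; positivity

end Noise

/-! ### The converse bound. -/

section Converse

/-- A Neyman-Pearson estimate. Where the total noise is at most c, bound f by 1. Elsewhere the
density is at most the threshold, because its exponent increases with the sum of the word; this is
why words of smaller cost need no separate treatment. -/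
theorem lintegral_blockChannel_le {β : ℝ} (hβ : 0 < β) {n : ℕ} {x : Fin n → ℝ≥0}
    (hx : ∑ i, (x i : ℝ) ≤ n * β) (c : ℝ) {f : (Fin n → ℝ) → ℝ≥0∞} (hf : Measurable f)
    (hf1 : ∀ y, f y ≤ 1) :
    ∫⁻ y, f y ∂(blockChannel expChannel n x) ≤ ENNReal.ofReal (noiseCdf n c) +
      ENNReal.ofReal (ratioThreshold β n c) *
        ∫⁻ y, f y ∂(Measure.pi fun _ : Fin n => expMeasure (1 / (1 + β))) := by
  rw [← lintegral_add_compl f (measurableSet_sum_sub_le x c)]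
  refine add_le_add ?_ ?_
  · calc ∫⁻ y in {y | ∑ i, (y i - x i) ≤ c}, f y ∂(blockChannel expChannel n x)
        ≤ ∫⁻ y in {y | ∑ i, (y i - x i) ≤ c}, 1 ∂(blockChannel expChannel n x) :=
          lintegral_mono fun y => hf1 y
      _ = _ := by
          rw [lintegral_one, Measure.restrict_apply_univ, blockChannel_sum_sub_le, noiseCdf,
            ofReal_measureReal]
  · rw [blockChannel_eq_withDensity hβ, setLIntegral_withDensity_eq_setLIntegral_mul _
      (measurable_blockDensity_right β x) hf
      (measurableSet_sum_sub_le x c).compl, ← lintegral_const_mul _ hf]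
    refine (setLIntegral_mono (hf.const_mul _) fun y hy => ?_).trans
      (setLIntegral_le_lintegral _ _)
    refine mul_le_mul_left ?_ _
    by_cases h : ∀ i, (x i : ℝ) ≤ y i
    · rw [blockDensity_of_le hβ h]
      refine ENNReal.ofReal_le_ofReal ?_
      unfold ratioThreshold
      gcongr
      rw [mem_compl_iff, mem_ofPred_eq, not_le, Finset.sum_sub_distrib] at hy
      have h1 : β / (1 + β) * (∑ i, (x i : ℝ) + c) ≤ β / (1 + β) * ∑ i, y i := by
        gcongr; linarith
      have h2 : ∑ i, (x i : ℝ) - β / (1 + β) * (∑ i, (x i : ℝ) + c) =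
          (∑ i, (x i : ℝ)) / (1 + β) - β / (1 + β) * c := by field_simp; ring
      have h3 : (∑ i, (x i : ℝ)) / (1 + β) ≤ n * β / (1 + β) := by gcongr
      have h4 : β / (1 + β) * (n - c) = n * β / (1 + β) - β / (1 + β) * c := by ring
      linarith
    · rw [blockDensity_of_not_le h]; exact zero_le

/-- The converse bound. -/
theorem CodeExists.mul_le {β : ℝ} (hβ : 0 < β) {n M : ℕ} (hn : 1 ≤ n) {ε : ℝ} (hε : 0 ≤ ε)
    (h : CodeExists expChannel expCost n M ε β) (c : ℝ) :
    M * (1 - ε - noiseCdf n c) ≤ ratioThreshold β n c := by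
  have hγ := ratioThreshold_pos hβ n c
  rcases Nat.eq_zero_or_pos M with rfl | hM
  · simpa using hγ.le
  have := isProbabilityMeasure_exp hβ
  obtain ⟨enc, dec, henc, hdec, hcost, herr⟩ := h
  have hM0 : (M : ℝ≥0∞) ≠ 0 := by exact_mod_cast hM.ne'
  rw [ENNReal.div_le_iff hM0 (ENNReal.natCast_ne_top M)] at herr
  have hsucc : ∀ m, (dec ∘ₖ blockChannel expChannel n ∘ₖ enc) m {m} ≤
      ENNReal.ofReal (noiseCdf n c) + ENNReal.ofReal (ratioThreshold β n c) *
        ∫⁻ y, dec y {m} ∂(Measure.pi fun _ : Fin n => expMeasure (1 / (1 + β))) := by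
    intro m
    rw [Kernel.comp_apply' _ _ _ (measurableSet_singleton m)]
    refine (lintegral_mono_ae (g := fun _ => ENNReal.ofReal (noiseCdf n c) +
      ENNReal.ofReal (ratioThreshold β n c) *
        ∫⁻ y, dec y {m} ∂(Measure.pi fun _ : Fin n => expMeasure (1 / (1 + β)))) ?_).trans ?_
    · filter_upwards [hcost m] with x hx
      rw [Kernel.comp_apply' _ _ _ (measurableSet_singleton m)]
      exact lintegral_blockChannel_le hβ ((blockCost_le_iff hβ hn x).1 hx) c
        (Kernel.measurable_coe _ (measurableSet_singleton m)) fun y => prob_le_one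
    · simp
  have hone : ∀ m, 1 = (dec ∘ₖ blockChannel expChannel n ∘ₖ enc) m {m} +
      (dec ∘ₖ blockChannel expChannel n ∘ₖ enc) m {m}ᶜ := fun m => by
    rw [measure_add_measure_compl (measurableSet_singleton m), measure_univ]
  -- Under the fixed reference law the output is independent of the message, and the decoder's
  -- message probabilities add up to one.
  have hdec1 : ∑ m, ∫⁻ y, dec y {m} ∂(Measure.pi fun _ : Fin n => expMeasure (1 / (1 + β))) = 1 := by
    rw [← lintegral_finsetSum _ fun m _ => Kernel.measurable_coe _ (measurableSet_singleton m)]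
    have : ∀ y, ∑ m, dec y {m} = 1 := fun y => by
      rw [sum_measure_singleton, Finset.coe_univ, measure_univ]
    simp only [this, lintegral_one, measure_univ]
  have htot : (M : ℝ≥0∞) ≤ M * ENNReal.ofReal (noiseCdf n c) +
      ENNReal.ofReal (ratioThreshold β n c) + ENNReal.ofReal ε * M := by
    calc (M : ℝ≥0∞) = ∑ m : Fin M, 1 := by simp
      _ = ∑ m, (dec ∘ₖ blockChannel expChannel n ∘ₖ enc) m {m} +
          ∑ m, (dec ∘ₖ blockChannel expChannel n ∘ₖ enc) m {m}ᶜ := by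
          rw [← Finset.sum_add_distrib]
          exact Finset.sum_congr rfl fun m _ => hone m
      _ ≤ _ := by
          refine add_le_add ((Finset.sum_le_sum fun m _ => hsucc m).trans ?_) herr
          rw [Finset.sum_add_distrib, ← Finset.mul_sum, hdec1]
          simp
  have hcdf : 0 ≤ noiseCdf n c := measureReal_nonneg
  have e : (M : ℝ≥0∞) * ENNReal.ofReal (noiseCdf n c) +
      ENNReal.ofReal (ratioThreshold β n c) + ENNReal.ofReal ε * M =
      ENNReal.ofReal (M * noiseCdf n c + ratioThreshold β n c + ε * M) := by
    rw [ENNReal.ofReal_add (by positivity) (by positivity),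
      ENNReal.ofReal_add (by positivity) hγ.le, ENNReal.ofReal_mul (by positivity),
      ENNReal.ofReal_mul hε, ENNReal.ofReal_natCast]
  rw [e, ← ENNReal.ofReal_natCast, ENNReal.ofReal_le_ofReal_iff (by positivity)] at htot
  linarith

theorem noiseCdf_of_neg (n : ℕ) {c : ℝ} (hc : c < 0) : noiseCdf n c = 0 := by
  have : noiseLaw n {z | ∑ i, z i ≤ c} = 0 := by
    rw [measure_eq_zero_iff_ae_notMem]
    filter_upwards [ae_nonneg_noiseLaw n] with z hz h
    have h1 : ∑ i, z i ≤ c := h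
    have h2 : 0 ≤ ∑ i, z i := Finset.sum_nonneg fun i _ => hz i
    linarith
  simp [noiseCdf, measureReal_def, this]

/-- Makes `maxCodeSize` a true maximum: the supremum in ℕ of an unbounded set would be 0. -/
theorem bddAbove_codeExists {β : ℝ} (hβ : 0 < β) {n : ℕ} (hn : 1 ≤ n) {ε : ℝ} (hε : 0 ≤ ε)
    (hε1 : ε < 1) : BddAbove {M : ℕ | CodeExists expChannel expCost n M ε β} := by
  -- Any negative noise level will do: the total noise is never below it, so the converse bounds M
  -- itself.
  refine ⟨⌈ratioThreshold β n (-1) / (1 - ε)⌉₊, fun M hM => ?_⟩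
  have hM' : CodeExists expChannel expCost n M ε β := hM
  have h := hM'.mul_le hβ hn hε (-1)
  rw [noiseCdf_of_neg n (by norm_num), sub_zero, ← le_div_iff₀ (by linarith)] at h
  exact_mod_cast h.trans (Nat.le_ceil _)

end Converse

/-! ### Greedy codes and the achievability bound. -/

section Achievability

theorem codeExists_of_decodingSets {β : ℝ} {n k : ℕ} (hk : 1 ≤ k) {ε : ℝ}
    {x : Fin k → Fin n → ℝ≥0} {D : Fin k → Set (Fin n → ℝ)}
    (hx : ∀ i, blockCost expCost n (x i) ≤ ENNReal.ofReal β)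
    (hD : ∀ i, MeasurableSet (D i)) (hdisj : Pairwise fun i j => Disjoint (D i) (D j))
    (herr : ∀ i, blockChannel expChannel n (x i) (D i)ᶜ ≤ ENNReal.ofReal ε) :
    CodeExists expChannel expCost n k ε β := by
  have : Nonempty (Fin k) := ⟨⟨0, hk⟩⟩
  obtain ⟨g, hg, hgD⟩ := exists_measurable_piecewise D hD (fun i _ => i)
    (fun _ => measurable_const) (fun i j hij y hy =>
      ((Set.disjoint_left.1 (hdisj hij)) hy.1 hy.2).elim)
  refine ⟨Kernel.deterministic x (measurable_of_finite _), Kernel.deterministic g hg, inferInstance,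
    inferInstance, fun m => ?_, ?_⟩
  · rw [Kernel.deterministic_apply]
    rw [ae_dirac_eq]
    exact hx m
  · have hk0 : (k : ℝ≥0∞) ≠ 0 := by exact_mod_cast (by omega : k ≠ 0)
    rw [ENNReal.div_le_iff hk0 (ENNReal.natCast_ne_top k)]
    calc _ ≤ ∑ m : Fin k, ENNReal.ofReal ε := by
          refine Finset.sum_le_sum fun m _ => (?_ : _ ≤ _).trans (herr m)
          rw [Kernel.comp_deterministic_eq_comap, Kernel.comap_apply,
            Kernel.deterministic_comp_eq_map, Kernel.map_apply' _ hg _ (measurableSet_singleton m).compl]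
          refine measure_mono fun y hy hyD => hy ?_
          exact hgD m hyD
      _ = _ := by simp [mul_comm]

/-- Greedy selection of codewords with disjoint decoding sets. -/
theorem exists_decodingSets {A B : Type*} [MeasurableSpace A] [MeasurableSpace B] (W : Kernel A B)
    [IsMarkovKernel W] {F : Set A} {G : A → Set B} (hG : ∀ x, MeasurableSet (G x))
    (P : Measure A) [IsProbabilityMeasure P] (hP : ∀ᵐ x ∂P, x ∈ F) {ν : Measure B} {K : ℝ≥0∞}
    (hK : W ∘ₘ P ≤ K • ν) {ε η : ℝ}
    (hW : ∀ x ∈ F, W x (G x)ᶜ + ENNReal.ofReal η ≤ ENNReal.ofReal ε) {g : ℝ≥0∞}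
    (hg : ∀ x ∈ F, ν (G x) ≤ g) (k : ℕ) (hk : K * (k * g) < ENNReal.ofReal η) :
    ∃ (x : Fin k → A) (D : Fin k → Set B), (∀ i, x i ∈ F) ∧ (∀ i, MeasurableSet (D i)) ∧
      (∀ i, D i ⊆ G (x i)) ∧ (Pairwise fun i j => Disjoint (D i) (D j)) ∧
      ∀ i, W (x i) (D i)ᶜ ≤ ENNReal.ofReal ε := by
  induction k with
  | zero => exact ⟨Fin.elim0, Fin.elim0, fun i => i.elim0, fun i => i.elim0, fun i => i.elim0,
      fun i => i.elim0, fun i => i.elim0⟩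
  | succ k ih =>
    have hk' : K * (k * g) < ENNReal.ofReal η := by
      refine lt_of_le_of_lt ?_ hk
      gcongr
      omega
    obtain ⟨x, D, hxF, hD, hDG, hdisj, herr⟩ := ih hk'
    set U := ⋃ i, D i with hU
    have hUm : MeasurableSet U := MeasurableSet.iUnion hD
    have hνU : ν U ≤ k * g := by
      refine (measure_iUnion_fintype_le _ _).trans ((Finset.sum_le_sum fun i _ =>
        (measure_mono (hDG i)).trans (hg _ (hxF i))).trans ?_)
      simp
    -- The sets used so far have small reference measure, hence small output probability by
    -- domination. As P is carried by F, some word of F puts mass less than η on them.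
    have hcomp : (W ∘ₘ P) U < ENNReal.ofReal η := by
      refine lt_of_le_of_lt (hK U) (lt_of_le_of_lt ?_ hk')
      rw [Measure.smul_apply, smul_eq_mul]
      gcongr
    obtain ⟨x₀, hx₀F, hx₀⟩ : ∃ x₀ ∈ F, W x₀ U < ENNReal.ofReal η := by
      by_contra hcon
      push Not at hcon
      rw [Measure.bind_apply hUm (Kernel.aemeasurable _)] at hcomp
      refine absurd hcomp (not_lt.2 ?_)
      calc ENNReal.ofReal η = ∫⁻ _, ENNReal.ofReal η ∂P := by simp
        _ ≤ _ := lintegral_mono_ae (by filter_upwards [hP] with x hx using hcon x hx)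
    -- The new decoding set is what the old ones leave of `G x₀`; the removal costs less than η in
    -- error probability.
    refine ⟨Fin.cons x₀ x, Fin.cons (G x₀ \ U) D, ?_, ?_, ?_, ?_, ?_⟩
    · exact fun i => Fin.cases hx₀F hxF i
    · exact fun i => Fin.cases ((hG x₀).diff hUm) hD i
    · exact fun i => Fin.cases (by simp) (by simpa using hDG) i
    · have h0 : ∀ i, Disjoint (G x₀ \ U) (D i) := fun i =>
        Set.disjoint_sdiff_left.mono_right (subset_iUnion D i)
      intro i j
      refine Fin.cases (Fin.cases ?_ (fun j' => ?_) j) (fun i' => Fin.cases ?_ (fun j' => ?_) j) i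
      · exact fun h => absurd rfl h
      · exact fun _ => by simpa using h0 j'
      · exact fun _ => by simpa using (h0 i').symm
      · exact fun h => by simpa using hdisj (fun e => h (by rw [e]))
    · refine fun i => Fin.cases ?_ (by simpa using herr) i
      simp only [Fin.cons_zero]
      refine le_trans ?_ (hW x₀ hx₀F)
      refine (measure_mono (t := (G x₀)ᶜ ∪ U) ?_).trans ((measure_union_le _ _).trans ?_)
      · intro y hy
        by_cases h : y ∈ G x₀
        · exact Or.inr (by_contra fun h' => hy ⟨h, h'⟩)
        · exact Or.inl h
      · gcongr

/-- The achievability bound. -/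
theorem codeExists_of_dominated {β : ℝ} (hβ : 0 < β) {n : ℕ} (hn : 1 ≤ n)
    (P : Measure (Fin n → ℝ≥0)) [IsProbabilityMeasure P]
    (hP : ∀ᵐ x ∂P, x ∈ costSurface expCost β n) {K : ℝ} (hK : 0 < K)
    (hdom : blockChannel expChannel n ∘ₘ P ≤
      ENNReal.ofReal K • Measure.pi fun _ : Fin n => expMeasure (1 / (1 + β)))
    {ε η c : ℝ} (hη : 0 < η) (hc : 1 - ε + η ≤ noiseCdf n c) {k : ℕ} (hk : 1 ≤ k)
    (hkK : k * K < η * ratioThreshold β n c) :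
    CodeExists expChannel expCost n k ε β := by
  have := isProbabilityMeasure_exp hβ
  have hγ := ratioThreshold_pos hβ n c
  have hcdf : 0 ≤ noiseCdf n c := measureReal_nonneg
  -- Outputs above the word with total noise at most c: there the density is at least the threshold,
  -- so the reference measure of `G x` is at most its inverse.
  let G : (Fin n → ℝ≥0) → Set (Fin n → ℝ) := fun x =>
    {y | ∀ i, (x i : ℝ) ≤ y i} ∩ {y | ∑ i, (y i - x i) ≤ c}
  have hGm : ∀ x, MeasurableSet (G x) := fun x =>
    (measurableSet_shift_le x).inter (measurableSet_sum_sub_le x c)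
  have hWG : ∀ x, blockChannel expChannel n x (G x) = ENNReal.ofReal (noiseCdf n c) := by
    intro x
    have h : G x =ᵐ[blockChannel expChannel n x] {y | ∑ i, (y i - x i) ≤ c} := by
      refine eventuallyEq_set.2 ?_
      filter_upwards [ae_le_blockChannel x] with y hy using ⟨fun h => h.2, fun h => ⟨hy, h⟩⟩
    rw [measure_congr h, blockChannel_sum_sub_le, noiseCdf, ofReal_measureReal]
  have hνG : ∀ x ∈ costSurface expCost β n,
      (Measure.pi fun _ : Fin n => expMeasure (1 / (1 + β))) (G x) ≤
        ENNReal.ofReal (1 / ratioThreshold β n c) := by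
    intro x hx
    rw [mem_costSurface_iff hβ hn] at hx
    have h1 : ENNReal.ofReal (ratioThreshold β n c) *
        (Measure.pi fun _ : Fin n => expMeasure (1 / (1 + β))) (G x) ≤ 1 := by
      refine le_trans ?_ (prob_le_one (μ := blockChannel expChannel n x) (s := G x))
      rw [blockChannel_eq_withDensity hβ, withDensity_apply _ (hGm x), ← setLIntegral_const]
      refine setLIntegral_mono (measurable_blockDensity_right β x)
        fun y hy => ?_
      have hy1 : ∀ i, (x i : ℝ) ≤ y i := hy.1
      have hy2 : ∑ i, (y i - x i) ≤ c := hy.2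
      rw [blockDensity_of_le hβ hy1]
      refine ENNReal.ofReal_le_ofReal ?_
      unfold ratioThreshold
      gcongr
      rw [Finset.sum_sub_distrib, hx] at hy2
      rw [hx]
      have h1 : β / (1 + β) * ∑ i, y i ≤ β / (1 + β) * (n * β + c) := by
        gcongr; linarith
      have h2 : n * β - β / (1 + β) * (n * β + c) = β / (1 + β) * (n - c) := by
        field_simp; ring
      linarith
    rw [ENNReal.ofReal_div_of_pos hγ, ENNReal.ofReal_one]
    rwa [ENNReal.le_div_iff_mul_le (Or.inl (by simpa using hγ)) (Or.inl (by simp)), mul_comm]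
  obtain ⟨x, D, hxF, hD, -, hdisj, herr⟩ := exists_decodingSets (ε := ε) (η := η)
    (blockChannel expChannel n) hGm P hP
    hdom (fun x _ => by
      rw [prob_compl_eq_one_sub (hGm x), hWG, ← ENNReal.ofReal_one,
        ← ENNReal.ofReal_sub 1 hcdf, ← ENNReal.ofReal_add (by
          have : noiseCdf n c ≤ 1 := measureReal_le_one
          linarith) hη.le]
      exact ENNReal.ofReal_le_ofReal (by linarith)) hνG k (by
      rw [← ENNReal.ofReal_natCast, ← ENNReal.ofReal_mul (by positivity),
        ← ENNReal.ofReal_mul hK.le, ENNReal.ofReal_lt_ofReal_iff hη]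
      rw [mul_one_div, mul_div_assoc', div_lt_iff₀ hγ]
      linarith)
  exact codeExists_of_decodingSets hk (fun i => le_of_eq (hxF i)) hD hdisj herr

theorem codeExists_one {β : ℝ} (hβ : 0 < β) {n : ℕ} (hn : 1 ≤ n) {ε : ℝ} :
    CodeExists expChannel expCost n 1 ε β := by
  refine codeExists_of_decodingSets (x := fun _ _ => 0) (D := fun _ => univ) le_rfl ?_
    (fun _ => MeasurableSet.univ) (fun i j h => absurd (Subsingleton.elim i j) h) (by simp)
  intro i
  rw [blockCost_le_iff hβ hn]
  simp
  positivity

end Achievability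

/-! ### Bounds on the normal tail. -/

section GaussianTail

/-- The standard normal distribution function. -/
def normalCdf (t : ℝ) : ℝ := (gaussianReal 0 1).real (Iic t)

/-- The Chernoff bound with the tilt equal to the threshold t. -/
theorem one_sub_exp_le_normalCdf {t : ℝ} (ht : 0 ≤ t) :
    1 - Real.exp (-(t ^ 2 / 2)) ≤ normalCdf t := by
  have h := measure_ge_le_exp_mul_mgf (μ := gaussianReal 0 1) (X := id) t ht
    (by simpa using! integrable_exp_mul_gaussianReal t)
  rw [mgf_id_gaussianReal, ← Real.exp_add] at h
  have h1 : normalCdf t = 1 - (gaussianReal 0 1).real (Ioi t) := by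
    rw [normalCdf, ← probReal_compl_eq_one_sub measurableSet_Ioi, compl_Ioi]
  have h2 : (gaussianReal 0 1).real (Ioi t) ≤ (gaussianReal 0 1).real {ω | t ≤ id ω} :=
    measureReal_mono fun x hx => by
      simpa using le_of_lt (mem_Ioi.1 hx)
  have h3 : -t * t + (0 * t + ((1 : ℝ≥0) : ℝ) * t ^ 2 / 2) = -(t ^ 2 / 2) := by
    rw [NNReal.coe_one]; ring
  rw [h3] at h
  linarith

/-- The tail contains (t, t + 1], where the density is at least its value at t + 1, and √(2π) ≤ 3.
-/
theorem normalCdf_le {t : ℝ} (ht : 0 ≤ t) :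
    normalCdf t ≤ 1 - 1 / 3 * Real.exp (-((t + 1) ^ 2 / 2)) := by
  have h1 : normalCdf t = 1 - (gaussianReal 0 1).real (Ioi t) := by
    rw [normalCdf, ← probReal_compl_eq_one_sub measurableSet_Ioi, compl_Ioi]
  have h2 : 1 / 3 * Real.exp (-((t + 1) ^ 2 / 2)) ≤ (gaussianReal 0 1).real (Ioi t) := by
    rw [measureReal_def, gaussianReal_apply_eq_integral _ one_ne_zero,
      ENNReal.toReal_ofReal (integral_nonneg fun x => gaussianPDFReal_nonneg _ _ _)]
    have h3 : ∫ x in Ioc t (t + 1), (1 / 3 * Real.exp (-((t + 1) ^ 2 / 2)) : ℝ) =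
        1 / 3 * Real.exp (-((t + 1) ^ 2 / 2)) := by simp
    rw [← h3]
    refine le_trans (setIntegral_mono_on (integrable_const _)
      (integrable_gaussianPDFReal 0 1).integrableOn measurableSet_Ioc fun x hx => ?_)
      (setIntegral_mono_set (integrable_gaussianPDFReal 0 1).integrableOn
        (ae_of_all _ fun x => gaussianPDFReal_nonneg _ _ _)
        Ioc_subset_Ioi_self.eventuallyLE)
    rw [gaussianPDFReal, NNReal.coe_one, mul_one, mul_one, sub_zero, neg_div]
    have h4 : √(2 * Real.pi) ≤ 3 := by
      rw [Real.sqrt_le_left (by norm_num)]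
      have := Real.pi_lt_four
      linarith
    have h5 : 1 / 3 ≤ (√(2 * Real.pi))⁻¹ := by
      rw [one_div]
      exact inv_anti₀ (Real.sqrt_pos.2 (by positivity)) h4
    have hx1 : 0 ≤ x := ht.trans hx.1.le
    have hx2 : x ≤ t + 1 := hx.2
    gcongr
  linarith

end GaussianTail

/-! ### The central limit theorem for the total noise. -/

section CentralLimit

theorem integral_expMeasure_sub_one : ∫ x, (x - 1) ∂(expMeasure 1) = 0 := by
  have h := integral_pow_expMeasure one_pos 1
  have hi := integrable_pow_expMeasure one_pos 1
  simp only [pow_one] at h hi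
  rw [integral_sub hi (integrable_const _), h]
  simp

theorem integral_expMeasure_sub_one_sq : ∫ x, (x - 1) ^ 2 ∂(expMeasure 1) = 1 := by
  have h1 := integral_pow_expMeasure one_pos 1
  have hi1 := integrable_pow_expMeasure one_pos 1
  have h2 := integral_pow_expMeasure one_pos 2
  have hi2 := integrable_pow_expMeasure one_pos 2
  simp only [pow_one] at h1 hi1
  have e : ∀ x : ℝ, (x - 1) ^ 2 = x ^ 2 - (2 * x - 1) := fun x => by ring
  simp_rw [e]
  have hi3 : Integrable (fun x : ℝ => 2 * x - 1) (expMeasure 1) :=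
    (hi1.const_mul 2).sub (integrable_const _)
  rw [integral_sub hi2 hi3, integral_sub (hi1.const_mul 2) (integrable_const _),
    integral_const_mul, h1, h2]
  norm_num

/-- Characteristic functions converge, hence the laws do; the limit law has no atom at t, so the
distribution functions converge there. -/
theorem tendsto_noiseCdf (t : ℝ) :
    Tendsto (fun n : ℕ => noiseCdf n (n + t * √n)) atTop (𝓝 (normalCdf t)) := by
  let S : (n : ℕ) → (Fin n → ℝ) → ℝ := fun n z => (√n)⁻¹ * ∑ i, (z i - 1)
  have hS : ∀ n, Measurable (S n) := fun n => by fun_prop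
  let ν : ℕ → ProbabilityMeasure ℝ := fun n =>
    ⟨(noiseLaw n).map (S n), Measure.isProbabilityMeasure_map (hS n).aemeasurable⟩
  let ν₀ : ProbabilityMeasure ℝ := ⟨gaussianReal 0 1, inferInstance⟩
  have hchar : ∀ (n : ℕ) (u : ℝ), charFun ((noiseLaw n).map (S n)) u =
      charFun ((expMeasure 1).map fun x => x - 1) ((√n)⁻¹ * u) ^ n := by
    intro n u
    rw [charFun_apply_real, charFun_apply_real, integral_map (hS n).aemeasurable
      (Measurable.aestronglyMeasurable (by fun_prop)), integral_map (by fun_prop)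
      (Measurable.aestronglyMeasurable (by fun_prop)), noiseLaw]
    have h := integral_fintype_prod_eq_pow (ι := Fin n) (μ := expMeasure 1) (fun x : ℝ =>
      Complex.exp (((√n)⁻¹ * u : ℝ) * ((x - 1 : ℝ) : ℂ) * Complex.I))
    rw [Fintype.card_fin] at h
    rw [← h]
    refine integral_congr_ae (ae_of_all _ fun z => ?_)
    simp only [S]
    rw [← Complex.exp_sum]
    congr 1
    push_cast
    rw [← Finset.sum_mul, ← Finset.mul_sum]
    ring
  have hlim : Tendsto ν atTop (𝓝 ν₀) := by
    refine ProbabilityMeasure.tendsto_iff_tendsto_charFun.2 fun u => ?_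
    have h := tendsto_charFun_inv_sqrt_mul_pow (P := expMeasure 1) (X := fun x : ℝ => x - 1)
      (by fun_prop) integral_expMeasure_sub_one
      (by simpa using integral_expMeasure_sub_one_sq) u
    have e1 : charFun (ν₀ : Measure ℝ) u = Complex.exp (-(u : ℂ) ^ 2 / 2) := by
      change charFun (gaussianReal 0 1) u = _
      rw [charFun_gaussianReal]
      congr 1
      push_cast
      ring
    rw [e1]
    exact h.congr fun n => (hchar n u).symm
  have hfr : (ν₀ : Measure ℝ) (frontier (Iic t)) = 0 := by
    rw [frontier_Iic]
    have := nullSingletonClass_gaussianReal (μ := 0) (v := 1) one_ne_zero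
    change gaussianReal 0 1 {t} = 0
    exact measure_singleton t
  have h1 := ProbabilityMeasure.tendsto_measure_of_null_frontier_of_tendsto' hlim hfr
  have h2 := (ENNReal.tendsto_toReal (measure_ne_top _ _)).comp h1
  refine h2.congr' ?_
  filter_upwards [eventually_ge_atTop 1] with n hn
  have hn0 : (0 : ℝ) < √n := Real.sqrt_pos.2 (by exact_mod_cast hn)
  change ((noiseLaw n).map (S n) (Iic t)).toReal = _
  rw [Measure.map_apply (hS n) measurableSet_Iic, noiseCdf, measureReal_def]
  congr 2
  ext z
  simp only [S, mem_preimage, mem_Iic, mem_ofPred_eq, Finset.sum_sub_distrib, Finset.sum_const,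
    Finset.card_univ, Fintype.card_fin, nsmul_eq_mul, mul_one]
  rw [inv_mul_le_iff₀ hn0, mul_comm]
  constructor <;> intro h <;> linarith

end CentralLimit

/-! ### The capacity-cost function and the optimal output. -/

section Capacity

open InformationTheory

/-- Data processing for the swap, applied in both directions. -/
theorem klDiv_map_swap {A B : Type*} [MeasurableSpace A] [MeasurableSpace B]
    (μ ν : Measure (A × B)) [IsFiniteMeasure μ] [IsFiniteMeasure ν] :
    klDiv (μ.map Prod.swap) (ν.map Prod.swap) = klDiv μ ν := by
  refine le_antisymm (klDiv_map_le _ _ measurable_swap) ?_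
  have h := klDiv_map_le (μ.map Prod.swap) (ν.map Prod.swap)
    (measurable_swap (α := B) (β := A))
  rwa [Measure.map_map measurable_swap measurable_swap,
    Measure.map_map measurable_swap measurable_swap, Prod.swap_swap_eq, Measure.map_id,
    Measure.map_id] at h

/-- The compensation identity: the divergence to an arbitrary output distribution is the mutual
information plus the divergence of the induced output distribution. -/
theorem klDiv_compProd_prod_eq {A B : Type*} [MeasurableSpace A] [MeasurableSpace B]
    [StandardBorelSpace A] [Nonempty A] (W : Kernel A B) [IsMarkovKernel W] (P : Measure A)
    [IsProbabilityMeasure P] (Q : Measure B) [IsProbabilityMeasure Q] :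
    klDiv (P ⊗ₘ W) (P.prod Q) =
      klDiv (P ⊗ₘ W) (P.prod (W ∘ₘ P)) + klDiv (W ∘ₘ P) Q := by
  -- The chain rule is taken with the output first: the posterior kernel disintegrates the joint
  -- law, and the reference product has constant conditional law P.
  have h := klDiv_compProd_eq_add (W ∘ₘ P) Q (W†P) (Kernel.const B P)
  rw [compProd_posterior_eq_map_swap, Measure.compProd_const, Measure.compProd_const,
    ← Measure.prod_swap, klDiv_map_swap, ← Measure.prod_swap (μ := P), klDiv_map_swap] at h
  rw [h, add_comm]

theorem expChannel_preimage_sub (x : ℝ≥0) {s : Set ℝ} (hs : MeasurableSet s) :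
    expChannel x {y | y - x ∈ s} = expMeasure 1 s := by
  have hm : MeasurableSet {y : ℝ | y - x ∈ s} := hs.preimage (f := fun y : ℝ => y - x) (by fun_prop)
  rw [expChannel_apply, Measure.map_apply (by fun_prop) hm]
  congr 1
  ext z
  simp only [mem_preimage, mem_ofPred_eq, add_sub_cancel_left]

theorem map_sub_expChannel (x : ℝ≥0) :
    (expChannel x).map (fun y : ℝ => y - (x : ℝ)) = expMeasure 1 := by
  ext s hs
  rw [Measure.map_apply (by fun_prop) hs]
  exact expChannel_preimage_sub x hs

theorem map_sub_compProd (P : Measure ℝ≥0) [IsProbabilityMeasure P] :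
    (P ⊗ₘ expChannel).map (fun p : ℝ≥0 × ℝ => p.2 - (p.1 : ℝ)) = expMeasure 1 := by
  ext s hs
  have hm : Measurable fun p : ℝ≥0 × ℝ => p.2 - (p.1 : ℝ) := by fun_prop
  rw [Measure.map_apply hm hs, Measure.compProd_apply (hm hs)]
  have : ∀ x, expChannel x (Prod.mk x ⁻¹' ((fun p : ℝ≥0 × ℝ => p.2 - (p.1 : ℝ)) ⁻¹' s)) =
      expMeasure 1 s := fun x => expChannel_preimage_sub x hs
  simp [this]

theorem compProd_eq_withDensity {β : ℝ} (hβ : 0 < β) (P : Measure ℝ≥0) [IsProbabilityMeasure P] :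
    P ⊗ₘ expChannel = (P.prod (expMeasure (1 / (1 + β)))).withDensity
      (Function.uncurry (expDensity β)) := by
  have := isProbabilityMeasure_exp hβ
  ext s hs
  rw [Measure.compProd_apply hs, withDensity_apply _ hs, ← lintegral_indicator hs,
    lintegral_prod _ ((measurable_expDensity β).indicator hs).aemeasurable]
  refine lintegral_congr fun x => ?_
  rw [expChannel_eq_withDensity hβ, withDensity_apply _ (measurable_prodMk_left hs),
    ← lintegral_indicator (measurable_prodMk_left hs)]
  rfl

theorem ae_le_compProd (P : Measure ℝ≥0) [IsProbabilityMeasure P] :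
    ∀ᵐ p ∂(P ⊗ₘ expChannel), (p.1 : ℝ) ≤ p.2 :=
  Measure.ae_compProd_of_ae_ae (measurableSet_le (by fun_prop) (by fun_prop))
    (ae_of_all _ ae_le_expChannel)

theorem llr_compProd_ae_eq {β : ℝ} (hβ : 0 < β) (P : Measure ℝ≥0) [IsProbabilityMeasure P] :
    llr (P ⊗ₘ expChannel) (P.prod (expMeasure (1 / (1 + β)))) =ᵐ[P ⊗ₘ expChannel]
      fun p => Real.log (1 + β) + (p.1 : ℝ) / (1 + β) - β / (1 + β) * (p.2 - p.1) := by
  have := isProbabilityMeasure_exp hβ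
  have h := Measure.rnDeriv_withDensity (P.prod (expMeasure (1 / (1 + β))))
    (measurable_expDensity β)
  rw [← compProd_eq_withDensity hβ] at h
  have hac : P ⊗ₘ expChannel ≪ P.prod (expMeasure (1 / (1 + β))) := by
    rw [compProd_eq_withDensity hβ]; exact withDensity_absolutelyContinuous _ _
  filter_upwards [hac.ae_le h, ae_le_compProd P] with p hp hle
  rw [llr, hp]
  simp only [Function.uncurry, expDensity, hle, if_true]
  rw [ENNReal.toReal_ofReal (by positivity), Real.log_mul (by positivity) (Real.exp_pos _).ne',
    Real.log_exp]
  field_simp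
  ring

theorem integrable_id_of_lintegral_le {β : ℝ} {P : Measure ℝ≥0}
    (hP : ∫⁻ x, expCost x ∂P ≤ ENNReal.ofReal β) : Integrable (fun x : ℝ≥0 => (x : ℝ)) P := by
  refine ⟨Measurable.aestronglyMeasurable (by fun_prop), ?_⟩
  refine lt_of_le_of_lt (le_of_eq_of_le (lintegral_congr fun x => ?_) hP) ENNReal.ofReal_lt_top
  rw [expCost]
  simp [enorm]

theorem integral_id_le_of_lintegral_le {β : ℝ} (hβ : 0 < β) {P : Measure ℝ≥0}
    (hP : ∫⁻ x, expCost x ∂P ≤ ENNReal.ofReal β) : ∫ x : ℝ≥0, (x : ℝ) ∂P ≤ β := by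
  rw [integral_eq_lintegral_of_nonneg_ae (ae_of_all _ fun x => x.2)
    (Measurable.aestronglyMeasurable (by fun_prop))]
  refine ENNReal.toReal_le_of_le_ofReal hβ.le (le_of_eq_of_le (lintegral_congr fun x => ?_) hP)
  rw [expCost]
  exact ENNReal.ofReal_coe_nnreal

/-- The log-likelihood ratio is affine in the input and the noise, and the noise has mean one; only
the mean of the input remains. -/
theorem klDiv_compProd_exp {β : ℝ} (hβ : 0 < β) (P : Measure ℝ≥0) [IsProbabilityMeasure P]
    (hP : Integrable (fun x : ℝ≥0 => (x : ℝ)) P) :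
    klDiv (P ⊗ₘ expChannel) (P.prod (expMeasure (1 / (1 + β)))) =
      ENNReal.ofReal (Real.log (1 + β) + (∫ x : ℝ≥0, (x : ℝ) ∂P - β) / (1 + β)) := by
  have := isProbabilityMeasure_exp hβ
  have hac : P ⊗ₘ expChannel ≪ P.prod (expMeasure (1 / (1 + β))) := by
    rw [compProd_eq_withDensity hβ]; exact withDensity_absolutelyContinuous _ _
  have hm : Measurable fun p : ℝ≥0 × ℝ => p.2 - (p.1 : ℝ) := by fun_prop
  have hN1 := integral_pow_expMeasure one_pos 1
  have hNi := integrable_pow_expMeasure one_pos 1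
  simp only [pow_one] at hN1 hNi
  have hi1 : Integrable (fun p : ℝ≥0 × ℝ => (p.1 : ℝ)) (P ⊗ₘ expChannel) := by
    have h := hP
    rw [← Measure.fst_compProd P expChannel] at h
    exact h.comp_measurable measurable_fst
  have hi2 : Integrable (fun p : ℝ≥0 × ℝ => p.2 - (p.1 : ℝ)) (P ⊗ₘ expChannel) := by
    rw [← map_sub_compProd P] at hNi
    exact hNi.comp_measurable hm
  have he1 : ∫ p : ℝ≥0 × ℝ, (p.1 : ℝ) ∂(P ⊗ₘ expChannel) = ∫ x : ℝ≥0, (x : ℝ) ∂P := by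
    conv_rhs => rw [← Measure.fst_compProd P expChannel]
    rw [Measure.fst, integral_map measurable_fst.aemeasurable
      (Measurable.aestronglyMeasurable (by fun_prop))]
  have he2 : ∫ p : ℝ≥0 × ℝ, (p.2 - (p.1 : ℝ)) ∂(P ⊗ₘ expChannel) = 1 := by
    have h := integral_map (μ := P ⊗ₘ expChannel) hm.aemeasurable (f := fun z : ℝ => z)
      (Measurable.aestronglyMeasurable (by fun_prop))
    rw [map_sub_compProd, hN1] at h
    simpa using h.symm
  have hi3 : Integrable (fun p : ℝ≥0 × ℝ => Real.log (1 + β) + (p.1 : ℝ) / (1 + β))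
      (P ⊗ₘ expChannel) := (integrable_const _).add (hi1.div_const _)
  have hint := hi3.sub (hi2.const_mul (β / (1 + β)))
  rw [klDiv_of_ac_of_integrable hac (hint.congr (llr_compProd_ae_eq hβ P).symm),
    integral_congr_ae (llr_compProd_ae_eq hβ P), integral_sub hi3 (hi2.const_mul _),
    integral_add (integrable_const _) (hi1.div_const _), integral_div, integral_const_mul, he1, he2]
  congr 1
  simp only [integral_const, probReal_univ, one_smul]
  field_simp
  ring

/-- The truncated transform at t = 0 shows that the averaged density is identically 1 on y ≥ 0. -/
theorem comp_expInput {β : ℝ} (hβ : 0 < β) :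
    expChannel ∘ₘ expInput β = expMeasure (1 / (1 + β)) := by
  have := isProbabilityMeasure_exp hβ
  have := isProbabilityMeasure_expInput hβ
  have key : ∀ y : ℝ, 0 ≤ y → ∫⁻ x, expDensity β x y ∂(expInput β) = 1 := by
    intro y hy
    have hl : (0 : ℝ) < β / (1 + β) := by positivity
    have h := integral_expInput_truncated hβ hy 0
    simp only [Complex.ofReal_zero, zero_mul, add_zero, zero_add, one_mul] at h
    have h2 : ((∫ x : ℝ≥0, (if (x : ℝ) ≤ y then Real.exp x else 0) ∂(expInput β) : ℝ) : ℂ) =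
        ((1 / (1 + β) * Real.exp (β / (1 + β) * y) : ℝ) : ℂ) := by
      rw [← integral_complex_ofReal]
      refine Eq.trans (integral_congr_ae (ae_of_all _ fun x => ?_)) (h.trans ?_)
      · simp only
        split_ifs <;> simp
      · have hl' : ((β / (1 + β) : ℝ) : ℂ) ≠ 0 := by exact_mod_cast hl.ne'
        rw [mul_div_cancel_left₀ _ hl']
        push_cast
        rfl
    have h3 := Complex.ofReal_injective h2
    have hfm : Measurable fun x : ℝ≥0 => if (x : ℝ) ≤ y then Real.exp x else 0 :=
      Measurable.ite (measurableSet_le (by fun_prop) measurable_const) (by fun_prop)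
        measurable_const
    have e : ∀ x : ℝ≥0, expDensity β x y =
        ENNReal.ofReal ((1 + β) * Real.exp (-(β / (1 + β) * y))) *
          ENNReal.ofReal (if (x : ℝ) ≤ y then Real.exp x else 0) := by
      intro x
      unfold expDensity
      split_ifs
      · rw [← ENNReal.ofReal_mul (by positivity), mul_assoc, ← Real.exp_add]
        ring_nf
      · simp
    simp_rw [e]
    rw [lintegral_const_mul _ hfm.ennreal_ofReal, ← ofReal_integral_eq_lintegral_ofReal, h3,
      ← ENNReal.ofReal_mul (by positivity), ← ENNReal.ofReal_one]
    · congr 1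
      field_simp
      rw [← Real.exp_add, neg_add_cancel, Real.exp_zero]
    · refine Integrable.mono' (integrable_const (Real.exp y)) hfm.aestronglyMeasurable
        (ae_of_all _ fun x => ?_)
      split_ifs with hx
      · rwa [Real.norm_eq_abs, Real.abs_exp, Real.exp_le_exp]
      · simpa using (Real.exp_pos _).le
    · exact ae_of_all _ fun x => by simp only [Pi.zero_apply]; split_ifs <;> positivity
  ext U hU
  rw [Measure.bind_apply hU (Kernel.aemeasurable _)]
  calc ∫⁻ x, expChannel x U ∂(expInput β)
      = ∫⁻ x, ∫⁻ y in U, expDensity β x y ∂(expMeasure (1 / (1 + β))) ∂(expInput β) := by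
        refine lintegral_congr fun x => ?_
        rw [expChannel_eq_withDensity hβ, withDensity_apply _ hU]
    _ = ∫⁻ y in U, ∫⁻ x, expDensity β x y ∂(expInput β) ∂(expMeasure (1 / (1 + β))) :=
        lintegral_lintegral_swap (measurable_expDensity β).aemeasurable
    _ = ∫⁻ y in U, 1 ∂(expMeasure (1 / (1 + β))) := by
        refine lintegral_congr_ae (ae_restrict_of_ae ?_)
        filter_upwards [ae_nonneg_expMeasure _] with y hy using key y hy
    _ = _ := by simp

theorem isFeasibleInput_expInput {β : ℝ} (hβ : 0 < β) :
    IsFeasibleInput expCost β (expInput β) := by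
  refine ⟨isProbabilityMeasure_expInput hβ, le_of_eq ?_⟩
  rw [← integral_expInput_id hβ, ofReal_integral_eq_lintegral_ofReal (integrable_expInput_id hβ)
    (ae_of_all _ fun x => x.2), integral_expInput_id hβ]
  exact lintegral_congr fun x => ENNReal.ofReal_coe_nnreal.symm

theorem mutualInfo_add {a β : ℝ} (ha : 1 < a) (hβ : 0 < β) {P : Measure ℝ≥0}
    (hP : IsFeasibleInput expCost β P) :
    mutualInfo a expChannel P +
        klDiv (expChannel ∘ₘ P) (expMeasure (1 / (1 + β))) / ENNReal.ofReal (Real.log a) =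
      ENNReal.ofReal ((Real.log (1 + β) + (∫ x : ℝ≥0, (x : ℝ) ∂P - β) / (1 + β)) / Real.log a) := by
  have := isProbabilityMeasure_exp hβ
  have := hP.1
  rw [mutualInfo, ← ENNReal.add_div, ← klDiv_compProd_prod_eq,
    klDiv_compProd_exp hβ P (integrable_id_of_lintegral_le hP.2),
    ENNReal.ofReal_div_of_pos (Real.log_pos ha)]

theorem mutualInfo_add_le {a β : ℝ} (ha : 1 < a) (hβ : 0 < β) {P : Measure ℝ≥0}
    (hP : IsFeasibleInput expCost β P) :
    mutualInfo a expChannel P +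
        klDiv (expChannel ∘ₘ P) (expMeasure (1 / (1 + β))) / ENNReal.ofReal (Real.log a) ≤
      ENNReal.ofReal (Real.logb a (1 + β)) := by
  rw [mutualInfo_add ha hβ hP, Real.logb]
  refine ENNReal.ofReal_le_ofReal (div_le_div_of_nonneg_right ?_ (Real.log_pos ha).le)
  have h := integral_id_le_of_lintegral_le hβ hP.2
  have : (∫ x : ℝ≥0, (x : ℝ) ∂P - β) / (1 + β) ≤ 0 :=
    div_nonpos_of_nonpos_of_nonneg (by linarith) (by positivity)
  linarith

theorem mutualInfo_expInput {a β : ℝ} (ha : 1 < a) (hβ : 0 < β) :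
    mutualInfo a expChannel (expInput β) = ENNReal.ofReal (Real.logb a (1 + β)) := by
  have := isProbabilityMeasure_exp hβ
  have h := mutualInfo_add ha hβ (isFeasibleInput_expInput hβ)
  rwa [comp_expInput hβ, klDiv_self, ENNReal.zero_div, add_zero, integral_expInput_id hβ, sub_self,
    zero_div, add_zero, ← Real.logb] at h

theorem capacityCost_exp {a β : ℝ} (ha : 1 < a) (hβ : 0 < β) :
    capacityCost a expChannel expCost β = ENNReal.ofReal (Real.logb a (1 + β)) := by
  refine le_antisymm (iSup₂_le fun P hP => le_self_add.trans (mutualInfo_add_le ha hβ hP)) ?_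
  rw [← mutualInfo_expInput ha hβ]
  exact le_iSup₂ (f := fun P (_ : IsFeasibleInput expCost β P) => mutualInfo a expChannel P)
    (expInput β) (isFeasibleInput_expInput hβ)

theorem isOptimalInput_expInput {a β : ℝ} (ha : 1 < a) (hβ : 0 < β) :
    IsOptimalInput a expChannel expCost β (expInput β) :=
  ⟨isFeasibleInput_expInput hβ, by rw [mutualInfo_expInput ha hβ, capacityCost_exp ha hβ]⟩

/-- An optimal input leaves no room for the divergence term in the compensation identity, and zero
divergence means equality of the laws. -/
theorem isOptimalOutput_iff {a β : ℝ} (ha : 1 < a) (hβ : 0 < β) (Q : Measure ℝ) :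
    IsOptimalOutput a expChannel expCost β Q ↔ Q = expMeasure (1 / (1 + β)) := by
  have := isProbabilityMeasure_exp hβ
  constructor
  · rintro ⟨P, ⟨hP, hopt⟩, rfl⟩
    have := hP.1
    have h := mutualInfo_add_le ha hβ hP
    rw [hopt, capacityCost_exp ha hβ] at h
    have h0 : klDiv (expChannel ∘ₘ P) (expMeasure (1 / (1 + β))) /
        ENNReal.ofReal (Real.log a) = 0 := by
      have h1 : ENNReal.ofReal (Real.logb a (1 + β)) +
          klDiv (expChannel ∘ₘ P) (expMeasure (1 / (1 + β))) / ENNReal.ofReal (Real.log a) ≤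
          ENNReal.ofReal (Real.logb a (1 + β)) + 0 := by rwa [add_zero]
      exact le_antisymm ((ENNReal.add_le_add_iff_left ENNReal.ofReal_ne_top).1 h1) zero_le
    rw [ENNReal.div_eq_zero_iff, or_iff_left ENNReal.ofReal_ne_top] at h0
    exact klDiv_eq_zero_iff.1 h0
  · rintro rfl
    exact ⟨expInput β, isOptimalInput_expInput ha hβ, (comp_expInput hβ).symm⟩

theorem capacityReal_exp {a β : ℝ} (ha : 1 < a) (hβ : 0 < β) :
    capacityReal a expChannel expCost β = Real.logb a (1 + β) := by
  rw [capacityReal, capacityCost_exp ha hβ, ENNReal.toReal_ofReal]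
  exact Real.logb_nonneg ha (by linarith)

theorem hasDerivAt_capacityReal {a β : ℝ} (ha : 1 < a) (hβ : 0 < β) :
    HasDerivAt (capacityReal a expChannel expCost) (1 / (1 + β) / Real.log a) β := by
  have h : HasDerivAt (fun b : ℝ => Real.log (1 + b) / Real.log a) (1 / (1 + β) / Real.log a) β :=
    (((hasDerivAt_id β).const_add 1).log (by simp only [id]; positivity)).div_const _
  refine h.congr_of_eventuallyEq ?_
  filter_upwards [lt_mem_nhds hβ] with b hb using capacityReal_exp ha hb

end Capacity

/-! ### The second-order asymptotics and the dispersion. -/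

section Dispersion

theorem codeExists_maxCodeSize {β ε : ℝ} (hβ : 0 < β) {n : ℕ} (hn : 1 ≤ n) (hε : 0 < ε)
    (hε1 : ε < 1) :
    CodeExists expChannel expCost n (maxCodeSize expChannel expCost n ε β) ε β :=
  Nat.sSup_mem (s := {M : ℕ | CodeExists expChannel expCost n M ε β})
    ⟨1, codeExists_one hβ hn⟩ (bddAbove_codeExists hβ hn hε.le hε1)

theorem le_maxCodeSize {β ε : ℝ} (hβ : 0 < β) {n : ℕ} (hn : 1 ≤ n) (hε : 0 < ε)
    (hε1 : ε < 1) {M : ℕ} (h : CodeExists expChannel expCost n M ε β) :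
    M ≤ maxCodeSize expChannel expCost n ε β :=
  le_csSup (bddAbove_codeExists hβ hn hε.le hε1) h

/-- The gap between `n C(β)` and the logarithm of the maximum code size, in nats. -/
def capacityGap (β ε : ℝ) (n : ℕ) : ℝ :=
  n * Real.log (1 + β) - Real.log (maxCodeSize expChannel expCost n ε β)

theorem log_ratioThreshold {β : ℝ} (hβ : 0 < β) (n : ℕ) (t : ℝ) :
    Real.log (ratioThreshold β n (n + t * √n)) =
      n * Real.log (1 + β) - β / (1 + β) * t * √n := by
  rw [ratioThreshold, Real.log_mul (by positivity) (Real.exp_pos _).ne', Real.log_pow,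
    Real.log_exp]
  ring

/-- A code whose error probability leaves room above the Gaussian tail at `t` loses at least
`t √n` in the exponent, up to a constant. -/
theorem exists_le_capacityGap {β ε t : ℝ} (hβ : 0 < β) (hε : 0 < ε) (hε1 : ε < 1)
    (ht : normalCdf t < 1 - ε) :
    ∃ B : ℝ, ∀ᶠ n : ℕ in atTop, β / (1 + β) * t * √n + B ≤ capacityGap β ε n := by
  -- Half of the margin absorbs the convergence in the central limit theorem; the other half remains
  -- in the converse bound.
  set δ := (1 - ε - normalCdf t) / 2 with hδ
  have hδ0 : 0 < δ := by rw [hδ]; linarith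
  refine ⟨Real.log δ, ?_⟩
  filter_upwards [(tendsto_noiseCdf t).eventually_lt_const
    (show normalCdf t < normalCdf t + δ by linarith), eventually_ge_atTop 1] with n hn hn1
  have h := (codeExists_maxCodeSize hβ hn1 hε hε1).mul_le hβ hn1 hε.le (n + t * √n)
  have hM : (1 : ℝ) ≤ maxCodeSize expChannel expCost n ε β := by
    exact_mod_cast le_maxCodeSize hβ hn1 hε hε1 (codeExists_one hβ hn1)
  have h2 : (maxCodeSize expChannel expCost n ε β : ℝ) * δ ≤ ratioThreshold β n (n + t * √n) :=
    (mul_le_mul_of_nonneg_left (by linarith) (by linarith)).trans h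
  have h3 := Real.log_le_log (by positivity) h2
  rw [log_ratioThreshold hβ, Real.log_mul (by positivity) hδ0.ne'] at h3
  rw [capacityGap]
  linarith

theorem tendsto_mul_sub_mul_sqrt {a : ℝ} (ha : 0 < a) (b : ℝ) :
    Tendsto (fun n : ℕ => n * a - b * √n) atTop atTop := by
  have hs : Tendsto (fun n : ℕ => √(n : ℝ)) atTop atTop :=
    Real.tendsto_sqrt_atTop.comp tendsto_natCast_atTop_atTop
  have h : Tendsto (fun n : ℕ => √(n : ℝ) * (√n * a - b)) atTop atTop :=
    hs.atTop_mul_atTop₀ (tendsto_atTop_add_const_right _ (-b) (hs.atTop_mul_const ha))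
  refine h.congr fun n => ?_
  have := Real.mul_self_sqrt (Nat.cast_nonneg (α := ℝ) n)
  linear_combination a * this

/-- Some code achieves a loss of at most `t √n` in the exponent, up to a constant, if its error
probability is allowed to exceed the Gaussian tail at `t`. -/
theorem exists_capacityGap_le {β ε t : ℝ} (hβ : 0 < β) (hε : 0 < ε) (hε1 : ε < 1)
    (ht : 1 - ε < normalCdf t) :
    ∃ B : ℝ, ∀ᶠ n : ℕ in atTop, capacityGap β ε n ≤ β / (1 + β) * t * √n + B := by
  obtain ⟨K, hK, hdom⟩ := exists_input_dominated hβ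
  -- Half of the margin again: for large n the noise stays below the level with probability at least
  -- 1 − ε + η, the slack that greedy selection consumes.
  set η := (normalCdf t - 1 + ε) / 2 with hη
  have hη0 : 0 < η := by rw [hη]; linarith
  refine ⟨-Real.log (η / (4 * K)), ?_⟩
  -- The threshold tends to infinity, so at least one codeword can be chosen and rounding down costs
  -- at most a factor 2.
  have hlim := tendsto_mul_sub_mul_sqrt (Real.log_pos (show (1 : ℝ) < 1 + β by linarith))
    (β / (1 + β) * t)
  filter_upwards [(tendsto_noiseCdf t).eventually_const_lt
    (show normalCdf t - η < normalCdf t by linarith), eventually_ge_atTop 1, hdom,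
    hlim.eventually_ge_atTop (Real.log (2 * K / η))] with n hn hn1 ⟨P, hP, hsupp, hdomn⟩ hbig
  have hγ := ratioThreshold_pos hβ n (n + t * √n)
  set γ := ratioThreshold β n (n + t * √n) with hγdef
  have hγ1 : 2 * K / η ≤ γ := by
    rw [← log_ratioThreshold hβ, ← hγdef] at hbig
    exact (Real.log_le_log_iff (by positivity) hγ).1 hbig
  have hx1 : 1 ≤ γ * η / (2 * K) := by
    rw [le_div_iff₀ (by positivity)]
    rw [div_le_iff₀ hη0] at hγ1
    linarith
  -- The 2 in the denominator makes the inequality required for greedy selection strict.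
  set k := ⌊γ * η / (2 * K)⌋₊ with hk
  have hk1 : 1 ≤ k := by rwa [hk, Nat.one_le_floor_iff]
  have hkle : (k : ℝ) ≤ γ * η / (2 * K) := Nat.floor_le (by positivity)
  have hlt : γ * η / (2 * K) < k + 1 := Nat.lt_floor_add_one _
  have hkK : (k : ℝ) * K < η * γ := by
    rw [le_div_iff₀ (by positivity)] at hkle
    nlinarith [mul_pos hη0 hγ]
  have hcode := codeExists_of_dominated hβ hn1 P hsupp hK hdomn hη0
    (show 1 - ε + η ≤ noiseCdf n (n + t * √n) by rw [hη] at hn ⊢; linarith) hk1 hkK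
  have hkM : (k : ℝ) ≤ maxCodeSize expChannel expCost n ε β := by
    exact_mod_cast le_maxCodeSize hβ hn1 hε hε1 hcode
  have hk1' : (1 : ℝ) ≤ k := by exact_mod_cast hk1
  have hfin : γ * (η / (4 * K)) ≤ maxCodeSize expChannel expCost n ε β := by
    have : γ * (η / (4 * K)) = γ * η / (2 * K) / 2 := by field_simp; ring
    rw [this]
    linarith
  have h3 := Real.log_le_log (by positivity) hfin
  rw [Real.log_mul hγ.ne' (by positivity), hγdef, log_ratioThreshold hβ] at h3
  rw [capacityGap]
  linarith

theorem tendsto_sq_affine_sqrt_div (A B : ℝ) :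
    Tendsto (fun n : ℕ => 1 / (n : ℝ) * (A * √n + B) ^ 2) atTop (𝓝 (A ^ 2)) := by
  have hs : Tendsto (fun n : ℕ => (√(n : ℝ))⁻¹) atTop (𝓝 0) :=
    tendsto_inv_atTop_zero.comp (Real.tendsto_sqrt_atTop.comp tendsto_natCast_atTop_atTop)
  have h : Tendsto (fun n : ℕ => (A + B * (√(n : ℝ))⁻¹) ^ 2) atTop (𝓝 ((A + B * 0) ^ 2)) :=
    ((hs.const_mul B).const_add A).pow 2
  rw [mul_zero, add_zero] at h
  refine h.congr' ?_
  filter_upwards [eventually_gt_atTop 0] with n hn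
  have hn' : (0 : ℝ) < n := by exact_mod_cast hn
  have hsq := Real.sq_sqrt hn'.le
  have hs0 : √(n : ℝ) ≠ 0 := (Real.sqrt_pos.2 hn').ne'
  rw [← hsq, Real.sqrt_sq (Real.sqrt_nonneg _)]
  field_simp

/-- If a sequence grows like a multiple of `√n` with the coefficient between `A` and `A'`, then
the upper limit of its normalised squares is between `A²` and `A'²`. -/
theorem limsup_sq_div_mem_Icc {A A' B B' L : ℝ} (hA : 0 < A) (hL : 0 < L) {D : ℕ → ℝ}
    (h : ∀ᶠ n : ℕ in atTop, A * √n + B ≤ D n) (h' : ∀ᶠ n : ℕ in atTop, D n ≤ A' * √n + B') :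
    limsup (fun n : ℕ => ((1 / (n : ℝ) * (D n ^ 2 / L) : ℝ) : EReal)) atTop ∈
      Icc ((A ^ 2 / L : ℝ) : EReal) ((A' ^ 2 / L : ℝ) : EReal) := by
  have hlim : ∀ A B : ℝ, Tendsto
      (fun n : ℕ => ((1 / (n : ℝ) * ((A * √n + B) ^ 2 / L) : ℝ) : EReal)) atTop
      (𝓝 ((A ^ 2 / L : ℝ) : EReal)) := fun A B => by
    refine (continuous_coe_real_ereal.tendsto _).comp ?_
    refine ((tendsto_sq_affine_sqrt_div A B).div_const L).congr fun n => ?_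
    ring
  -- Squaring preserves order only for nonnegative values; A > 0 makes the lower bound eventually
  -- nonnegative.
  have hs : Tendsto (fun n : ℕ => A * √(n : ℝ) + B) atTop atTop :=
    tendsto_atTop_add_const_right _ _
      ((Real.tendsto_sqrt_atTop.comp tendsto_natCast_atTop_atTop).const_mul_atTop hA)
  have hmono : ∀ {u v : ℝ} (n : ℕ), 0 ≤ u → u ≤ v →
      ((1 / (n : ℝ) * (u ^ 2 / L) : ℝ) : EReal) ≤ ((1 / (n : ℝ) * (v ^ 2 / L) : ℝ) : EReal) :=
    fun n hu huv => EReal.coe_le_coe_iff.2 (by gcongr)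
  constructor
  · rw [← (hlim A B).limsup_eq]
    refine limsup_le_limsup ?_
    filter_upwards [h, hs.eventually_ge_atTop 0] with n hn hn0 using hmono n hn0 hn
  · rw [← (hlim A' B').limsup_eq]
    refine limsup_le_limsup ?_
    filter_upwards [h, h', hs.eventually_ge_atTop 0] with n hn hn' hn0 using
      hmono n (hn0.trans hn) hn'

/-- With r = √(2 ln(1/ε)) this places the normal quantile of 1 − ε above r − 2. The gain exp(r −
1/2) beats the factor 1/3 of the tail bound. -/
theorem normalCdf_lt_of_sqrt_log {r : ℝ} (hr : 3 ≤ r) :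
    normalCdf (r - 2) < 1 - Real.exp (-(r ^ 2 / 2)) := by
  have h := normalCdf_le (show 0 ≤ r - 2 by linarith)
  have e : Real.exp (-((r - 2 + 1) ^ 2 / 2)) =
      Real.exp (-(r ^ 2 / 2)) * Real.exp (r - 1 / 2) := by
    rw [← Real.exp_add]; ring_nf
  have h3 : (3 : ℝ) < Real.exp (r - 1 / 2) := by
    have := Real.add_one_lt_exp (show r - 1 / 2 ≠ 0 by linarith)
    linarith
  rw [e] at h
  nlinarith [Real.exp_pos (-(r ^ 2 / 2))]

theorem lt_normalCdf_of_sqrt_log {r : ℝ} (hr : 0 ≤ r) :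
    1 - Real.exp (-(r ^ 2 / 2)) < normalCdf (r + 1) := by
  have h := one_sub_exp_le_normalCdf (show 0 ≤ r + 1 by linarith)
  have : Real.exp (-((r + 1) ^ 2 / 2)) < Real.exp (-(r ^ 2 / 2)) :=
    Real.exp_lt_exp.2 (by nlinarith)
  linarith

/-- For fixed ε the upper limit lies between c²(r − 2)²/r² and c²(r + 1)²/r², with r = √(2 ln(1/ε))
and c = β/(1+β)/ln a; both tend to c² as r tends to infinity. -/
theorem isDispersion_exp {a β : ℝ} (ha : 1 < a) (hβ : 0 < β) :
    IsDispersion a expChannel expCost β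
      (β ^ 2 / (1 + β) ^ 2 * Real.logb a (Real.exp 1) ^ 2) := by
  have hla := Real.log_pos ha
  set c := β / (1 + β) / Real.log a with hc
  have hc0 : 0 < c := by positivity
  have hcV : β ^ 2 / (1 + β) ^ 2 * Real.logb a (Real.exp 1) ^ 2 = c ^ 2 := by
    rw [Real.logb, Real.log_exp, hc]
    field_simp
  rw [hcV]
  have hr : Tendsto (fun ε : ℝ => √(2 * Real.log (1 / ε))) (𝓝[>] 0) atTop := by
    refine Real.tendsto_sqrt_atTop.comp (Tendsto.const_mul_atTop two_pos ?_)
    simp only [one_div]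
    exact Real.tendsto_log_atTop.comp tendsto_inv_nhdsGT_zero
  have hlim : ∀ d : ℝ, Tendsto (fun ε : ℝ =>
      (((c * (√(2 * Real.log (1 / ε)) + d)) ^ 2 / (2 * Real.log (1 / ε)) : ℝ) : EReal))
      (𝓝[>] 0) (𝓝 ((c ^ 2 : ℝ) : EReal)) := by
    intro d
    refine (continuous_coe_real_ereal.tendsto _).comp ?_
    have h : Tendsto (fun ε : ℝ => (c * (1 + d * (√(2 * Real.log (1 / ε)))⁻¹)) ^ 2) (𝓝[>] 0)
        (𝓝 ((c * (1 + d * 0)) ^ 2)) :=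
      ((((tendsto_inv_atTop_zero.comp hr).const_mul d).const_add 1).const_mul c).pow 2
    rw [mul_zero, add_zero, mul_one] at h
    refine h.congr' ?_
    filter_upwards [hr.eventually_gt_atTop 0] with ε hε
    have hpos := Real.sqrt_pos.1 hε
    nth_rewrite 3 [← Real.sq_sqrt hpos.le]
    field_simp
  refine tendsto_of_tendsto_of_tendsto_of_le_of_le' (hlim (-2)) (hlim 1) ?_ ?_ <;>
  · filter_upwards [hr.eventually_ge_atTop 3, self_mem_nhdsWithin,
      mem_nhdsWithin_of_mem_nhds (gt_mem_nhds one_pos)] with ε hrε hε hε1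
    have hε : 0 < ε := hε
    have hε1 : ε < 1 := hε1
    have hL : 0 < 2 * Real.log (1 / ε) := Real.sqrt_pos.1 (by linarith)
    set r := √(2 * Real.log (1 / ε)) with hrdef
    have hεr : ε = Real.exp (-(r ^ 2 / 2)) := by
      rw [hrdef, Real.sq_sqrt hL.le, one_div, Real.log_inv]
      ring_nf
      rw [Real.exp_log hε]
    have h1 := normalCdf_lt_of_sqrt_log hrε
    have h2 := lt_normalCdf_of_sqrt_log (show 0 ≤ r by linarith)
    rw [← hεr] at h1 h2
    obtain ⟨B, hB⟩ := exists_le_capacityGap hβ hε hε1 h1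
    obtain ⟨B', hB'⟩ := exists_capacityGap_le hβ hε hε1 h2
    have key := limsup_sq_div_mem_Icc (A := c * (r - 2)) (B := B / Real.log a)
      (A' := c * (r + 1)) (B' := B' / Real.log a)
      (D := fun n => n * capacityReal a expChannel expCost β -
        Real.logb a (maxCodeSize expChannel expCost n ε β))
      (mul_pos hc0 (by linarith)) hL ?_ ?_
    · first | exact key.1 | exact key.2
    all_goals
      have hD : ∀ n : ℕ, n * capacityReal a expChannel expCost β -
          Real.logb a (maxCodeSize expChannel expCost n ε β) = capacityGap β ε n / Real.log a := by
        intro n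
        rw [capacityReal_exp ha hβ, capacityGap, Real.logb, Real.logb]
        ring
    · filter_upwards [hB] with n hn
      rw [hD, le_div_iff₀ hla, hc]
      refine le_of_eq_of_le ?_ hn
      field_simp
    · filter_upwards [hB'] with n hn
      rw [hD, div_le_iff₀ hla, hc]
      refine hn.trans_eq ?_
      field_simp

end Dispersion

/-! ### The tilted density and the regularity conditions. -/

section Regularity

/-- Applied with T the noise y − x, which has the same law for a fixed input and for any random
input; hence one computation serves the conditional and the unconditional variance. -/
theorem mean_variance_of_law {Ω : Type*} [MeasurableSpace Ω] {μ : Measure Ω} {T : Ω → ℝ}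
    (hT : Measurable T) (hlaw : μ.map T = expMeasure 1) {f : Ω → ℝ} {A c : ℝ}
    (hf : f =ᵐ[μ] fun ω => A + c * (1 - T ω)) :
    ∫ ω, f ω ∂μ = A ∧ variance f μ = c ^ 2 := by
  have hg : Measurable fun z : ℝ => A + c * (1 - z) := by fun_prop
  have hi : Integrable (fun z : ℝ => z - 1) (expMeasure 1) := by
    have := integrable_pow_expMeasure one_pos 1
    simp only [pow_one] at this
    exact this.sub (integrable_const _)
  have e : ∀ z : ℝ, A + c * (1 - z) = A - c * (z - 1) := fun z => by ring
  have hmean : ∫ z, (A + c * (1 - z)) ∂(expMeasure 1) = A := by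
    simp_rw [e]
    rw [integral_sub (integrable_const _) (hi.const_mul _), integral_const_mul,
      integral_expMeasure_sub_one]
    simp
  constructor
  · have h := integral_map (μ := μ) hT.aemeasurable hg.aestronglyMeasurable
    rw [hlaw, hmean] at h
    rw [integral_congr_ae hf, ← h]
  · rw [variance_congr hf]
    have h := variance_map (μ := μ) (X := fun z : ℝ => A + c * (1 - z)) (Y := T)
      hg.aemeasurable hT.aemeasurable
    rw [hlaw] at h
    refine Eq.trans h.symm ?_
    rw [variance_eq_integral hg.aemeasurable, hmean]
    have e2 : ∀ z : ℝ, (A + c * (1 - z) - A) ^ 2 = c ^ 2 * (z - 1) ^ 2 := fun z => by ring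
    simp_rw [e2]
    rw [integral_const_mul, integral_expMeasure_sub_one_sq, mul_one]

theorem integrable_abs_one_sub_pow (c : ℝ) :
    Integrable (fun z => |c * (1 - z)| ^ 3) (expMeasure 1) := by
  refine Integrable.mono' (((integrable_const (1 : ℝ)).add
    (integrable_pow_expMeasure one_pos 3)).const_mul (|c| ^ 3))
    (Measurable.aestronglyMeasurable (by fun_prop)) ?_
  filter_upwards [ae_nonneg_expMeasure 1] with z hz
  rw [Real.norm_of_nonneg (by positivity), abs_mul, mul_pow]
  refine mul_le_mul_of_nonneg_left ?_ (by positivity)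
  simp only [Pi.add_apply]
  rcases le_total z 1 with h | h
  · have h0 : |1 - z| ≤ 1 := by rw [abs_of_nonneg (by linarith)]; linarith
    have := pow_le_one₀ (n := 3) (abs_nonneg (1 - z)) h0
    have : 0 ≤ z ^ 3 := by positivity
    linarith
  · have h0 : |1 - z| ≤ z := by rw [abs_of_nonpos (by linarith)]; linarith
    have := pow_le_pow_left₀ (abs_nonneg (1 - z)) h0 3
    linarith

/-- Subtracting C′(β)(x − β) turns the coefficient 1 of x into β/(1+β), matching that of y, so only
the noise y − x is left. -/
theorem logb_expDensity_sub {a β : ℝ} (hβ : 0 < β) {x : ℝ≥0} {y : ℝ} (h : (x : ℝ) ≤ y) :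
    Real.logb a (expDensity β x y).toReal - 1 / (1 + β) / Real.log a * ((x : ℝ) - β) =
      Real.logb a (1 + β) + β / (1 + β) * ((x : ℝ) - y + 1) * Real.logb a (Real.exp 1) := by
  rw [expDensity, if_pos h, ENNReal.toReal_ofReal (by positivity), Real.logb, Real.logb, Real.logb,
    Real.log_mul (by positivity) (Real.exp_pos _).ne', Real.log_exp, Real.log_exp]
  have e : (x : ℝ) - β / (1 + β) * y - 1 / (1 + β) * (x - β) = β / (1 + β) * (x - y + 1) := by
    field_simp
    ring
  rw [mul_one_div, ← e]
  ring

theorem tiltedDensity_eq {a β : ℝ} (ha : 1 < a) (hβ : 0 < β) {x : ℝ≥0} {y : ℝ}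
    (h : (x : ℝ) ≤ y)
    (hy : outputDensity expChannel (expMeasure (1 / (1 + β))) x y = expDensity β x y) :
    tiltedDensity a expChannel expCost β (expMeasure (1 / (1 + β))) x y =
      Real.logb a (1 + β) + β / (1 + β) * ((x : ℝ) - y + 1) * Real.logb a (Real.exp 1) := by
  rw [tiltedDensity, hy, (hasDerivAt_capacityReal ha hβ).deriv, ← logb_expDensity_sub hβ h,
    expCost, ENNReal.coe_toReal]

theorem tiltedDensity_ae_eq {a β : ℝ} (ha : 1 < a) (hβ : 0 < β) (x : ℝ≥0) :
    tiltedDensity a expChannel expCost β (expMeasure (1 / (1 + β))) x =ᵐ[expChannel x] fun y =>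
      Real.logb a (1 + β) + β / (1 + β) * Real.logb a (Real.exp 1) * (1 - (y - (x : ℝ))) := by
  filter_upwards [ae_le_expChannel x,
    (expChannel_absolutelyContinuous hβ x).ae_le (outputDensity_ae_eq hβ x)] with y hle hy
  rw [tiltedDensity_eq ha hβ hle hy]
  ring

theorem measurable_tiltedDensity (a β : ℝ) (Q : Measure ℝ) :
    Measurable fun p : ℝ≥0 × ℝ => tiltedDensity a expChannel expCost β Q p.1 p.2 := by
  have h := measurable_outputDensity Q
  have hc : Measurable expCost := measurable_coe_nnreal_ennreal
  unfold tiltedDensity Real.logb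
  fun_prop

theorem tiltedDensity_compProd_ae_eq {a β : ℝ} (ha : 1 < a) (hβ : 0 < β) (P : Measure ℝ≥0)
    [IsProbabilityMeasure P] :
    (fun p : ℝ≥0 × ℝ =>
      tiltedDensity a expChannel expCost β (expMeasure (1 / (1 + β))) p.1 p.2) =ᵐ[P ⊗ₘ expChannel]
      fun p => Real.logb a (1 + β) +
        β / (1 + β) * Real.logb a (Real.exp 1) * (1 - (p.2 - (p.1 : ℝ))) :=
  Measure.ae_compProd_of_ae_ae
    (measurableSet_eq_fun (measurable_tiltedDensity a β _) (by fun_prop))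
    (ae_of_all _ fun x => tiltedDensity_ae_eq ha hβ x)

theorem lintegral_abs_tiltedDensity_sub_lt_top {a β : ℝ} (ha : 1 < a) (hβ : 0 < β) (x : ℝ≥0) :
    ∫⁻ y, ENNReal.ofReal (|tiltedDensity a expChannel expCost β (expMeasure (1 / (1 + β))) x y -
      capacityReal a expChannel expCost β| ^ 3) ∂(expChannel x) < ∞ := by
  have h : ∀ᵐ y ∂(expChannel x), ENNReal.ofReal
      (|tiltedDensity a expChannel expCost β (expMeasure (1 / (1 + β))) x y -
        capacityReal a expChannel expCost β| ^ 3) =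
      ENNReal.ofReal (|β / (1 + β) * Real.logb a (Real.exp 1) * (1 - (y - (x : ℝ)))| ^ 3) := by
    filter_upwards [tiltedDensity_ae_eq ha hβ x] with y hy
    rw [hy, capacityReal_exp ha hβ, add_sub_cancel_left]
  rw [lintegral_congr_ae h]
  have hm := lintegral_map (μ := expChannel x) (g := fun y : ℝ => y - (x : ℝ))
    (f := fun z => ENNReal.ofReal (|β / (1 + β) * Real.logb a (Real.exp 1) * (1 - z)| ^ 3))
    (by fun_prop) (by fun_prop)
  rw [← hm, map_sub_expChannel]
  exact (integrable_abs_one_sub_pow _).lintegral_lt_top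

theorem logRatio_blockChannel_ae_eq {a β : ℝ} (hβ : 0 < β) {n : ℕ} (hn : 1 ≤ n)
    {x : Fin n → ℝ≥0} (hx : x ∈ costSurface expCost β n) :
    logRatio a (blockChannel expChannel n x)
        (Measure.pi fun _ : Fin n => expMeasure (1 / (1 + β))) =ᵐ[blockChannel expChannel n x]
      fun y => Real.logb a ((1 + β) ^ n * Real.exp (n * β - β / (1 + β) * ∑ i, y i)) := by
  have := isProbabilityMeasure_exp hβ
  have hd := Measure.rnDeriv_withDensity (Measure.pi fun _ : Fin n => expMeasure (1 / (1 + β)))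
    (measurable_blockDensity_right β x)
  rw [← blockChannel_eq_withDensity hβ x] at hd
  have hac : blockChannel expChannel n x ≪
      Measure.pi fun _ : Fin n => expMeasure (1 / (1 + β)) := by
    rw [blockChannel_eq_withDensity hβ x]
    exact withDensity_absolutelyContinuous _ _
  filter_upwards [hac.ae_le hd, ae_le_blockChannel x] with y hy hle
  rw [logRatio, hy, blockDensity_of_le hβ hle, ENNReal.toReal_ofReal (by positivity),
    (mem_costSurface_iff hβ hn x).1 hx]

/-- The right-hand side does not involve the word; this is the symmetry condition on the cost
surface. -/
theorem map_logRatio_blockChannel {a β : ℝ} (hβ : 0 < β) {n : ℕ} (hn : 1 ≤ n)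
    {x : Fin n → ℝ≥0} (hx : x ∈ costSurface expCost β n) :
    (blockChannel expChannel n x).map (logRatio a (blockChannel expChannel n x)
        (Measure.pi fun _ : Fin n => expMeasure (1 / (1 + β)))) =
      (noiseLaw n).map fun z => Real.logb a
        ((1 + β) ^ n * Real.exp (n * β - β / (1 + β) * (n * β + ∑ i, z i))) := by
  rw [Measure.map_congr (logRatio_blockChannel_ae_eq hβ hn hx), blockChannel_eq_map,
    Measure.map_map (by unfold Real.logb; fun_prop) (by fun_prop)]
  congr 1
  ext z
  simp only [Function.comp_apply, Finset.sum_add_distrib, (mem_costSurface_iff hβ hn x).1 hx]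

/-- A measure dominated by a multiple of another one has a log-likelihood ratio bounded by the
logarithm of the factor. -/
theorem logRatio_le_of_le_smul {Ω : Type*} [MeasurableSpace Ω] {a K : ℝ} (ha : 1 < a)
    (hK : 0 < K) {μ ν : Measure Ω} [IsFiniteMeasure μ] [IsFiniteMeasure ν]
    (h : μ ≤ ENNReal.ofReal K • ν) :
    μ ≪ ν ∧ ∀ᵐ y ∂μ, logRatio a μ ν y ≤ Real.logb a K := by
  have hac : μ ≪ ν := (Measure.absolutelyContinuous_of_le h).trans
    Measure.smul_absolutelyContinuous
  have hle : μ.rnDeriv ν ≤ᵐ[ν] fun _ => ENNReal.ofReal K := by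
    refine ae_le_of_forall_setLIntegral_le_of_sigmaFinite (Measure.measurable_rnDeriv _ _)
      fun s _ _ => ?_
    rw [setLIntegral_const]
    exact (Measure.setLIntegral_rnDeriv_le s).trans (h s)
  refine ⟨hac, ?_⟩
  filter_upwards [hac.ae_le hle, Measure.rnDeriv_pos hac] with y hy hpos
  have hfin : μ.rnDeriv ν y ≠ ∞ := (hy.trans_lt ENNReal.ofReal_lt_top).ne
  exact Real.logb_le_logb_of_le ha (ENNReal.toReal_pos hpos.ne' hfin)
    (ENNReal.toReal_le_of_le_ofReal hK.le hy)

/-- Covers the finitely many short blocks: the point mass at the constant word β has a bounded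
output density, with a bound that may depend on n. -/
theorem exists_dominated_of_one_le {β : ℝ} (hβ : 0 < β) {n : ℕ} (hn : 1 ≤ n) :
    ∃ K : ℝ, 0 < K ∧ ∃ P : Measure (Fin n → ℝ≥0), IsProbabilityMeasure P ∧
      (∀ᵐ x ∂P, x ∈ costSurface expCost β n) ∧ blockChannel expChannel n ∘ₘ P ≤
        ENNReal.ofReal K • Measure.pi fun _ : Fin n => expMeasure (1 / (1 + β)) := by
  let x₀ : Fin n → ℝ≥0 := fun _ => β.toNNReal
  have hx₀ : ∑ i, (x₀ i : ℝ) = n * β := by simp [x₀, Real.coe_toNNReal _ hβ.le]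
  refine ⟨(1 + β) ^ n * Real.exp (n * β), by positivity, Measure.dirac x₀, inferInstance, ?_,
    comp_blockChannel_le hβ _ fun y hy => ?_⟩
  · rw [ae_dirac_eq]
    exact (mem_costSurface_iff hβ hn x₀).2 hx₀
  · rw [lintegral_dirac]
    by_cases h : ∀ i, (x₀ i : ℝ) ≤ y i
    · rw [blockDensity_of_le hβ h, hx₀]
      refine ENNReal.ofReal_le_ofReal (mul_le_mul_of_nonneg_left ?_ (by positivity))
      have : 0 ≤ β / (1 + β) * ∑ i, y i :=
        mul_nonneg (by positivity) (Finset.sum_nonneg fun i _ => hy i)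
      exact Real.exp_le_exp.2 (by linarith)
    · rw [blockDensity_of_not_le h]
      exact zero_le

theorem exists_ratioBound {a β : ℝ} (ha : 1 < a) (hβ : 0 < β) :
    ∃ f : ℕ → ℝ, f =O[atTop] (fun _ : ℕ => (1 : ℝ)) ∧ ∀ n : ℕ, 1 ≤ n →
      ∃ P : Measure (Fin n → ℝ≥0), IsProbabilityMeasure P ∧
        (∀ᵐ x ∂P, x ∈ costSurface expCost β n) ∧
        (blockChannel expChannel n ∘ₘ P) ≪
          Measure.pi (fun _ : Fin n => expMeasure (1 / (1 + β))) ∧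
        ∀ᵐ y ∂(blockChannel expChannel n ∘ₘ P),
          logRatio a (blockChannel expChannel n ∘ₘ P)
            (Measure.pi fun _ : Fin n => expMeasure (1 / (1 + β))) y ≤ f n := by
  have := isProbabilityMeasure_exp hβ
  obtain ⟨K, hK, hdom⟩ := exists_input_dominated hβ
  have hex : ∀ n : ℕ, ∃ K' : ℝ, 1 ≤ n → 0 < K' ∧ ∃ P : Measure (Fin n → ℝ≥0),
      IsProbabilityMeasure P ∧ (∀ᵐ x ∂P, x ∈ costSurface expCost β n) ∧
      blockChannel expChannel n ∘ₘ P ≤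
        ENNReal.ofReal K' • Measure.pi fun _ : Fin n => expMeasure (1 / (1 + β)) := by
    intro n
    by_cases hn : 1 ≤ n
    · obtain ⟨K', h⟩ := exists_dominated_of_one_le hβ hn
      exact ⟨K', fun _ => h⟩
    -- A default value for n = 0, where nothing is claimed.
    · exact ⟨0, fun h => absurd h hn⟩
  choose K' hK' using hex
  obtain ⟨N, hN⟩ := eventually_atTop.1 hdom
  -- Constant from N on, hence bounded; the earlier values do not affect the growth.
  refine ⟨fun n => Real.logb a (if N ≤ n then K else K' n), ?_, fun n hn => ?_⟩
  · refine (Asymptotics.isBigO_const_const (Real.logb a K) one_ne_zero atTop).congr' ?_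
      EventuallyEq.rfl
    filter_upwards [eventually_ge_atTop N] with n hn
    rw [if_pos hn]
  · have key : 0 < (if N ≤ n then K else K' n) ∧ ∃ P : Measure (Fin n → ℝ≥0),
        IsProbabilityMeasure P ∧ (∀ᵐ x ∂P, x ∈ costSurface expCost β n) ∧
        blockChannel expChannel n ∘ₘ P ≤ ENNReal.ofReal (if N ≤ n then K else K' n) •
          Measure.pi fun _ : Fin n => expMeasure (1 / (1 + β)) := by
      split_ifs with h
      · exact ⟨hK, hN n h⟩
      · exact hK' n hn
    obtain ⟨hpos, P, hP, hsupp, hle⟩ := key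
    exact ⟨P, hP, hsupp, logRatio_le_of_le_smul ha hpos hle⟩

theorem isLittleO_sqrt_of_isBigO_one {f : ℕ → ℝ} (hf : f =O[atTop] (fun _ : ℕ => (1 : ℝ))) :
    f =o[atTop] fun n : ℕ => √(n : ℝ) :=
  hf.trans_isLittleO ((Asymptotics.isLittleO_const_left).2 (Or.inr
    (tendsto_norm_atTop_atTop.comp
      (Real.tendsto_sqrt_atTop.comp tendsto_natCast_atTop_atTop))))

theorem exists_abstractAlphabetConditions {a β : ℝ} (ha : 1 < a) (hβ : 0 < β) :
    ∃ f : ℕ → ℝ, f =O[atTop] (fun _ : ℕ => (1 : ℝ)) ∧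
      AbstractAlphabetConditions a expChannel expCost β (expMeasure (1 / (1 + β))) f := by
  obtain ⟨f, hf, hbound⟩ := exists_ratioBound ha hβ
  refine ⟨f, hf, ⟨fun γ _ => ⟨γ.toNNReal, rfl⟩, fun n _ x _ => ?_, fun n hn x hx x' hx' => ?_,
    fun n x _ => lintegral_abs_tiltedDensity_sub_lt_top ha hβ (x 0), hbound,
    isLittleO_sqrt_of_isBigO_one hf⟩⟩
  · rw [blockChannel_eq_withDensity hβ x]
    exact withDensity_absolutelyContinuous _ _
  · rw [map_logRatio_blockChannel hβ hn hx, map_logRatio_blockChannel hβ hn hx']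

end Regularity

end CostChannel

end

/-! ### The main theorem. -/

theorem mainTheorem10 (a β : ℝ) (ha : 1 < a) (hβ : 0 < β) :
    -- the capacity-cost function
    CostChannel.capacityCost a CostChannel.expChannel CostChannel.expCost β =
      ENNReal.ofReal (Real.logb a (1 + β)) ∧
    DifferentiableAt ℝ
      (CostChannel.capacityReal a CostChannel.expChannel CostChannel.expCost) β ∧
    -- the dispersion-cost function
    (∀ (n : ℕ) (ε : ℝ), 1 ≤ n → 0 < ε → ε < 1 →
      {M : ℕ | CostChannel.CodeExists CostChannel.expChannel CostChannel.expCost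
        n M ε β}.Nonempty ∧
      BddAbove {M : ℕ | CostChannel.CodeExists CostChannel.expChannel CostChannel.expCost
        n M ε β}) ∧
    CostChannel.IsDispersion a CostChannel.expChannel CostChannel.expCost β
      (β ^ 2 / (1 + β) ^ 2 * Real.logb a (Real.exp 1) ^ 2) ∧
    -- the optimal output distribution exists, is unique, and is exponential with mean `1 + β`
    (∀ Q : Measure ℝ,
      CostChannel.IsOptimalOutput a CostChannel.expChannel CostChannel.expCost β Q ↔
        Q = expMeasure (1 / (1 + β))) ∧
    ∀ Q : Measure ℝ,
      CostChannel.IsOptimalOutput a CostChannel.expChannel CostChannel.expCost β Q →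
      -- the `b`-tilted information density; the density vanishes for `y < x`
      (∀ x : ℝ≥0, CostChannel.expChannel x ≪ Q ∧
        (∀ᵐ y ∂Q, (x : ℝ) ≤ y →
          0 < CostChannel.outputDensity CostChannel.expChannel Q x y ∧
          CostChannel.outputDensity CostChannel.expChannel Q x y < ∞ ∧
          CostChannel.tiltedDensity a CostChannel.expChannel CostChannel.expCost β Q x y =
            Real.logb a (1 + β) +
              β / (1 + β) * ((x : ℝ) - y + 1) * Real.logb a (Real.exp 1)) ∧
        (∀ᵐ y ∂Q, y < (x : ℝ) →
          CostChannel.outputDensity CostChannel.expChannel Q x y = 0)) ∧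
      -- the conditional variance, uniformly over the inputs
      (∀ x : ℝ≥0,
        variance (CostChannel.tiltedDensity a CostChannel.expChannel CostChannel.expCost β Q x)
            (CostChannel.expChannel x) =
          β ^ 2 / (1 + β) ^ 2 * Real.logb a (Real.exp 1) ^ 2) ∧
      -- capacity and dispersion as mean and variance of the `b`-tilted information density
      (∀ P : Measure ℝ≥0,
        CostChannel.IsOptimalInput a CostChannel.expChannel CostChannel.expCost β P →
        ∫ p, CostChannel.tiltedDensity a CostChannel.expChannel CostChannel.expCost β Q p.1 p.2
            ∂(P ⊗ₘ CostChannel.expChannel) = Real.logb a (1 + β) ∧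
        variance
            (fun p : ℝ≥0 × ℝ =>
              CostChannel.tiltedDensity a CostChannel.expChannel CostChannel.expCost β Q p.1 p.2)
            (P ⊗ₘ CostChannel.expChannel) =
          β ^ 2 / (1 + β) ^ 2 * Real.logb a (Real.exp 1) ^ 2) ∧
      -- the regularity conditions, with a bounded sequence
      ∃ f : ℕ → ℝ, f =O[atTop] (fun _ : ℕ => (1 : ℝ)) ∧
        CostChannel.AbstractAlphabetConditions a CostChannel.expChannel CostChannel.expCost β Q f
    := by
  have hV : (β / (1 + β) * Real.logb a (Real.exp 1)) ^ 2 =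
      β ^ 2 / (1 + β) ^ 2 * Real.logb a (Real.exp 1) ^ 2 := by rw [mul_pow, div_pow]
  refine ⟨CostChannel.capacityCost_exp ha hβ,
    (CostChannel.hasDerivAt_capacityReal ha hβ).differentiableAt,
    fun n ε hn hε hε1 => ⟨⟨1, CostChannel.codeExists_one hβ hn⟩,
      CostChannel.bddAbove_codeExists hβ hn hε.le hε1⟩,
    CostChannel.isDispersion_exp ha hβ, CostChannel.isOptimalOutput_iff ha hβ, fun Q hQ => ?_⟩
  obtain rfl := (CostChannel.isOptimalOutput_iff ha hβ Q).1 hQ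
  refine ⟨fun x => ⟨CostChannel.expChannel_absolutelyContinuous hβ x, ?_, ?_⟩, fun x => ?_,
    fun P hP => ?_, CostChannel.exists_abstractAlphabetConditions ha hβ⟩
  · filter_upwards [CostChannel.outputDensity_ae_eq hβ x] with y hy hle
    refine ⟨?_, ?_, CostChannel.tiltedDensity_eq ha hβ hle hy⟩
    · rw [hy, CostChannel.expDensity, if_pos hle, ENNReal.ofReal_pos]
      positivity
    · rw [hy, CostChannel.expDensity, if_pos hle]
      exact ENNReal.ofReal_lt_top
  · filter_upwards [CostChannel.outputDensity_ae_eq hβ x] with y hy hlt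
    rw [hy, CostChannel.expDensity, if_neg hlt.not_ge]
  · rw [← hV]
    exact (CostChannel.mean_variance_of_law (by fun_prop) (CostChannel.map_sub_expChannel x)
      (CostChannel.tiltedDensity_ae_eq ha hβ x)).2
  · have := hP.1.1
    rw [← hV]
    exact CostChannel.mean_variance_of_law (by fun_prop) (CostChannel.map_sub_compProd P)
      (CostChannel.tiltedDensity_compProd_ae_eq ha hβ P)
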